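/- Let $d\ge 1$ be an integer and $p>0$ a real number such that either $d\in\{1,2\}$ and $p<d/2$, or $d\ge 3$ and $p\le 1$. Let $|\cdot|$ be the Euclidean norm on $\mathbb R^d$. For finite families $\mathcal X=(x_1,\dots,x_m)$ and $\mathcal Y=(y_1,\dots,y_n)$ of points of $\mathbb R^d$ let $M_p(\mathcal X,\mathcal Y)$ be the minimal bipartite matching cost: if $m\le n$, $$M_p(\mathcal X,\mathcal Y)=\min_{\sigma}\sum_{i=1}^m|x_i-y_{\sigma(i)}|^p,$$ the minimum being over all injections $\sigma:\{1,\dots,m\}\to\{1,\dots,n\}$, and $M_p(\mathcal X,\mathcal Y)=M_p(\mathcal Y,\mathcal X)$ if $m>n$. For $Q=[0,1]^d$ and families $\mathcal X,\mathcal Y$ of points of $Q$, let the boundary matching cost be $$M_{p,\partial Q}(\mathcal X,\mathcal Y)=\min_{A,B,\sigma}\Big\{\sum_{i\in A}|x_i-y_{\sigma(i)}|^p+q\sum_{i\notin A}d(x_i,\partial Q)^p+q\sum_{j\notin B}d(y_j,\partial Q)^p\Big\},\qquad q=\min(2^{p-1},1),$$ the minimum being over all $A\subset\{1,\dots,m\}$,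 $B\subset\{1,\dots,n\}$ of the same cardinality and all bijections $\sigma:A\to B$. For a finite measure $\nu$ on $\mathbb R^d$ and $L\in\{M_p,M_{p,\partial Q}\}$, let $\mathbb E L(\nu)\in[0,\infty]$ denote the expectation of $L(\mathcal X,\mathcal Y)$ when $\mathcal X,\mathcal Y$ are independent Poisson point processes with intensity $\nu$ (for $M_{p,\partial Q}$, $\nu$ being supported in $Q$). Below, limits are taken as the real parameter $t\to+\infty$. Then the limits $$\beta=\lim_{t\to\infty}\frac{\mathbb E M_p(t\mathbf 1_{[0,1]^d}\,dx)}{t^{1-p/d}},\qquad \beta'=\lim_{t\to\infty}\frac{\mathbb E M_{p,\partial [0,1]^d}(t\mathbf 1_{[0,1]^d}\,dx)}{t^{1-p/d}}$$ exist and are finite and positive (they depend only on $p$ and $d$), and the following holds. Let $\mu$ be a finite Borel measure on $\mathbb R^d$, possibly with a singular part and with unbounded support, such that $\int|x|^\alpha\,d\mu(x)<\infty$ for some $\alpha>\frac{2dp}{d-2p}$, and let $f$ be the density of the absolutely continuous part of $\mu$. Then $$\liminf_{t\to\infty}\frac{\mathbb E M_p(t\mu)}{t^{1-p/d}}\ \ge\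 \beta'\int_{\mathbb R^d}f^{1-p/d}\,dx .$$ If moreover $f$ is almost everywhere equal to $c\,\mathbf 1_\Omega$ for a constant $c\ge 0$ and a bounded measurable set $\Omega\subset\mathbb R^d$ of positive Lebesgue measure, then $$\lim_{t\to\infty}\frac{\mathbb E M_p(t\mu)}{t^{1-p/d}}=\beta\int_{\mathbb R^d}f^{1-p/d}\,dx .$$ -/

import Mathlib

open MeasureTheory Filter Topology
open scoped ENNReal NNReal

namespace BipartiteMatching

/-- The Euclidean space of dimension `d`, with its Euclidean norm and Lebesgue measure. -/
abbrev Pt (d : ℕ) : Type := EuclideanSpace ℝ (Fin d)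

/-- A functional of two finite families of points (all those used below are invariant under
relabelling, so they are functionals of two finite multisets). -/
abbrev BipartiteFunctional (d : ℕ) : Type :=
  (m n : ℕ) → (Fin m → Pt d) → (Fin n → Pt d) → ℝ

/-- The minimal bipartite matching cost with power `p`: all the points of the smaller family are
matched, injectively, to points of the larger one. The index types are finite and nonempty, so the
infimum is a minimum. -/
noncomputable def matchingCost (d : ℕ) (p : ℝ) : BipartiteFunctional d :=
  fun m n X Y =>
    if m ≤ n then ⨅ σ : Fin m ↪ Fin n, ∑ i, ‖X i - Y (σ i)‖ ^ p
    else ⨅ σ : Fin n ↪ Fin m, ∑ j, ‖X (σ j) - Y j‖ ^ p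

/-- The boundary matching cost on a set `S`: a partial matching is a bijection `σ` from a subset
`A` of the first index set to a subset `B` of the second one; each unmatched point pays
`q * d(point, ∂S) ^ p` with `q = min (2 ^ (p - 1)) 1`. -/
noncomputable def boundaryMatchingCost (d : ℕ) (p : ℝ) (S : Set (Pt d)) : BipartiteFunctional d :=
  fun m n X Y =>
    ⨅ τ : (A : Finset (Fin m)) × (B : Finset (Fin n)) × (A ≃ B),
      ((∑ i : τ.1, ‖X i - Y (τ.2.2 i)‖ ^ p)
        + (∑ i ∈ τ.1ᶜ, min ((2 : ℝ) ^ (p - 1)) 1 * Metric.infDist (X i) (frontier S) ^ p)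
        + ∑ j ∈ τ.2.1ᶜ, min ((2 : ℝ) ^ (p - 1)) 1 * Metric.infDist (Y j) (frontier S) ^ p)

/-- The law of the Poisson point process whose intensity is the finite measure `ν`, on finite
families of points. Its restriction to families of size `k` is
`e ^ (-|ν|) / k! • ν ^ ⊗ k = (e ^ (-|ν|) * |ν| ^ k / k!) • (ν / |ν|) ^ ⊗ k`:
the number of points is Poisson of parameter `|ν|`, and given that number the points are
independent with distribution `ν / |ν|`. -/
noncomputable def poissonLaw {d : ℕ} (ν : Measure (Pt d)) : Measure (Σ k : ℕ, (Fin k → Pt d)) :=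
  Measure.sum fun k : ℕ =>
    ENNReal.ofReal (Real.exp (-(ν.real Set.univ)) / (Nat.factorial k : ℝ)) •
      (Measure.pi fun _ : Fin k => ν).map fun X => ⟨k, X⟩

/-- The law of a Poisson point process with finite intensity is a probability measure. -/
theorem isProbabilityMeasure_poissonLaw {d : ℕ} (ν : Measure (Pt d)) [IsFiniteMeasure ν] :
    IsProbabilityMeasure (poissonLaw ν) := by
  constructor
  have hk : ∀ k : ℕ, Measurable (fun X : Fin k → Pt d => (⟨k, X⟩ : Σ k : ℕ, (Fin k → Pt d))) :=
    fun k s hs => MeasurableSpace.measurableSet_iInf.1 hs k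
  have hterm : ∀ k : ℕ,
      (ENNReal.ofReal (Real.exp (-(ν.real Set.univ)) / (Nat.factorial k : ℝ)) •
        (Measure.pi fun _ : Fin k => ν).map (fun X => (⟨k, X⟩ : Σ k : ℕ, (Fin k → Pt d)))) Set.univ
      = ENNReal.ofReal (Real.exp (-(ν.real Set.univ)) *
          ((ν.real Set.univ) ^ k / (Nat.factorial k : ℝ))) := by
    intro k
    rw [Measure.smul_apply, Measure.map_apply (hk k) MeasurableSet.univ, Set.preimage_univ,
      Measure.pi_univ]
    simp only [Finset.prod_const, Finset.card_univ, Fintype.card_fin, smul_eq_mul]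
    rw [← ofReal_measureReal (μ := ν) (s := Set.univ),
      ← ENNReal.ofReal_pow measureReal_nonneg, ← ENNReal.ofReal_mul (by positivity)]
    congr 1
    ring
  rw [poissonLaw, Measure.sum_apply _ MeasurableSet.univ]
  simp_rw [hterm]
  rw [← ENNReal.ofReal_tsum_of_nonneg (fun k => by positivity)
    ((Real.summable_pow_div_factorial _).mul_left _), tsum_mul_left]
  have h := congrFun Real.exp_eq_exp_ℝ (ν.real Set.univ)
  rw [NormedSpace.exp_eq_tsum_div] at h
  beta_reduce at h
  rw [← h, ← Real.exp_add]
  simp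

/-- `E L(ν)`: the expectation (with values in `[0, ∞]`) of the nonnegative functional `L` at two
independent Poisson point processes with intensity `ν`. -/
noncomputable def poissonExpectation {d : ℕ} (L : BipartiteFunctional d) (ν : Measure (Pt d)) :
    ℝ≥0∞ :=
  ∫⁻ Z, ENNReal.ofReal (L Z.1.1 Z.2.1 Z.1.2 Z.2.2) ∂((poissonLaw ν).prod (poissonLaw ν))

/-- The ratio `E L(tμ) / t ^ (1 - p / d)`. -/
noncomputable def scaledExpectation {d : ℕ} (p : ℝ) (L : BipartiteFunctional d)
    (μ : Measure (Pt d)) (t : ℝ) : ℝ≥0∞ :=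
  poissonExpectation L (ENNReal.ofReal t • μ) / ENNReal.ofReal (t ^ (1 - p / (d : ℝ)))

/-- The closed unit cube. -/
def unitCube (d : ℕ) : Set (Pt d) := {x | ∀ i, x i ∈ Set.Icc (0 : ℝ) 1}

end BipartiteMatching

/-! In every admissible case p ≤ 1 and p < d/2. The first makes |x - y|^p a distance; the second
makes errors of order √t negligible against t^(1-p/d).

The cost M_p is not subadditive, because the two families have different sizes. It is compared with
`transportCost`, where every partial matching is allowed and an unmatched point x pays an exit price
h(x). For h(x) = |x|^p (exit at the origin) this dominates M_p
(`fullMatchingCost_le_transportCost`), and it exceeds M_p at most by the exit price of the surplus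
points, of which there are O(√t) on average (`poissonMean₂_cardDist_le`). The moment hypothesis,
with a truncation at radius t^(1/(2α)), makes this excess o(t^(1-p/d))
(`originScaled_le_scaledExpectation_add`). For h = q d(x,∂Q)^p one gets the boundary cost itself.

Let T(ν) be the expected transport cost at intensity ν. Superposition of Poisson processes turns
unions of matchings into T(μ+ν) ≤ T(μ) + T(ν) (`transportMean_add_le`). The triangle inequality
allows points to be deleted, so T(μ) ≤ T(μ+ν) + T(ν) (`transportMean_le_add`). If two points of
different cells never pay more for leaving than for being matched, T is superadditive over the cells
(`sum_transportMean_le`).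

The quantitative input is T(ν) ≤ C s^p |ν|^(1-p/d) for every ν carried by the ball of radius s
(`exists_originMean_ball_le`), |ν| being the total mass. It comes from matching scale by scale in
dyadic cubes; since p < d/2 the finest scale dominates. The bound is uniform in ν, so the scaled
cost is stable under small changes of the intensity.

Cutting the cube into m^d similar cubes makes the scaled boundary cost exactly monotone along s ↦
m^d s, and the scaled origin cost monotone the other way up to a vanishing error. With continuity in
t this yields both limits (`exists_tendsto_scaledMean`). The limit β' is at least the ratio at t =
1, which is positive, and β ≥ β'.

For a general μ, tails are summed over dyadic annuli (`exists_tail_le`). The singular part costs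
nothing in the limit, because up to small mass it lives on a compact set covered by cells of small
total volume (`eventually_originScaled_le_of_ball`). The density is approximated in L¹ by step
functions (`exists_stepMeasure_approx`), for which superadditivity gives β' as a lower constant and
subadditivity gives β as an upper one. For a uniform density on Ω, Ω is placed in a box, where the
limit is exactly β; subtracting the upper bound for the complement of Ω gives the matching lower
bound (`tendsto_originScaled_indicator`). -/

namespace BipartiteMatching

/-! ### Partial matchings of finite multisets and their costs -/

/-- A partial matching of two finite multisets: some matched pairs, and unmatched points. -/
@[ext]
structure PartialMatching {α β : Type*} (X : Multiset α) (Y : Multiset β) where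
  pairs : Multiset (α × β)
  left : Multiset α
  right : Multiset β
  fst_eq : X = pairs.map Prod.fst + left
  snd_eq : Y = pairs.map Prod.snd + right

namespace PartialMatching

variable {α β : Type*}

/-- The cost of a partial matching, when unmatched points pay `h` or `k`. -/
noncomputable def cost {X : Multiset α} {Y : Multiset β} (M : PartialMatching X Y)
    (c : α → β → ℝ≥0∞) (h : α → ℝ≥0∞) (k : β → ℝ≥0∞) : ℝ≥0∞ :=
  (M.pairs.map fun z => c z.1 z.2).sum + (M.left.map h).sum + (M.right.map k).sum

/-- The union of two partial matchings. -/
@[simps]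
def add {X X' : Multiset α} {Y Y' : Multiset β} (M : PartialMatching X Y)
    (M' : PartialMatching X' Y') : PartialMatching (X + X') (Y + Y') where
  pairs := M.pairs + M'.pairs
  left := M.left + M'.left
  right := M.right + M'.right
  fst_eq := (congrArg₂ (· + ·) M.fst_eq M'.fst_eq).trans (by rw [Multiset.map_add]; abel)
  snd_eq := (congrArg₂ (· + ·) M.snd_eq M'.snd_eq).trans (by rw [Multiset.map_add]; abel)

/-- The matching without pairs. -/
@[simps]
def empty (X : Multiset α) (Y : Multiset β) : PartialMatching X Y where
  pairs := 0
  left := X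
  right := Y
  fst_eq := by simp
  snd_eq := by simp

/-- The reversed matching. -/
@[simps]
def symm {X : Multiset α} {Y : Multiset β} (M : PartialMatching X Y) : PartialMatching Y X where
  pairs := M.pairs.map Prod.swap
  left := M.right
  right := M.left
  fst_eq := by rw [Multiset.map_map]; exact M.snd_eq
  snd_eq := by rw [Multiset.map_map]; exact M.fst_eq

/-- The image of a matching. -/
@[simps]
def map {α' β' : Type*} (f : α → α') (g : β → β') {X : Multiset α} {Y : Multiset β}
    (M : PartialMatching X Y) : PartialMatching (X.map f) (Y.map g) where
  pairs := M.pairs.map (Prod.map f g)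
  left := M.left.map f
  right := M.right.map g
  fst_eq := by
    conv_lhs => rw [M.fst_eq]
    simp [Multiset.map_map]
  snd_eq := by
    conv_lhs => rw [M.snd_eq]
    simp [Multiset.map_map]

/-- Induction on the pairs: each one has preimages in `X` and `Y`, which can be erased. Every
matching of the images therefore lifts, so costs of images are pulled-back costs. -/
theorem exists_lift_aux {α' β' : Type*} (f : α → α') (g : β → β')
    (P : Multiset (α' × β')) : ∀ (X : Multiset α) (Y : Multiset β) (U : Multiset α')
      (V : Multiset β'), X.map f = P.map Prod.fst + U → Y.map g = P.map Prod.snd + V →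
      ∃ M : PartialMatching X Y, M.pairs.map (Prod.map f g) = P ∧ M.left.map f = U ∧
        M.right.map g = V := by
  classical
  induction P using Multiset.induction with
  | empty =>
    intro X Y U V hU hV
    exact ⟨empty X Y, by simp, by simpa using hU, by simpa using hV⟩
  | cons z P ih =>
    intro X Y U V hU hV
    rw [Multiset.map_cons, Multiset.cons_add] at hU hV
    obtain ⟨x, hx, hxz, hX⟩ := (Multiset.map_eq_cons f X _ _).2 hU
    obtain ⟨y, hy, hyz, hY⟩ := (Multiset.map_eq_cons g Y _ _).2 hV
    obtain ⟨M, h1, h2, h3⟩ := ih _ _ U V hX hY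
    refine ⟨⟨(x, y) ::ₘ M.pairs, M.left, M.right, ?_, ?_⟩, ?_, h2, h3⟩
    · rw [Multiset.map_cons, Multiset.cons_add, ← M.fst_eq, Multiset.cons_erase hx]
    · rw [Multiset.map_cons, Multiset.cons_add, ← M.snd_eq, Multiset.cons_erase hy]
    · rw [Multiset.map_cons, h1]
      simp [Prod.map, hxz, hyz]

theorem exists_map_eq {α' β' : Type*} (f : α → α') (g : β → β') {X : Multiset α}
    {Y : Multiset β} (M : PartialMatching (X.map f) (Y.map g)) :
    ∃ N : PartialMatching X Y, N.map f g = M := by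
  obtain ⟨N, h1, h2, h3⟩ := exists_lift_aux f g M.pairs X Y M.left M.right M.fst_eq M.snd_eq
  exact ⟨N, by ext1 <;> simpa⟩

/-- Makes the infimum over matchings of indices a countable one, hence measurable in the positions.
-/
instance [Countable α] [Countable β] (X : Multiset α) (Y : Multiset β) :
    Countable (PartialMatching X Y) := by
  have : Function.Injective
      (fun M : PartialMatching X Y => (M.pairs, M.left, M.right)) := by
    intro M N h
    simp only [Prod.mk.injEq] at h
    exact PartialMatching.ext h.1 h.2.1 h.2.2
  exact this.countable

end PartialMatching

variable {α β : Type*}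

/-- The minimal cost of a partial matching, when unmatched points pay `h` or `k`. -/
noncomputable def transportCost (c : α → β → ℝ≥0∞) (h : α → ℝ≥0∞) (k : β → ℝ≥0∞)
    (X : Multiset α) (Y : Multiset β) : ℝ≥0∞ :=
  ⨅ M : PartialMatching X Y, M.cost c h k

/-- The minimal cost of a matching of the smaller multiset into the larger one. -/
noncomputable def fullMatchingCost (c : α → β → ℝ≥0∞) (X : Multiset α) (Y : Multiset β) : ℝ≥0∞ :=
  ⨅ (M : PartialMatching X Y) (_ : M.left = 0 ∨ M.right = 0),
    (M.pairs.map fun z => c z.1 z.2).sum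

theorem transportCost_le {c : α → β → ℝ≥0∞} {h : α → ℝ≥0∞} {k : β → ℝ≥0∞}
    {X : Multiset α} {Y : Multiset β} (M : PartialMatching X Y) :
    transportCost c h k X Y ≤ M.cost c h k := iInf_le _ M

/-- With `f` and `g` families of points, this moves the infimum to matchings of the indices, a set
which does not depend on the points. -/
theorem transportCost_map {α' β' : Type*} (f : α → α') (g : β → β') (c : α' → β' → ℝ≥0∞)
    (h : α' → ℝ≥0∞) (k : β' → ℝ≥0∞) (X : Multiset α) (Y : Multiset β) :
    transportCost c h k (X.map f) (Y.map g) =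
      transportCost (fun x y => c (f x) (g y)) (h ∘ f) (k ∘ g) X Y := by
  have key : ∀ N : PartialMatching X Y, (N.map f g).cost c h k =
      N.cost (fun x y => c (f x) (g y)) (h ∘ f) (k ∘ g) := by
    intro N
    simp [PartialMatching.cost, Multiset.map_map]
  apply le_antisymm
  · exact le_iInf fun N => (transportCost_le (N.map f g)).trans (key N).le
  · refine le_iInf fun M => ?_
    obtain ⟨N, rfl⟩ := M.exists_map_eq f g
    exact (transportCost_le N).trans (key N).ge

theorem fullMatchingCost_map {α' β' : Type*} (f : α → α') (g : β → β') (c : α' → β' → ℝ≥0∞)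
    (X : Multiset α) (Y : Multiset β) :
    fullMatchingCost c (X.map f) (Y.map g) =
      fullMatchingCost (fun x y => c (f x) (g y)) X Y := by
  apply le_antisymm
  · refine le_iInf₂ fun N hN => (iInf₂_le (N.map f g) ?_).trans (le_of_eq ?_)
    · simpa using hN
    · simp [Multiset.map_map]
  · refine le_iInf₂ fun M hM => ?_
    obtain ⟨N, rfl⟩ := M.exists_map_eq f g
    refine (iInf₂_le N ?_).trans (le_of_eq ?_)
    · simpa using hM
    · simp [Multiset.map_map]

theorem transportCost_const_mul {a : ℝ≥0∞} (ha0 : a ≠ 0) (ha : a ≠ ∞) (c : α → β → ℝ≥0∞)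
    (h : α → ℝ≥0∞) (k : β → ℝ≥0∞) (X : Multiset α) (Y : Multiset β) :
    transportCost (fun x y => a * c x y) (fun x => a * h x) (fun y => a * k y) X Y =
      a * transportCost c h k X Y := by
  rw [transportCost, transportCost, ENNReal.mul_iInf_of_ne ha0 ha]
  simp [PartialMatching.cost, Multiset.sum_map_mul_left, mul_add]

theorem transportCost_symm (c : α → β → ℝ≥0∞) (h : α → ℝ≥0∞) (k : β → ℝ≥0∞)
    (X : Multiset α) (Y : Multiset β) :
    transportCost c h k X Y = transportCost (fun y x => c x y) k h Y X := by
  apply le_antisymm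
  · refine le_iInf fun M => (transportCost_le M.symm).trans (le_of_eq ?_)
    simp [PartialMatching.cost, Multiset.map_map, add_right_comm]
  · refine le_iInf fun M => (transportCost_le M.symm).trans (le_of_eq ?_)
    simp [PartialMatching.cost, Multiset.map_map, add_right_comm]

theorem transportCost_le_sum (c : α → β → ℝ≥0∞) (h : α → ℝ≥0∞) (k : β → ℝ≥0∞)
    (X : Multiset α) (Y : Multiset β) :
    transportCost c h k X Y ≤ (X.map h).sum + (Y.map k).sum :=
  (transportCost_le (PartialMatching.empty X Y)).trans (by simp [PartialMatching.cost])

theorem transportCost_add_le (c : α → β → ℝ≥0∞) (h : α → ℝ≥0∞) (k : β → ℝ≥0∞)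
    (X X' : Multiset α) (Y Y' : Multiset β) :
    transportCost c h k (X + X') (Y + Y') ≤
      transportCost c h k X Y + transportCost c h k X' Y' := by
  simp_rw [transportCost, ENNReal.iInf_add, ENNReal.add_iInf]
  refine le_iInf₂ fun M M' => (iInf_le _ (M.add M')).trans (le_of_eq ?_)
  simp only [PartialMatching.cost, PartialMatching.add_pairs, PartialMatching.add_left,
    PartialMatching.add_right, Multiset.map_add, Multiset.sum_add]
  ac_rfl

/-- A matching that uses `z` on both sides is rerouted. If `z` has a partner on each side, the two
partners are joined by the triangle inequality; if it has only one, that partner exits, at the price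
of the pair plus the exit of `z`. -/
theorem transportCost_le_cons_cons {c : α → α → ℝ≥0∞} {h k : α → ℝ≥0∞}
    (htri : ∀ x y z, c x z ≤ c x y + c y z) (hh : ∀ x y, h x ≤ c x y + h y)
    (hk : ∀ x y, k y ≤ k x + c x y) (z : α) (X Y : Multiset α) :
    transportCost c h k X Y ≤ transportCost c h k (z ::ₘ X) (z ::ₘ Y) := by
  classical
  refine le_iInf fun ⟨P, U, V, hX, hY⟩ => ?_
  simp only [PartialMatching.cost]
  have h1 : z ∈ P.map Prod.fst + U := hX ▸ Multiset.mem_cons_self z X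
  have h2 : z ∈ P.map Prod.snd + V := hY ▸ Multiset.mem_cons_self z Y
  rw [Multiset.mem_add] at h1 h2
  rcases h1 with h1 | h1
  · obtain ⟨⟨z', y⟩, hP, rfl⟩ := Multiset.mem_map.1 h1
    obtain ⟨P, rfl⟩ := Multiset.exists_cons_of_mem hP
    simp only [Multiset.map_cons, Multiset.cons_add, Multiset.cons_inj_right] at hX
    rcases h2 with h2 | h2
    · obtain ⟨⟨x, z''⟩, hP2, hz⟩ := Multiset.mem_map.1 h2
      simp only at hz
      subst hz
      rw [Multiset.mem_cons] at hP2
      rcases hP2 with hP2 | hP2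
      -- The two copies of `z` are matched with each other: the pair is dropped.
      · obtain ⟨rfl, rfl⟩ := Prod.mk.inj hP2
        simp only [Multiset.map_cons, Multiset.cons_add, Multiset.cons_inj_right] at hY
        refine (transportCost_le ⟨P, U, V, hX, hY⟩).trans ?_
        simp only [PartialMatching.cost, Multiset.map_cons, Multiset.sum_cons]
        gcongr
        exact le_add_self
      · obtain ⟨P, rfl⟩ := Multiset.exists_cons_of_mem hP2
        simp only [Multiset.map_cons, Multiset.cons_add] at hX hY
        rw [Multiset.cons_swap, Multiset.cons_inj_right] at hY
        refine (transportCost_le ⟨(x, y) ::ₘ P, U, V, by simpa using hX, by simpa using hY⟩).trans ?_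
        simp only [PartialMatching.cost, Multiset.map_cons, Multiset.sum_cons]
        calc _ ≤ (c x z'' + c z'' y) + (P.map fun z => c z.1 z.2).sum + (U.map h).sum
              + (V.map k).sum := by gcongr; exact htri _ _ _
          _ = _ := by ac_rfl
    -- The left copy is matched with `y` and the right copy exits: now `y` exits.
    · obtain ⟨V, rfl⟩ := Multiset.exists_cons_of_mem h2
      simp only [Multiset.map_cons, Multiset.cons_add] at hY
      rw [Multiset.add_cons, Multiset.cons_swap, Multiset.cons_inj_right] at hY
      refine (transportCost_le ⟨P, U, y ::ₘ V, hX, by simpa using hY⟩).trans ?_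
      simp only [PartialMatching.cost, Multiset.map_cons, Multiset.sum_cons]
      calc _ ≤ (P.map fun z => c z.1 z.2).sum + (U.map h).sum
              + ((k z' + c z' y) + (V.map k).sum) := by gcongr; exact hk _ _
        _ = _ := by ac_rfl
  · obtain ⟨U, rfl⟩ := Multiset.exists_cons_of_mem h1
    rw [Multiset.add_cons, Multiset.cons_inj_right] at hX
    rcases h2 with h2 | h2
    · obtain ⟨⟨x, z'⟩, hP, rfl⟩ := Multiset.mem_map.1 h2
      obtain ⟨P, rfl⟩ := Multiset.exists_cons_of_mem hP
      simp only [Multiset.map_cons, Multiset.cons_add] at hX hY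
      rw [Multiset.cons_inj_right] at hY
      refine (transportCost_le ⟨P, x ::ₘ U, V, by simpa using hX, hY⟩).trans ?_
      simp only [PartialMatching.cost, Multiset.map_cons, Multiset.sum_cons]
      calc _ ≤ (P.map fun z => c z.1 z.2).sum + ((c x z' + h z') + (U.map h).sum)
              + (V.map k).sum := by gcongr; exact hh _ _
        _ = _ := by ac_rfl
    · obtain ⟨V, rfl⟩ := Multiset.exists_cons_of_mem h2
      rw [Multiset.add_cons, Multiset.cons_inj_right] at hY
      refine (transportCost_le ⟨P, U, V, hX, hY⟩).trans ?_
      simp only [PartialMatching.cost, Multiset.map_cons, Multiset.sum_cons]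
      gcongr <;> exact le_add_self

theorem transportCost_le_add_add {c : α → α → ℝ≥0∞} {h k : α → ℝ≥0∞}
    (htri : ∀ x y z, c x z ≤ c x y + c y z) (hh : ∀ x y, h x ≤ c x y + h y)
    (hk : ∀ x y, k y ≤ k x + c x y) (Z X Y : Multiset α) :
    transportCost c h k X Y ≤ transportCost c h k (Z + X) (Z + Y) := by
  induction Z using Multiset.induction with
  | empty => simp
  | cons z Z ih =>
    rw [Multiset.cons_add, Multiset.cons_add]
    exact ih.trans (transportCost_le_cons_cons htri hh hk z _ _)

/-- For a symmetric cost which satisfies the triangle inequality, removing points changes the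
transport cost by at most the transport cost of the removed points. -/
theorem transportCost_le_add {c : α → α → ℝ≥0∞} {h : α → ℝ≥0∞}
    (hsymm : ∀ x y, c x y = c y x)
    (htri : ∀ x y z, c x z ≤ c x y + c y z) (hh : ∀ x y, h x ≤ c x y + h y)
    (X X' Y Y' : Multiset α) :
    transportCost c h h X Y ≤
      transportCost c h h (X + X') (Y + Y') + transportCost c h h X' Y' := by
  have h1 := transportCost_le_add_add htri hh
    (fun x y => by rw [hsymm, add_comm]; exact hh y x) (X' + Y') X Y
  -- The points added to both sides are `X' + Y'`; the enlarged families split into (X + X', Y + Y')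
  -- and (Y', X'), and the last cost is symmetric.
  have h2 := transportCost_add_le c h h (X + X') Y' (Y + Y') X'
  rw [show X + X' + Y' = X' + Y' + X by abel, show Y + Y' + X' = X' + Y' + Y by abel] at h2
  have h3 := transportCost_symm c h h Y' X'
  rw [funext₂ fun x y => hsymm y x] at h3
  exact h1.trans (h2.trans (by rw [h3]))

/-- A pair that crosses the boundary of `A` is cut, and its two ends exit on their own sides; by
assumption the price of the pair covers both exits. The other pairs are kept. -/
theorem exists_split_pairs {c : α → α → ℝ≥0∞} {h : α → ℝ≥0∞} (A : Set α) [DecidablePred (· ∈ A)]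
    (P : Multiset (α × α)) :
    (∀ z ∈ P, z.1 ∈ A → z.2 ∉ A → h z.1 + h z.2 ≤ c z.1 z.2) →
    (∀ z ∈ P, z.1 ∉ A → z.2 ∈ A → h z.1 + h z.2 ≤ c z.1 z.2) →
    ∃ (M : PartialMatching ((P.map Prod.fst).filter (· ∈ A)) ((P.map Prod.snd).filter (· ∈ A)))
      (N : PartialMatching ((P.map Prod.fst).filter (· ∉ A)) ((P.map Prod.snd).filter (· ∉ A))),
      M.cost c h h + N.cost c h h ≤ (P.map fun z => c z.1 z.2).sum := by
  induction P using Multiset.induction with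
  | empty =>
    intro _ _
    exact ⟨⟨0, 0, 0, by simp, by simp⟩, ⟨0, 0, 0, by simp, by simp⟩,
      by simp [PartialMatching.cost]⟩
  | cons z P ih =>
    intro h1 h2
    obtain ⟨⟨P1, U1, V1, hX1, hY1⟩, ⟨P2, U2, V2, hX2, hY2⟩, hc⟩ :=
      ih (fun w hw => h1 w (Multiset.mem_cons_of_mem hw))
        (fun w hw => h2 w (Multiset.mem_cons_of_mem hw))
    have h1 := h1 z (Multiset.mem_cons_self _ _)
    have h2 := h2 z (Multiset.mem_cons_self _ _)
    simp only [PartialMatching.cost] at hc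
    by_cases hz1 : z.1 ∈ A <;> by_cases hz2 : z.2 ∈ A
    · refine ⟨⟨z ::ₘ P1, U1, V1, by simp [hz1, hX1], by simp [hz2, hY1]⟩,
        ⟨P2, U2, V2, by simp [hz1, hX2], by simp [hz2, hY2]⟩, ?_⟩
      simp only [PartialMatching.cost, Multiset.map_cons, Multiset.sum_cons]
      refine le_trans (le_of_eq ?_) (add_le_add_right hc (c z.1 z.2))
      ac_rfl
    · refine ⟨⟨P1, z.1 ::ₘ U1, V1, by simp [hz1, hX1], by simp [hz2, hY1]⟩,
        ⟨P2, U2, z.2 ::ₘ V2, by simp [hz1, hX2], by simp [hz2, hY2]⟩, ?_⟩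
      simp only [PartialMatching.cost, Multiset.map_cons, Multiset.sum_cons]
      refine le_trans (le_of_eq ?_) (add_le_add (h1 hz1 hz2) hc)
      ac_rfl
    · refine ⟨⟨P1, U1, z.2 ::ₘ V1, by simp [hz1, hX1], by simp [hz2, hY1]⟩,
        ⟨P2, z.1 ::ₘ U2, V2, by simp [hz1, hX2], by simp [hz2, hY2]⟩, ?_⟩
      simp only [PartialMatching.cost, Multiset.map_cons, Multiset.sum_cons]
      refine le_trans (le_of_eq ?_) (add_le_add (h2 hz1 hz2) hc)
      ac_rfl
    · refine ⟨⟨P1, U1, V1, by simp [hz1, hX1], by simp [hz2, hY1]⟩,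
        ⟨z ::ₘ P2, U2, V2, by simp [hz1, hX2], by simp [hz2, hY2]⟩, ?_⟩
      simp only [PartialMatching.cost, Multiset.map_cons, Multiset.sum_cons]
      refine le_trans (le_of_eq ?_) (add_le_add_right hc (c z.1 z.2))
      ac_rfl

/-- If matching across `A` costs at least as much as not matching, the transport cost is
superadditive for the decomposition into points of `A` and points of the complement. -/
theorem add_transportCost_le {c : α → α → ℝ≥0∞} {h : α → ℝ≥0∞} {A : Set α}
    {X X' Y Y' : Multiset α} (hX : ∀ x ∈ X, x ∈ A) (hY : ∀ x ∈ Y, x ∈ A)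
    (hX' : ∀ x ∈ X', x ∉ A) (hY' : ∀ x ∈ Y', x ∉ A)
    (h1 : ∀ x ∈ X, ∀ y ∈ Y', h x + h y ≤ c x y) (h2 : ∀ x ∈ X', ∀ y ∈ Y, h x + h y ≤ c x y) :
    transportCost c h h X Y + transportCost c h h X' Y' ≤
      transportCost c h h (X + X') (Y + Y') := by
  classical
  refine le_iInf fun ⟨P, U, V, hXX, hYY⟩ => ?_
  have hm : ∀ z ∈ P, z.1 ∈ X + X' ∧ z.2 ∈ Y + Y' := fun z hz => by
    rw [hXX, hYY, Multiset.mem_add, Multiset.mem_add]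
    exact ⟨Or.inl (Multiset.mem_map_of_mem _ hz), Or.inl (Multiset.mem_map_of_mem _ hz)⟩
  obtain ⟨⟨P1, U1, V1, hX1, hY1⟩, ⟨P2, U2, V2, hX2, hY2⟩, hc⟩ :=
    exists_split_pairs (c := c) (h := h) A P
    (fun z hz hz1 hz2 => by
      obtain ⟨hx, hy⟩ := hm z hz
      rw [Multiset.mem_add] at hx hy
      exact h1 _ (hx.resolve_right fun hx => hX' _ hx hz1) _
        (hy.resolve_left fun hy => hz2 (hY _ hy)))
    (fun z hz hz1 hz2 => by
      obtain ⟨hx, hy⟩ := hm z hz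
      rw [Multiset.mem_add] at hx hy
      exact h2 _ (hx.resolve_left fun hx => hz1 (hX _ hx)) _
        (hy.resolve_right fun hy => hY' _ hy hz2))
  have eA : ∀ {W W' : Multiset α}, (∀ x ∈ W, x ∈ A) → (∀ x ∈ W', x ∉ A) →
      (W + W').filter (· ∈ A) = W := by
    intro W W' hW hW'
    rw [Multiset.filter_add, Multiset.filter_eq_self.2 hW, Multiset.filter_eq_nil.2 hW', add_zero]
  have eA' : ∀ {W W' : Multiset α}, (∀ x ∈ W, x ∈ A) → (∀ x ∈ W', x ∉ A) →
      (W + W').filter (· ∉ A) = W' := by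
    intro W W' hW hW'
    rw [Multiset.filter_add, Multiset.filter_eq_self.2 hW',
      Multiset.filter_eq_nil.2 (fun x hx => not_not.2 (hW x hx)), zero_add]
  have e1 : X = P1.map Prod.fst + (U1 + U.filter (· ∈ A)) := by
    rw [← eA hX hX', hXX, Multiset.filter_add, hX1, add_assoc]
  have e2 : Y = P1.map Prod.snd + (V1 + V.filter (· ∈ A)) := by
    rw [← eA hY hY', hYY, Multiset.filter_add, hY1, add_assoc]
  have e3 : X' = P2.map Prod.fst + (U2 + U.filter (· ∉ A)) := by
    rw [← eA' hX hX', hXX, Multiset.filter_add, hX2, add_assoc]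
  have e4 : Y' = P2.map Prod.snd + (V2 + V.filter (· ∉ A)) := by
    rw [← eA' hY hY', hYY, Multiset.filter_add, hY2, add_assoc]
  refine (add_le_add (transportCost_le ⟨_, _, _, e1, e2⟩)
    (transportCost_le ⟨_, _, _, e3, e4⟩)).trans ?_
  simp only [PartialMatching.cost, Multiset.map_add, Multiset.sum_add] at hc ⊢
  have fsum : ∀ W : Multiset α, (W.map h).sum = ((W.filter (· ∈ A)).map h).sum +
      ((W.filter (· ∉ A)).map h).sum := fun W => by
    rw [← Multiset.sum_add, ← Multiset.map_add, Multiset.filter_add_not]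
  rw [fsum U, fsum V]
  refine le_trans (le_of_eq ?_) (add_le_add_left (add_le_add_left hc _) _)
  ac_rfl

/-- Greedy pairing: as long as both sides have points, pair two of them, which costs no more than
letting both exit. Applied to the unmatched points of a partial matching, it produces a full one. -/
theorem exists_full_matching {c : α → β → ℝ≥0∞} {h : α → ℝ≥0∞} {k : β → ℝ≥0∞}
    (hc : ∀ x y, c x y ≤ h x + k y) (U : Multiset α) : ∀ (V : Multiset β),
    ∃ M : PartialMatching U V, (M.left = 0 ∨ M.right = 0) ∧
      (M.pairs.map fun z => c z.1 z.2).sum ≤ (U.map h).sum + (V.map k).sum := by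
  induction U using Multiset.induction with
  | empty => exact fun V => ⟨PartialMatching.empty 0 V, Or.inl rfl, by simp⟩
  | cons x U ih =>
    intro V
    induction V using Multiset.induction with
    | empty => exact ⟨PartialMatching.empty _ 0, Or.inr rfl, by simp⟩
    | cons y V _ =>
      obtain ⟨M, hM, hMc⟩ := ih V
      refine ⟨⟨(x, y) ::ₘ M.pairs, M.left, M.right, by simp [← M.fst_eq], by simp [← M.snd_eq]⟩,
        hM, ?_⟩
      simp only [Multiset.map_cons, Multiset.sum_cons]
      refine (add_le_add (hc x y) hMc).trans (le_of_eq ?_)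
      ac_rfl

theorem fullMatchingCost_le_transportCost {c : α → β → ℝ≥0∞} {h : α → ℝ≥0∞} {k : β → ℝ≥0∞}
    (hc : ∀ x y, c x y ≤ h x + k y) (X : Multiset α) (Y : Multiset β) :
    fullMatchingCost c X Y ≤ transportCost c h k X Y := by
  refine le_iInf fun ⟨P, U, V, hX, hY⟩ => ?_
  obtain ⟨M, hM, hMc⟩ := exists_full_matching hc U V
  have e1 : X = (P + M.pairs).map Prod.fst + M.left := by
    rw [hX, Multiset.map_add, add_assoc, ← M.fst_eq]
  have e2 : Y = (P + M.pairs).map Prod.snd + M.right := by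
    rw [hY, Multiset.map_add, add_assoc, ← M.snd_eq]
  refine (iInf₂_le ⟨P + M.pairs, M.left, M.right, e1, e2⟩ hM).trans ?_
  simp only [PartialMatching.cost, Multiset.map_add, Multiset.sum_add]
  rw [add_assoc]
  gcongr

theorem sum_map_le_card_mul_add {H : ℝ≥0∞} {h k : α → ℝ≥0∞} (hk : ∀ x, h x ≤ H + k x)
    (X : Multiset α) : (X.map h).sum ≤ H * X.card + (X.map k).sum := by
  refine (Multiset.sum_map_le_sum_map h (fun x => H + k x) fun x _ => hk x).trans (le_of_eq ?_)
  rw [Multiset.sum_map_add]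
  simp [mul_comm]

/-- A full matching leaves exactly the surplus points of the larger family. Each pays at most `H`
plus an excess, and the excesses are bounded by their sum over all points. The split lets `H` come
from a truncation and `k`, `k'` from the tails. -/
theorem transportCost_le_fullMatchingCost {c : α → β → ℝ≥0∞} {H : ℝ≥0∞} {h k : α → ℝ≥0∞}
    {h' k' : β → ℝ≥0∞}
    (hk : ∀ x, h x ≤ H + k x) (hk' : ∀ x, h' x ≤ H + k' x) (X : Multiset α) (Y : Multiset β) :
    transportCost c h h' X Y ≤ fullMatchingCost c X Y +
      H * ((X.card - Y.card : ℕ) + (Y.card - X.card : ℕ)) + (X.map k).sum + (Y.map k').sum := by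
  simp_rw [fullMatchingCost, ENNReal.iInf_add]
  refine le_iInf₂ fun M hM => (transportCost_le M).trans ?_
  have hXc : X.card = M.pairs.card + M.left.card := by
    conv_lhs => rw [M.fst_eq]
    simp
  have hYc : Y.card = M.pairs.card + M.right.card := by
    conv_lhs => rw [M.snd_eq]
    simp
  rw [hXc, hYc, Nat.add_sub_add_left, Nat.add_sub_add_left]
  have h1 : (M.left.map k).sum ≤ (X.map k).sum := by
    conv_rhs => rw [M.fst_eq]
    simp
  have h2 : (M.right.map k').sum ≤ (Y.map k').sum := by
    conv_rhs => rw [M.snd_eq]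
    simp
  rw [PartialMatching.cost, add_assoc, add_assoc, add_assoc]
  refine add_le_add_right ?_ _
  rcases hM with hM | hM
  · rw [hM]
    simp only [Multiset.map_zero, Multiset.sum_zero, Multiset.card_zero, Nat.zero_sub,
      Nat.cast_zero, Nat.sub_zero, zero_add]
    refine (sum_map_le_card_mul_add hk' _).trans ?_
    gcongr
    exact h2.trans le_add_self
  · rw [hM]
    simp only [Multiset.map_zero, Multiset.sum_zero, Multiset.card_zero, Nat.zero_sub,
      Nat.cast_zero, Nat.sub_zero, add_zero]
    refine (sum_map_le_card_mul_add hk _).trans ?_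
    gcongr
    exact h1.trans le_self_add

end BipartiteMatching

/-! ### Poisson expectations of functionals of finite multisets -/

namespace BipartiteMatching

/-! ### Finite families as multisets -/

/-- The multiset of the values of a finite family. -/
def toMultiset {α : Type*} {k : ℕ} (X : Fin k → α) : Multiset α := Finset.univ.val.map X

theorem toMultiset_eq_ofFn {α : Type*} {k : ℕ} (X : Fin k → α) :
    toMultiset X = (List.ofFn X : Multiset α) := by
  rw [toMultiset, Fin.univ_val_map]

theorem toMultiset_cons {α : Type*} {k : ℕ} (x : α) (X : Fin k → α) :
    toMultiset (Fin.cons x X : Fin (k + 1) → α) = x ::ₘ toMultiset X := by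
  simp [toMultiset_eq_ofFn, List.ofFn_succ]

theorem toMultiset_append {α : Type*} {k l : ℕ} (X : Fin k → α) (Y : Fin l → α) :
    toMultiset (Fin.append X Y) = toMultiset X + toMultiset Y := by
  simp [toMultiset_eq_ofFn, List.ofFn_fin_append]

theorem toMultiset_comp {α β : Type*} {k : ℕ} (f : α → β) (X : Fin k → α) :
    toMultiset (f ∘ X) = (toMultiset X).map f := by
  rw [toMultiset, toMultiset, Multiset.map_map]

theorem exists_toMultiset_eq {α : Type*} (X : Multiset α) :
    ∃ (k : ℕ) (x : Fin k → α), toMultiset x = X := by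
  induction X using Quotient.inductionOn with
  | h l => exact ⟨l.length, l.get, by simp [toMultiset_eq_ofFn]⟩

@[simp]
theorem card_toMultiset {α : Type*} {k : ℕ} (X : Fin k → α) : (toMultiset X).card = k := by
  simp [toMultiset]

theorem mem_toMultiset {α : Type*} {k : ℕ} {X : Fin k → α} {x : α} :
    x ∈ toMultiset X ↔ ∃ i, X i = x := by
  simp [toMultiset]

/-! ### Measurability on disjoint unions -/

section Sigma

variable {ι : Type*} {E : ι → Type*} [∀ i, MeasurableSpace (E i)]

theorem measurable_sigmaMk (i : ι) : Measurable (Sigma.mk i : E i → Σ i, E i) :=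
  fun _ hs => MeasurableSpace.measurableSet_iInf.1 hs i

theorem measurable_sigma_iff {γ : Type*} [MeasurableSpace γ] {f : (Σ i, E i) → γ} :
    Measurable f ↔ ∀ i, Measurable fun x => f ⟨i, x⟩ := by
  refine ⟨fun hf i => hf.comp (measurable_sigmaMk i), fun hf s hs => ?_⟩
  exact MeasurableSpace.measurableSet_iInf.2 fun i => hf i hs

theorem measurableEmbedding_sigmaMk (i : ι) :
    MeasurableEmbedding (Sigma.mk i : E i → Σ i, E i) where
  injective := sigma_mk_injective
  measurable := measurable_sigmaMk i
  measurableSet_image' := by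
    intro s hs
    refine MeasurableSpace.measurableSet_iInf.2 fun j => ?_
    change MeasurableSet (Sigma.mk j ⁻¹' (Sigma.mk i '' s))
    by_cases hij : i = j
    · subst hij
      rwa [Set.preimage_image_eq _ sigma_mk_injective]
    · convert MeasurableSet.empty (α := E j)
      ext x
      simp only [Set.mem_preimage, Set.mem_image, Sigma.mk.injEq, Set.mem_empty_iff_false,
        iff_false, not_exists, not_and]
      exact fun _ _ h => absurd h hij

theorem measurable_sigma_prod {κ : Type*} [Countable ι] [Countable κ] {F : κ → Type*}
    [∀ i, MeasurableSpace (F i)] {γ : Type*} [MeasurableSpace γ]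
    {f : (Σ i, E i) × (Σ j, F j) → γ}
    (hf : ∀ i j, Measurable fun x : E i × F j => f (⟨i, x.1⟩, ⟨j, x.2⟩)) : Measurable f := by
  intro s hs
  have : f ⁻¹' s = ⋃ (i) (j), Prod.map (Sigma.mk i) (Sigma.mk j) ''
      ((fun x : E i × F j => f (⟨i, x.1⟩, ⟨j, x.2⟩)) ⁻¹' s) := by
    ext ⟨⟨i, x⟩, ⟨j, y⟩⟩
    simp only [Set.mem_preimage, Set.mem_iUnion, Set.mem_image, Prod.exists]
    constructor
    · exact fun h => ⟨i, j, x, y, h, rfl⟩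
    · rintro ⟨i', j', x', y', h, h'⟩
      rw [← h']
      exact h
  rw [this]
  exact MeasurableSet.iUnion fun i => MeasurableSet.iUnion fun j =>
    ((measurableEmbedding_sigmaMk i).prodMap (measurableEmbedding_sigmaMk j)).measurableSet_image.2
      (hf i j hs)

end Sigma

/-! ### Measurable functionals of finite multisets -/

variable {d : ℕ}

/-- A functional of finite multisets of points which is measurable on families of each size. -/
def MeasurableFunctional (G : Multiset (Pt d) → ℝ≥0∞) : Prop :=
  ∀ k : ℕ, Measurable fun X : Fin k → Pt d => G (toMultiset X)

/-- A functional of two finite multisets which is jointly measurable on families. -/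
def MeasurableFunctional₂ (F : Multiset (Pt d) → Multiset (Pt d) → ℝ≥0∞) : Prop :=
  ∀ m n : ℕ, Measurable fun Z : (Fin m → Pt d) × (Fin n → Pt d) =>
    F (toMultiset Z.1) (toMultiset Z.2)

theorem measurable_finAppend {k l : ℕ} :
    Measurable fun Z : (Fin k → Pt d) × (Fin l → Pt d) => Fin.append Z.1 Z.2 := by
  refine measurable_pi_lambda _ fun i => ?_
  induction i using Fin.addCases with
  | left i => simp only [Fin.append_left]; fun_prop
  | right i => simp only [Fin.append_right]; fun_prop

theorem measurable_finCons {k : ℕ} :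
    Measurable fun Z : Pt d × (Fin k → Pt d) => (Fin.cons Z.1 Z.2 : Fin (k + 1) → Pt d) := by
  refine measurable_pi_lambda _ fun i => ?_
  induction i using Fin.cases with
  | zero => simp only [Fin.cons_zero]; fun_prop
  | succ i => simp only [Fin.cons_succ]; fun_prop

theorem MeasurableFunctional₂.of_add {G : Multiset (Pt d) → ℝ≥0∞} (hG : MeasurableFunctional G) :
    MeasurableFunctional₂ fun X Y => G (X + Y) := fun m n => by
  simp_rw [← toMultiset_append]
  exact (hG (m + n)).comp measurable_finAppend

theorem MeasurableFunctional₂.right {F : Multiset (Pt d) → Multiset (Pt d) → ℝ≥0∞}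
    (hF : MeasurableFunctional₂ F) (X : Multiset (Pt d)) : MeasurableFunctional (F X) := by
  intro n
  obtain ⟨m, x, rfl⟩ := exists_toMultiset_eq X
  exact (hF m n).comp measurable_prodMk_left

theorem MeasurableFunctional.add_left {G : Multiset (Pt d) → ℝ≥0∞} (hG : MeasurableFunctional G)
    (X : Multiset (Pt d)) : MeasurableFunctional fun Y => G (X + Y) :=
  (MeasurableFunctional₂.of_add hG).right X

theorem MeasurableFunctional.cons {G : Multiset (Pt d) → ℝ≥0∞} (hG : MeasurableFunctional G)
    (x : Pt d) : MeasurableFunctional fun Y => G (x ::ₘ Y) := by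
  simpa only [Multiset.singleton_add] using hG.add_left {x}

theorem MeasurableFunctional.sum_map {g : Pt d → ℝ≥0∞} (hg : Measurable g) :
    MeasurableFunctional fun X => (X.map g).sum := by
  intro k
  have : ∀ X : Fin k → Pt d, ((toMultiset X).map g).sum = ∑ i, g (X i) := fun X => by
    rw [toMultiset, Multiset.map_map]
    rfl
  simp_rw [this]
  fun_prop

/-! ### Integrals over families of fixed size -/

/-- The integral of a functional over families of `k` points. -/
noncomputable def powerMean (ν : Measure (Pt d)) (k : ℕ) (G : Multiset (Pt d) → ℝ≥0∞) : ℝ≥0∞ :=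
  ∫⁻ X : Fin k → Pt d, G (toMultiset X) ∂(Measure.pi fun _ => ν)

theorem powerMean_zero (ν : Measure (Pt d)) [IsFiniteMeasure ν] (G : Multiset (Pt d) → ℝ≥0∞) :
    powerMean ν 0 G = G 0 := by
  have : ∀ X : Fin 0 → Pt d, toMultiset X = 0 := fun X => by simp [toMultiset]
  simp [powerMean, this]

theorem powerMean_const (ν : Measure (Pt d)) [IsFiniteMeasure ν] (k : ℕ) (a : ℝ≥0∞) :
    powerMean ν k (fun _ => a) = a * ν Set.univ ^ k := by
  simp [powerMean, Measure.pi_univ]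

theorem powerMean_succ (ν : Measure (Pt d)) [IsFiniteMeasure ν] (k : ℕ)
    {G : Multiset (Pt d) → ℝ≥0∞} (hG : MeasurableFunctional G) :
    powerMean ν (k + 1) G = ∫⁻ x, powerMean ν k (fun Y => G (x ::ₘ Y)) ∂ν := by
  have h := (measurePreserving_piFinSuccAbove (fun _ : Fin (k + 1) => ν) 0).symm
  rw [powerMean, ← h.lintegral_comp (hG _), lintegral_prod]
  · refine lintegral_congr fun x => lintegral_congr fun Y => ?_
    simp only [← toMultiset_cons]
    congr 2
    exact Fin.insertNth_zero' x Y
  · exact ((hG _).comp h.measurable).aemeasurable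

theorem MeasurableFunctional₂.powerMean {F : Multiset (Pt d) → Multiset (Pt d) → ℝ≥0∞}
    (hF : MeasurableFunctional₂ F) (ν : Measure (Pt d)) [IsFiniteMeasure ν] (k : ℕ) :
    MeasurableFunctional fun X => powerMean ν k (F X) :=
  fun m => (hF m k).lintegral_prod_right'

theorem MeasurableFunctional.measurable_powerMean_cons {G : Multiset (Pt d) → ℝ≥0∞}
    (hG : MeasurableFunctional G) (ν : Measure (Pt d)) [IsFiniteMeasure ν] (k : ℕ) :
    Measurable fun x => BipartiteMatching.powerMean ν k fun Y => G (x ::ₘ Y) := by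
  have h : Measurable fun Z : Pt d × (Fin k → Pt d) => G (Z.1 ::ₘ toMultiset Z.2) := by
    simp_rw [← toMultiset_cons]
    exact (hG _).comp measurable_finCons
  exact h.lintegral_prod_right'

/-- The binomial theorem for the k-th product power of μ + ν. Terms are grouped by the number of
points drawn from μ, which is legitimate because a functional of multisets ignores their order. -/
theorem powerMean_add_measure (μ ν : Measure (Pt d)) [IsFiniteMeasure μ] [IsFiniteMeasure ν]
    (k : ℕ) : ∀ {G : Multiset (Pt d) → ℝ≥0∞}, MeasurableFunctional G →
    powerMean (μ + ν) k G = ∑ ij ∈ Finset.HasAntidiagonal.antidiagonal k, (k.choose ij.1 : ℝ≥0∞) *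
      powerMean μ ij.1 fun X => powerMean ν ij.2 fun Y => G (X + Y) := by
  induction k with
  | zero =>
    intro G _
    simp [powerMean_zero]
  | succ k ih =>
    intro G hG
    have hT : ∀ i j : ℕ, Measurable fun x : Pt d =>
        powerMean μ i fun X => powerMean ν j fun Y => G (x ::ₘ (X + Y)) := by
      intro i j
      have := ((MeasurableFunctional₂.of_add hG).powerMean ν j).measurable_powerMean_cons μ i
      simpa only [Multiset.cons_add] using this
    have h1 : ∀ i j : ℕ, ∫⁻ x, (powerMean μ i fun X => powerMean ν j fun Y => G (x ::ₘ (X + Y))) ∂μ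
        = powerMean μ (i + 1) fun X => powerMean ν j fun Y => G (X + Y) := by
      intro i j
      rw [powerMean_succ μ i ((MeasurableFunctional₂.of_add hG).powerMean ν j)]
      simp only [Multiset.cons_add]
    -- The new ν-point stands outside the μ-points; Tonelli brings it next to the other ν-points.
    have h2 : ∀ i j : ℕ, ∫⁻ x, (powerMean μ i fun X => powerMean ν j fun Y => G (x ::ₘ (X + Y))) ∂ν
        = powerMean μ i fun X => powerMean ν (j + 1) fun Y => G (X + Y) := by
      intro i j
      simp_rw [powerMean_succ ν j (hG.add_left _)]
      rw [powerMean, ← lintegral_lintegral_swap]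
      · simp only [Multiset.add_cons, powerMean]
      · have := (((MeasurableFunctional₂.of_add hG).powerMean ν j) (i + 1)).comp
          measurable_finCons
        refine Measurable.aemeasurable ?_
        simpa only [Function.comp_def, toMultiset_cons, Multiset.cons_add, Multiset.add_cons,
          Function.uncurry_def] using this
    rw [powerMean_succ _ _ hG, lintegral_add_measure]
    simp_rw [fun x => ih (hG.cons x)]
    rw [lintegral_finsetSum _ fun ij _ => (hT ij.1 ij.2).const_mul _,
      lintegral_finsetSum _ fun ij _ => (hT ij.1 ij.2).const_mul _]
    simp_rw [lintegral_const_mul _ (hT _ _), h1, h2]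
    -- Pascal's rule.
    rw [Finset.sum_antidiagonal_choose_succ_mul
      (fun i j => powerMean μ i fun X => powerMean ν j fun Y => G (X + Y)) k, add_comm]
    congr 1
    refine Finset.sum_congr rfl fun ij hij => ?_
    rw [Nat.choose_symm_of_eq_add (Finset.HasAntidiagonal.mem_antidiagonal.1 hij).symm]

theorem powerMean_sum_map (ν : Measure (Pt d)) [IsFiniteMeasure ν] {g : Pt d → ℝ≥0∞}
    (hg : Measurable g) (k : ℕ) :
    powerMean ν (k + 1) (fun X => (X.map g).sum) = (k + 1) * ν Set.univ ^ k * ∫⁻ x, g x ∂ν := by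
  have key : ∀ k, powerMean ν (k + 1) (fun X => (X.map g).sum) =
      ν Set.univ ^ k * ∫⁻ x, g x ∂ν + ν Set.univ * powerMean ν k fun X => (X.map g).sum := by
    intro k
    rw [powerMean_succ ν k (MeasurableFunctional.sum_map hg)]
    simp only [Multiset.map_cons, Multiset.sum_cons]
    have : ∀ x, powerMean ν k (fun Y => g x + (Y.map g).sum) =
        g x * ν Set.univ ^ k + powerMean ν k fun X => (X.map g).sum := by
      intro x
      rw [← powerMean_const, powerMean, lintegral_add_left measurable_const]
      rfl
    simp_rw [this]
    rw [lintegral_add_left (hg.mul_const _), lintegral_mul_const _ hg, lintegral_const,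
      mul_comm (powerMean _ _ _), mul_comm (∫⁻ x, g x ∂ν)]
  induction k with
  | zero => rw [key, powerMean_zero]; simp
  | succ k ih =>
    rw [key, ih]
    push_cast
    ring

theorem powerMean_map (ν : Measure (Pt d)) [IsFiniteMeasure ν] {φ : Pt d → Pt d}
    (hφ : Measurable φ) (k : ℕ) {G : Multiset (Pt d) → ℝ≥0∞} (hG : MeasurableFunctional G) :
    powerMean (ν.map φ) k G = powerMean ν k fun X => G (X.map φ) := by
  have : IsFiniteMeasure (ν.map φ) := inferInstance
  rw [powerMean, ← Measure.pi_map_pi (fun _ => hφ.aemeasurable), lintegral_map (hG k)]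
  · simp only [powerMean, ← toMultiset_comp]
    rfl
  · fun_prop

/-! ### Poisson expectations -/

instance instIsProbabilityMeasurePoissonLaw (ν : Measure (Pt d)) [IsFiniteMeasure ν] :
    IsProbabilityMeasure (poissonLaw ν) := isProbabilityMeasure_poissonLaw ν

/-- The expectation of a functional of one Poisson point process. -/
noncomputable def poissonMean (ν : Measure (Pt d)) (G : Multiset (Pt d) → ℝ≥0∞) : ℝ≥0∞ :=
  ∫⁻ Z, G (toMultiset Z.2) ∂poissonLaw ν

/-- The expectation of a functional of two independent Poisson point processes. -/
noncomputable def poissonMean₂ (ν : Measure (Pt d))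
    (F : Multiset (Pt d) → Multiset (Pt d) → ℝ≥0∞) : ℝ≥0∞ :=
  poissonMean ν fun X => poissonMean ν fun Y => F X Y

/-- The weights of the mixture that defines the Poisson law. -/
noncomputable def poissonWeight (ν : Measure (Pt d)) (k : ℕ) : ℝ≥0∞ :=
  ENNReal.ofReal (Real.exp (-(ν.real Set.univ)) / (Nat.factorial k : ℝ))

theorem MeasurableFunctional.measurable {G : Multiset (Pt d) → ℝ≥0∞}
    (hG : MeasurableFunctional G) :
    Measurable fun Z : Σ k : ℕ, (Fin k → Pt d) => G (toMultiset Z.2) :=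
  measurable_sigma_iff.2 hG

theorem MeasurableFunctional₂.measurable {F : Multiset (Pt d) → Multiset (Pt d) → ℝ≥0∞}
    (hF : MeasurableFunctional₂ F) :
    Measurable fun Z : (Σ k : ℕ, (Fin k → Pt d)) × (Σ k : ℕ, (Fin k → Pt d)) =>
      F (toMultiset Z.1.2) (toMultiset Z.2.2) :=
  measurable_sigma_prod hF

theorem poissonMean_eq_tsum (ν : Measure (Pt d)) {G : Multiset (Pt d) → ℝ≥0∞}
    (hG : MeasurableFunctional G) :
    poissonMean ν G = ∑' k, poissonWeight ν k * powerMean ν k G := by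
  rw [poissonMean, poissonLaw, lintegral_sum_measure]
  refine tsum_congr fun k => ?_
  rw [lintegral_smul_measure, lintegral_map hG.measurable (measurable_sigmaMk k)]
  rfl

theorem MeasurableFunctional₂.poissonMean {F : Multiset (Pt d) → Multiset (Pt d) → ℝ≥0∞}
    (hF : MeasurableFunctional₂ F) (ν : Measure (Pt d)) [IsFiniteMeasure ν] :
    MeasurableFunctional fun X => BipartiteMatching.poissonMean ν (F X) := by
  intro m
  exact (hF.measurable.comp ((measurable_sigmaMk (E := fun k : ℕ => Fin k → Pt d) m).prodMap
    measurable_id)).lintegral_prod_right'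

theorem poissonMean_mono (ν : Measure (Pt d)) {G G' : Multiset (Pt d) → ℝ≥0∞}
    (h : ∀ X, G X ≤ G' X) : poissonMean ν G ≤ poissonMean ν G' :=
  lintegral_mono fun _ => h _

theorem poissonMean_const (ν : Measure (Pt d)) [IsFiniteMeasure ν] (a : ℝ≥0∞) :
    poissonMean ν (fun _ => a) = a := by
  simp [poissonMean]

theorem poissonMean_add_left (ν : Measure (Pt d)) {G G' : Multiset (Pt d) → ℝ≥0∞}
    (hG : MeasurableFunctional G) :
    poissonMean ν (fun X => G X + G' X) = poissonMean ν G + poissonMean ν G' :=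
  lintegral_add_left hG.measurable _

theorem poissonMean_add_right (ν : Measure (Pt d)) {G G' : Multiset (Pt d) → ℝ≥0∞}
    (hG' : MeasurableFunctional G') :
    poissonMean ν (fun X => G X + G' X) = poissonMean ν G + poissonMean ν G' :=
  lintegral_add_right _ hG'.measurable

theorem poissonMean_const_mul (ν : Measure (Pt d)) {G : Multiset (Pt d) → ℝ≥0∞}
    (hG : MeasurableFunctional G) (a : ℝ≥0∞) :
    poissonMean ν (fun X => a * G X) = a * poissonMean ν G :=
  lintegral_const_mul _ hG.measurable

theorem MeasurableFunctional₂.poissonMean₂_eq {F : Multiset (Pt d) → Multiset (Pt d) → ℝ≥0∞}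
    (hF : MeasurableFunctional₂ F) (ν : Measure (Pt d)) [IsFiniteMeasure ν] :
    poissonMean₂ ν F = ∫⁻ Z, F (toMultiset Z.1.2) (toMultiset Z.2.2)
      ∂(poissonLaw ν).prod (poissonLaw ν) := by
  rw [lintegral_prod _ hF.measurable.aemeasurable]
  rfl

theorem poissonMean₂_mono (ν : Measure (Pt d)) {F F' : Multiset (Pt d) → Multiset (Pt d) → ℝ≥0∞}
    (h : ∀ X Y, F X Y ≤ F' X Y) : poissonMean₂ ν F ≤ poissonMean₂ ν F' :=
  poissonMean_mono ν fun X => poissonMean_mono ν (h X)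

theorem poissonMean₂_add_left (ν : Measure (Pt d)) [IsFiniteMeasure ν]
    {F F' : Multiset (Pt d) → Multiset (Pt d) → ℝ≥0∞} (hF : MeasurableFunctional₂ F) :
    poissonMean₂ ν (fun X Y => F X Y + F' X Y) = poissonMean₂ ν F + poissonMean₂ ν F' := by
  simp_rw [poissonMean₂, fun X => poissonMean_add_left (G' := F' X) ν (hF.right X)]
  exact poissonMean_add_left ν (hF.poissonMean ν)

theorem poissonMean₂_const_mul (ν : Measure (Pt d)) [IsFiniteMeasure ν]
    {F : Multiset (Pt d) → Multiset (Pt d) → ℝ≥0∞} (hF : MeasurableFunctional₂ F) (a : ℝ≥0∞) :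
    poissonMean₂ ν (fun X Y => a * F X Y) = a * poissonMean₂ ν F := by
  simp_rw [poissonMean₂, fun X => poissonMean_const_mul ν (hF.right X) a]
  exact poissonMean_const_mul ν (hF.poissonMean ν) a

theorem poissonWeight_add (μ ν : Measure (Pt d)) [IsFiniteMeasure μ] [IsFiniteMeasure ν]
    (i j : ℕ) : poissonWeight (μ + ν) (i + j) * ((i + j).choose i : ℝ≥0∞) =
      poissonWeight μ i * poissonWeight ν j := by
  rw [poissonWeight, poissonWeight, poissonWeight, ← ENNReal.ofReal_natCast,
    ← ENNReal.ofReal_mul (by positivity), ← ENNReal.ofReal_mul (by positivity),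
    Nat.cast_add_choose, measureReal_add_apply, neg_add, Real.exp_add]
  congr 1
  have := Nat.factorial_ne_zero (i + j)
  field_simp

/-- Superposition: the union of two independent Poisson processes is a Poisson process. -/
theorem poissonMean_add_measure (μ ν : Measure (Pt d)) [IsFiniteMeasure μ] [IsFiniteMeasure ν]
    {G : Multiset (Pt d) → ℝ≥0∞} (hG : MeasurableFunctional G) :
    poissonMean (μ + ν) G = poissonMean μ fun X => poissonMean ν fun Y => G (X + Y) := by
  have hG₂ := MeasurableFunctional₂.of_add hG
  set T : ℕ → ℕ → ℝ≥0∞ := fun i j => powerMean μ i fun X => powerMean ν j fun Y => G (X + Y)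
  have h1 : poissonMean (μ + ν) G = ∑' q : ℕ × ℕ,
      poissonWeight μ q.1 * poissonWeight ν q.2 * T q.1 q.2 := by
    -- The sum over the total number k becomes a sum over pairs (i, j) with i + j = k; the binomial
    -- coefficient turns the weight of k into a product.
    rw [poissonMean_eq_tsum _ hG, ← Finset.HasAntidiagonal.sigmaAntidiagonalEquivProd.tsum_eq, ENNReal.tsum_sigma']
    refine tsum_congr fun k => ?_
    rw [tsum_fintype, powerMean_add_measure μ ν k hG, Finset.mul_sum,
      ← Finset.sum_coe_sort (Finset.HasAntidiagonal.antidiagonal k)]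
    refine Finset.sum_congr rfl fun q _ => ?_
    rw [← mul_assoc]
    congr 1
    obtain ⟨⟨i, j⟩, hq⟩ := q
    rw [Finset.HasAntidiagonal.mem_antidiagonal] at hq
    subst hq
    exact poissonWeight_add μ ν i j
  rw [h1, ENNReal.tsum_prod (f := fun i j => poissonWeight μ i * poissonWeight ν j * T i j), poissonMean_eq_tsum _ (hG₂.poissonMean ν)]
  refine tsum_congr fun i => ?_
  simp_rw [fun X => poissonMean_eq_tsum ν (hG₂.right X)]
  have h2 := lintegral_tsum (μ := Measure.pi fun _ : Fin i => μ)
    fun j => ((hG₂.powerMean ν j i).const_mul (poissonWeight ν j)).aemeasurable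
  rw [powerMean, h2, ← ENNReal.tsum_mul_left]
  refine tsum_congr fun j => ?_
  rw [mul_assoc, lintegral_const_mul _ (hG₂.powerMean ν j i)]
  rfl

theorem poissonMean_map (ν : Measure (Pt d)) [IsFiniteMeasure ν] {φ : Pt d → Pt d}
    (hφ : Measurable φ) {G : Multiset (Pt d) → ℝ≥0∞} (hG : MeasurableFunctional G) :
    poissonMean (ν.map φ) G = poissonMean ν fun X => G (X.map φ) := by
  have hG' : MeasurableFunctional fun X => G (X.map φ) := by
    intro k
    simp_rw [← toMultiset_comp]
    exact (hG k).comp (by fun_prop)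
  rw [poissonMean_eq_tsum _ hG, poissonMean_eq_tsum _ hG']
  refine tsum_congr fun k => ?_
  rw [powerMean_map ν hφ k hG, poissonWeight, poissonWeight, measureReal_def, measureReal_def,
    Measure.map_apply hφ MeasurableSet.univ, Set.preimage_univ]

/-- The weights do not contain the power of the mass, so their recursion is free of ν; Campbell's
formula and the factorial moments rest on it. -/
theorem poissonWeight_succ (ν : Measure (Pt d)) (k : ℕ) :
    poissonWeight ν (k + 1) * (k + 1) = poissonWeight ν k := by
  have : ((k : ℝ≥0∞) + 1) = ENNReal.ofReal ((k : ℝ) + 1) := by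
    rw [ENNReal.ofReal_add (by positivity) (by positivity)]
    simp
  rw [poissonWeight, poissonWeight, this, ← ENNReal.ofReal_mul (by positivity),
    Nat.factorial_succ]
  congr 1
  push_cast
  field_simp

theorem tsum_poissonWeight (ν : Measure (Pt d)) [IsFiniteMeasure ν] :
    ∑' k, poissonWeight ν k * ν Set.univ ^ k = 1 := by
  have h := poissonMean_eq_tsum ν (G := fun _ => 1) (fun k => measurable_const)
  rw [poissonMean_const] at h
  simp_rw [powerMean_const, one_mul] at h
  exact h.symm

/-- Campbell's formula. -/
theorem poissonMean_sum_map (ν : Measure (Pt d)) [IsFiniteMeasure ν] {g : Pt d → ℝ≥0∞}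
    (hg : Measurable g) : poissonMean ν (fun X => (X.map g).sum) = ∫⁻ x, g x ∂ν := by
  rw [poissonMean_eq_tsum ν (MeasurableFunctional.sum_map hg),
    tsum_eq_zero_add' ENNReal.summable, powerMean_zero]
  simp_rw [powerMean_sum_map ν hg, ← mul_assoc, poissonWeight_succ]
  rw [ENNReal.tsum_mul_right, tsum_poissonWeight]
  simp

theorem measurableFunctional_card (φ : ℕ → ℝ≥0∞) :
    MeasurableFunctional (d := d) fun X => φ X.card := fun k => by
  simp only [card_toMultiset]
  exact measurable_const

/-- The size-biasing identity E[N φ(N)] = λ E[φ(N + 1)] of the Poisson law, from a shift of the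
index. -/
theorem poissonMean_card_mul (ν : Measure (Pt d)) [IsFiniteMeasure ν] (φ : ℕ → ℝ≥0∞) :
    poissonMean ν (fun X => X.card * φ X.card) =
      ν Set.univ * poissonMean ν fun X => φ (X.card + 1) := by
  rw [poissonMean_eq_tsum ν (measurableFunctional_card fun k => k * φ k),
    poissonMean_eq_tsum ν (measurableFunctional_card fun k => φ (k + 1)),
    tsum_eq_zero_add' ENNReal.summable, powerMean_zero, ← ENNReal.tsum_mul_left]
  have : ∀ (k : ℕ) (ψ : ℕ → ℝ≥0∞), powerMean ν k (fun X => ψ X.card) = ψ k * ν Set.univ ^ k := by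
    intro k ψ
    rw [← powerMean_const]
    simp [powerMean]
  simp_rw [this _ fun k => φ (k + 1), this _ fun k => k * φ k]
  simp only [Multiset.card_zero, Nat.cast_zero, zero_mul, mul_zero, zero_add]
  refine tsum_congr fun k => ?_
  rw [← poissonWeight_succ ν k]
  push_cast
  ring

theorem poissonMean_card (ν : Measure (Pt d)) [IsFiniteMeasure ν] :
    poissonMean ν (fun X => (X.card : ℝ≥0∞)) = ν Set.univ := by
  simpa [poissonMean_const] using poissonMean_card_mul ν fun _ => 1

theorem poissonMean_card_sq (ν : Measure (Pt d)) [IsFiniteMeasure ν] :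
    poissonMean ν (fun X => (X.card : ℝ≥0∞) * X.card) =
      ν Set.univ * (ν Set.univ + 1) := by
  rw [poissonMean_card_mul ν fun k => (k : ℝ≥0∞)]
  push_cast
  rw [poissonMean_add_left ν (measurableFunctional_card fun k => k), poissonMean_card,
    poissonMean_const]

/-- Allows pointwise inequalities between functionals to be checked only on configurations inside a
set of full measure. -/
theorem ae_poissonLaw {ν : Measure (Pt d)} [IsFiniteMeasure ν] {A : Set (Pt d)}
    (hA : ∀ᵐ x ∂ν, x ∈ A) : ∀ᵐ Z ∂poissonLaw ν, ∀ x ∈ toMultiset Z.2, x ∈ A := by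
  rw [poissonLaw, Measure.ae_sum_iff]
  intro k
  refine Measure.ae_smul_measure ?_ _
  rw [(measurableEmbedding_sigmaMk (E := fun k : ℕ => Fin k → Pt d) k).ae_map_iff]
  have : ∀ᵐ X : Fin k → Pt d ∂Measure.pi fun _ => ν, ∀ i, X i ∈ A :=
    ae_all_iff.2 fun i =>
      (Measure.tendsto_eval_ae_ae (μ := fun _ : Fin k => ν) (i := i)).eventually hA
  filter_upwards [this] with X hX x hx
  obtain ⟨i, rfl⟩ := mem_toMultiset.1 hx
  exact hX i

theorem poissonMean_mono_of_mem {ν : Measure (Pt d)} [IsFiniteMeasure ν]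
    {G G' : Multiset (Pt d) → ℝ≥0∞} {A : Set (Pt d)} (hA : ∀ᵐ x ∂ν, x ∈ A)
    (h : ∀ X, (∀ x ∈ X, x ∈ A) → G X ≤ G' X) : poissonMean ν G ≤ poissonMean ν G' :=
  lintegral_mono_ae ((ae_poissonLaw hA).mono fun _ hZ => h _ hZ)

/-- Only the term k = 1 of the mixture is kept. With the term k = 0 for the other process, it
isolates the event of one point against none. -/
theorem lintegral_singleton_le_poissonMean (ν : Measure (Pt d)) [IsFiniteMeasure ν]
    {G : Multiset (Pt d) → ℝ≥0∞} (hG : MeasurableFunctional G) :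
    poissonWeight ν 1 * ∫⁻ x, G {x} ∂ν ≤ poissonMean ν G := by
  rw [poissonMean_eq_tsum ν hG]
  refine le_trans (le_of_eq ?_) (ENNReal.le_tsum 1)
  rw [powerMean_succ ν 0 hG]
  simp [powerMean_zero]

theorem poissonWeight_mul_empty_le_poissonMean (ν : Measure (Pt d)) [IsFiniteMeasure ν]
    {G : Multiset (Pt d) → ℝ≥0∞} (hG : MeasurableFunctional G) :
    poissonWeight ν 0 * G 0 ≤ poissonMean ν G := by
  rw [poissonMean_eq_tsum ν hG]
  refine le_trans (le_of_eq ?_) (ENNReal.le_tsum 0)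
  rw [powerMean_zero]

/-- The absolute difference of the numbers of points. -/
def cardDist {α β : Type*} (X : Multiset α) (Y : Multiset β) : ℝ≥0∞ :=
  ((X.card - Y.card : ℕ) + (Y.card - X.card : ℕ))

theorem measurableFunctional₂_card (φ : ℕ → ℕ → ℝ≥0∞) :
    MeasurableFunctional₂ (d := d) fun X Y => φ X.card Y.card := fun m n => by
  simp only [card_toMultiset]
  exact measurable_const

theorem ennreal_two_mul_mul_le (s a : ℝ≥0∞) : 2 * (s * a) ≤ s * s + a * a := by
  induction s with
  | top => by_cases h : a = 0 <;> simp [h]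
  | coe s =>
    induction a with
    | top => by_cases h : s = 0 <;> simp [h]
    | coe a =>
      norm_cast
      have := two_mul_le_add_sq s a
      nlinarith

/-- The variance of the difference of two independent Poisson variables. The identity |m - n|² + 2mn
= m² + n² avoids subtraction in [0, ∞]; the finite term 2λ² is cancelled at the end. -/
theorem poissonMean₂_cardDist_sq (ν : Measure (Pt d)) [IsFiniteMeasure ν] :
    poissonMean₂ ν (fun X Y => cardDist X Y * cardDist X Y) = 2 * ν Set.univ := by
  have hk : ∀ m n : ℕ, ((m - n : ℕ) + (n - m : ℕ)) * ((m - n : ℕ) + (n - m : ℕ)) + 2 * (m * n) =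
      m * m + n * n := by
    intro m n
    rcases le_total m n with h | h <;> obtain ⟨k, rfl⟩ := Nat.exists_eq_add_of_le h
    · simp; ring
    · simp; ring
  have h1 : poissonMean₂ ν (fun X Y => cardDist X Y * cardDist X Y + 2 * (X.card * Y.card)) =
      poissonMean₂ ν (fun X Y => (X.card : ℝ≥0∞) * X.card + (Y.card : ℝ≥0∞) * Y.card) := by
    congr 1
    funext X Y
    simp only [cardDist]
    exact_mod_cast hk X.card Y.card
  have hD : MeasurableFunctional₂ (d := d) fun X Y => cardDist X Y * cardDist X Y :=
    measurableFunctional₂_card fun m n =>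
      (((m - n : ℕ) + (n - m : ℕ)) * ((m - n : ℕ) + (n - m : ℕ)) : ℝ≥0∞)
  rw [poissonMean₂_add_left ν hD,
    poissonMean₂_const_mul ν (measurableFunctional₂_card fun m n => (m : ℝ≥0∞) * n),
    poissonMean₂_add_left ν (measurableFunctional₂_card fun m _ => (m : ℝ≥0∞) * m)] at h1
  have h2 : poissonMean₂ ν (fun X Y => (X.card : ℝ≥0∞) * Y.card) = ν Set.univ * ν Set.univ := by
    simp_rw [poissonMean₂, fun X : Multiset (Pt d) => poissonMean_const_mul ν
      (measurableFunctional_card fun k => (k : ℝ≥0∞)) (X.card : ℝ≥0∞), poissonMean_card,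
      mul_comm _ (ν Set.univ)]
    rw [poissonMean_const_mul ν (measurableFunctional_card fun k => (k : ℝ≥0∞)), poissonMean_card]
  have h3 : poissonMean₂ ν (fun X _ => (X.card : ℝ≥0∞) * X.card) =
      ν Set.univ * (ν Set.univ + 1) := by
    simp_rw [poissonMean₂, poissonMean_const]
    exact poissonMean_card_sq ν
  have h4 : poissonMean₂ ν (fun _ Y => (Y.card : ℝ≥0∞) * Y.card) =
      ν Set.univ * (ν Set.univ + 1) := by
    simp_rw [poissonMean₂, poissonMean_const]
    exact poissonMean_card_sq ν
  rw [h2, h3, h4] at h1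
  have hfin : 2 * (ν Set.univ * ν Set.univ) ≠ ∞ :=
    ENNReal.mul_ne_top (by simp) (ENNReal.mul_ne_top (measure_ne_top _ _) (measure_ne_top _ _))
  refine (ENNReal.add_left_inj hfin).1 (h1.trans ?_)
  ring

theorem poissonMean₂_cardDist_le (ν : Measure (Pt d)) [IsFiniteMeasure ν] :
    poissonMean₂ ν cardDist ≤ 2 * ν Set.univ ^ (1 / 2 : ℝ) := by
  set s := ν Set.univ ^ (1 / 2 : ℝ) with hs
  have hss : s * s = ν Set.univ := by
    rw [hs, ← ENNReal.rpow_add_of_nonneg _ _ (by norm_num) (by norm_num)]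
    norm_num
  have hm : MeasurableFunctional₂ (d := d) cardDist :=
    measurableFunctional₂_card fun m n => (((m - n : ℕ) + (n - m : ℕ)) : ℝ≥0∞)
  have hsq := poissonMean₂_cardDist_sq ν
  -- The general case divides by `s`. For zero mass one uses that an integer is at most its square.
  by_cases h0 : s = 0
  · rw [h0, mul_zero] at hss
    rw [← hss, mul_zero] at hsq
    refine (poissonMean₂_mono ν fun X Y => ?_).trans (hsq.le.trans zero_le)
    simp only [cardDist]
    norm_cast
    exact Nat.le_mul_self _
  · have hst : s ≠ ∞ := ENNReal.rpow_ne_top_of_nonneg (by norm_num) (measure_ne_top _ _)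
    -- Instead of Cauchy–Schwarz, 2sD ≤ s² + D² with s the square root of the mass; hence the
    -- constant 2 in place of √2.
    have h1 : 2 * (s * poissonMean₂ ν cardDist) ≤ 2 * (s * (2 * s)) := by
      calc 2 * (s * poissonMean₂ ν cardDist)
          = poissonMean₂ ν fun X Y => 2 * (s * cardDist X Y) := by
            simp_rw [← mul_assoc]
            rw [poissonMean₂_const_mul ν hm]
        _ ≤ poissonMean₂ ν fun X Y => s * s + cardDist X Y * cardDist X Y :=
            poissonMean₂_mono ν fun X Y => ennreal_two_mul_mul_le _ _
        _ = s * s + 2 * (s * s) := by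
            rw [poissonMean₂_add_left ν (measurableFunctional₂_card fun _ _ => s * s), hsq, hss]
            simp [poissonMean₂, poissonMean_const]
        _ ≤ s * s + s * s + 2 * (s * s) := by gcongr; exact le_self_add
        _ = _ := by ring
    rw [ENNReal.mul_le_mul_iff_right (by simp) (by simp), ENNReal.mul_le_mul_iff_right h0 hst] at h1
    exact h1

end BipartiteMatching

/-! ### The costs of the statement as costs of multisets -/

namespace BipartiteMatching

/-! ### Partial matchings of finite types -/

section Index

variable {ι κ : Type*} [Fintype ι] [Fintype κ]

theorem val_add_compl_val [DecidableEq ι] (A : Finset ι) : A.val + Aᶜ.val = (Finset.univ : Finset ι).val := by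
  have h := Finset.union_compl A
  rw [← Finset.disjUnion_eq_union A Aᶜ disjoint_compl_right] at h
  rw [← h]
  rfl

theorem eq_compl_val [DecidableEq ι] {A : Finset ι} {U : Multiset ι}
    (h : (Finset.univ : Finset ι).val = A.val + U) : U = Aᶜ.val := by
  rw [← val_add_compl_val A] at h
  exact (add_left_cancel h).symm

variable (M : PartialMatching (Finset.univ : Finset ι).val (Finset.univ : Finset κ).val)

theorem PartialMatching.nodup_fst : (M.pairs.map Prod.fst).Nodup :=
  (Multiset.nodup_add.1 (M.fst_eq ▸ (Finset.univ : Finset ι).nodup)).1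

theorem PartialMatching.nodup_snd : (M.pairs.map Prod.snd).Nodup :=
  (Multiset.nodup_add.1 (M.snd_eq ▸ (Finset.univ : Finset κ).nodup)).1

/-- The set of matched indices on the left. -/
def PartialMatching.fstFinset : Finset ι := ⟨M.pairs.map Prod.fst, M.nodup_fst⟩

/-- The set of matched indices on the right. -/
def PartialMatching.sndFinset : Finset κ := ⟨M.pairs.map Prod.snd, M.nodup_snd⟩

/-- The set of matched pairs of indices. -/
def PartialMatching.pairFinset : Finset (ι × κ) := ⟨M.pairs, M.nodup_fst.of_map⟩

/-- Matched pairs are determined by their first component. -/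
noncomputable def PartialMatching.fstEquiv : M.pairFinset ≃ M.fstFinset :=
  Equiv.ofBijective (fun z => ⟨z.1.1, Multiset.mem_map_of_mem _ z.2⟩) (by
    constructor
    · intro z w h
      exact Subtype.ext (Multiset.inj_on_of_nodup_map M.nodup_fst _ z.2 _ w.2 (congrArg Subtype.val h))
    · rintro ⟨i, hi⟩
      obtain ⟨z, hz, rfl⟩ := Multiset.mem_map.1 hi
      exact ⟨⟨z, hz⟩, rfl⟩)

/-- Matched pairs are determined by their second component. -/
noncomputable def PartialMatching.sndEquiv : M.pairFinset ≃ M.sndFinset :=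
  Equiv.ofBijective (fun z => ⟨z.1.2, Multiset.mem_map_of_mem _ z.2⟩) (by
    constructor
    · intro z w h
      exact Subtype.ext (Multiset.inj_on_of_nodup_map M.nodup_snd _ z.2 _ w.2 (congrArg Subtype.val h))
    · rintro ⟨i, hi⟩
      obtain ⟨z, hz, rfl⟩ := Multiset.mem_map.1 hi
      exact ⟨⟨z, hz⟩, rfl⟩)

theorem PartialMatching.sum_fstFinset (c : ι → κ → ℝ≥0∞) :
    ∑ i : M.fstFinset, c i (M.sndEquiv (M.fstEquiv.symm i)) =
      (M.pairs.map fun z => c z.1 z.2).sum := by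
  rw [← Equiv.sum_comp M.fstEquiv]
  simp only [Equiv.symm_apply_apply]
  exact Finset.sum_coe_sort M.pairFinset fun z => c z.1 z.2

/-- The multiset of all indices has no repetition, so the matched pairs form the graph of a
bijection between two subsets and the unmatched parts are the complements. -/
theorem transportCost_univ [DecidableEq ι] [DecidableEq κ] (c : ι → κ → ℝ≥0∞) (h : ι → ℝ≥0∞) (k : κ → ℝ≥0∞) :
    transportCost c h k (Finset.univ : Finset ι).val (Finset.univ : Finset κ).val =
      ⨅ τ : (A : Finset ι) × (B : Finset κ) × (A ≃ B),
        ((∑ i : τ.1, c i (τ.2.2 i)) + (∑ i ∈ τ.1ᶜ, h i) + ∑ j ∈ τ.2.1ᶜ, k j) := by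
  apply le_antisymm
  · refine le_iInf fun ⟨A, B, e⟩ => ?_
    have h1 : (Finset.univ : Finset ι).val =
        ((Finset.univ : Finset A).val.map fun i => (i.1, (e i).1)).map Prod.fst + Aᶜ.val := by
      rw [← val_add_compl_val A, Multiset.map_map]
      congr 1
      exact (Multiset.attach_map_val A.val).symm
    have h2 : (Finset.univ : Finset κ).val =
        ((Finset.univ : Finset A).val.map fun i => (i.1, (e i).1)).map Prod.snd + Bᶜ.val := by
      rw [← val_add_compl_val B, Multiset.map_map]
      congr 1
      have := congrArg (Multiset.map Subtype.val) (Multiset.map_univ_val_equiv e)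
      rw [Multiset.map_map] at this
      exact (Multiset.attach_map_val B.val).symm.trans this.symm
    refine (transportCost_le ⟨_, _, _, h1, h2⟩).trans (le_of_eq ?_)
    simp only [PartialMatching.cost, Multiset.map_map]
    rfl
  · refine le_iInf fun M => (iInf_le _ ⟨M.fstFinset, M.sndFinset,
      M.fstEquiv.symm.trans M.sndEquiv⟩).trans (le_of_eq ?_)
    simp only [PartialMatching.cost, Equiv.trans_apply]
    rw [M.sum_fstFinset c, Finset.sum, Finset.sum, ← eq_compl_val (A := M.fstFinset) M.fst_eq,
      ← eq_compl_val (A := M.sndFinset) M.snd_eq]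

theorem fullMatchingCost_univ [DecidableEq κ] (c : ι → κ → ℝ≥0∞) (hle : Fintype.card ι ≤ Fintype.card κ) :
    fullMatchingCost c (Finset.univ : Finset ι).val (Finset.univ : Finset κ).val =
      ⨅ σ : ι ↪ κ, ∑ i, c i (σ i) := by
  apply le_antisymm
  · refine le_iInf fun σ => ?_
    have h1 : (Finset.univ : Finset ι).val =
        ((Finset.univ : Finset ι).val.map fun i => (i, σ i)).map Prod.fst + 0 := by
      simp [Multiset.map_map]
    have h2 : (Finset.univ : Finset κ).val =
        ((Finset.univ : Finset ι).val.map fun i => (i, σ i)).map Prod.snd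
          + (Finset.univ.map σ)ᶜ.val := by
      rw [← val_add_compl_val (Finset.univ.map σ), Multiset.map_map]
      rfl
    let M : PartialMatching (Finset.univ : Finset ι).val (Finset.univ : Finset κ).val :=
      ⟨_, _, _, h1, h2⟩
    refine (iInf₂_le M (Or.inl rfl)).trans (le_of_eq ?_)
    simp only [M, Multiset.map_map]
    rfl
  · refine le_iInf₂ fun M hM => ?_
    have c1 := congrArg Multiset.card M.fst_eq
    have c2 := congrArg Multiset.card M.snd_eq
    simp only [Multiset.card_add, Multiset.card_map, Finset.card_val, Finset.card_univ] at c1 c2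
    -- If instead the right side is exhausted, the inequality of cardinalities leaves no room on the
    -- left.
    have hl : M.left = 0 := by
      rcases hM with hM | hM
      · exact hM
      · rw [hM, Multiset.card_zero] at c2
        exact Multiset.card_eq_zero.1 (by omega)
    have hA : M.fstFinset = Finset.univ := by
      apply Finset.val_injective
      have := M.fst_eq
      rw [hl, add_zero] at this
      exact this.symm
    have hmem : ∀ i, i ∈ M.fstFinset := fun i => hA ▸ Finset.mem_univ i
    have hinj : Function.Injective fun i : ι =>
        ((M.sndEquiv (M.fstEquiv.symm ⟨i, hmem i⟩) : M.sndFinset) : κ) := by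
      intro i j hij
      exact congrArg Subtype.val (M.fstEquiv.symm.injective (M.sndEquiv.injective (Subtype.ext hij)))
    refine (iInf_le _ ⟨_, hinj⟩).trans (le_of_eq ?_)
    rw [← M.sum_fstFinset c]
    exact (Equiv.sum_comp (Equiv.subtypeUnivEquiv hmem)
      (fun i => c i (M.sndEquiv (M.fstEquiv.symm ⟨i, hmem i⟩)))).symm

end Index

theorem fullMatchingCost_symm {α β : Type*} (c : α → β → ℝ≥0∞) (X : Multiset α) (Y : Multiset β) :
    fullMatchingCost c X Y = fullMatchingCost (fun y x => c x y) Y X := by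
  apply le_antisymm
  · refine le_iInf₂ fun M hM => (iInf₂_le M.symm hM.symm).trans (le_of_eq ?_)
    simp [Multiset.map_map]
  · refine le_iInf₂ fun M hM => (iInf₂_le M.symm hM.symm).trans (le_of_eq ?_)
    simp [Multiset.map_map]

/-! ### Measurability -/

theorem measurable_multiset_sum_map {Ω ι : Type*} [MeasurableSpace Ω] (s : Multiset ι)
    {f : ι → Ω → ℝ≥0∞} (hf : ∀ i, Measurable (f i)) :
    Measurable fun ω => (s.map fun i => f i ω).sum := by
  induction s using Multiset.induction with
  | empty => simp
  | cons i s ih =>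
    simp only [Multiset.map_cons, Multiset.sum_cons]
    exact (hf i).add ih

variable {d : ℕ}

/-- After the pullback to indices, the cost is an infimum, over a countable type independent of the
points, of finite sums of measurable functions. -/
theorem measurableFunctional₂_transportCost {c : Pt d → Pt d → ℝ≥0∞} {h : Pt d → ℝ≥0∞}
    (hc : Measurable fun z : Pt d × Pt d => c z.1 z.2) (hh : Measurable h) :
    MeasurableFunctional₂ (transportCost c h h) := by
  intro m n
  simp only [toMultiset, transportCost_map]
  refine Measurable.iInf fun M => ?_
  simp only [PartialMatching.cost, Function.comp_apply]
  refine Measurable.add (Measurable.add (measurable_multiset_sum_map _ fun z => ?_)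
    (measurable_multiset_sum_map _ fun i => ?_)) (measurable_multiset_sum_map _ fun i => ?_)
  · exact hc.comp (f := fun a : (Fin m → Pt d) × (Fin n → Pt d) => (a.1 z.1, a.2 z.2)) (by fun_prop)
  · exact hh.comp (by fun_prop)
  · exact hh.comp (by fun_prop)

theorem measurableFunctional₂_fullMatchingCost {c : Pt d → Pt d → ℝ≥0∞}
    (hc : Measurable fun z : Pt d × Pt d => c z.1 z.2) :
    MeasurableFunctional₂ (fullMatchingCost c) := by
  intro m n
  simp only [toMultiset, fullMatchingCost_map]
  refine Measurable.iInf fun M => Measurable.iInf fun hM => ?_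
  refine measurable_multiset_sum_map _ fun z => ?_
  exact hc.comp (f := fun a : (Fin m → Pt d) × (Fin n → Pt d) => (a.1 z.1, a.2 z.2)) (by fun_prop)

/-! ### The power of the distance -/

/-- The `p`-th power of the distance. -/
noncomputable def powDist (p : ℝ) (x y : Pt d) : ℝ≥0∞ := edist x y ^ p

theorem powDist_eq_ofReal {p : ℝ} (hp : 0 < p) (x y : Pt d) :
    powDist p x y = ENNReal.ofReal (‖x - y‖ ^ p) := by
  rw [powDist, edist_eq_enorm_sub, ← ofReal_norm,
    ENNReal.ofReal_rpow_of_nonneg (norm_nonneg _) hp.le]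

theorem measurable_powDist (p : ℝ) : Measurable fun z : Pt d × Pt d => powDist p z.1 z.2 := by
  unfold powDist
  fun_prop

theorem powDist_comm (p : ℝ) (x y : Pt d) : powDist p x y = powDist p y x := by
  rw [powDist, powDist, edist_comm]

theorem powDist_triangle {p : ℝ} (hp : 0 < p) (hp1 : p ≤ 1) (x y z : Pt d) :
    powDist p x z ≤ powDist p x y + powDist p y z :=
  (ENNReal.rpow_le_rpow (edist_triangle x y z) hp.le).trans
    (ENNReal.rpow_add_le_add_rpow _ _ hp.le hp1)

/-- The expected transport cost between two independent Poisson processes. -/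
noncomputable def transportMean (p : ℝ) (h : Pt d → ℝ≥0∞) (ν : Measure (Pt d)) : ℝ≥0∞ :=
  poissonMean₂ ν (transportCost (powDist p) h h)

/-- The expected full matching cost between two independent Poisson processes. -/
noncomputable def matchingMean (p : ℝ) (ν : Measure (Pt d)) : ℝ≥0∞ :=
  poissonMean₂ ν (fullMatchingCost (powDist p))

/-- The price of leaving the unit cube. -/
noncomputable def boundaryCost (p : ℝ) (x : Pt d) : ℝ≥0∞ :=
  ENNReal.ofReal (min ((2 : ℝ) ^ (p - 1)) 1 * Metric.infDist x (frontier (unitCube d)) ^ p)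

theorem measurable_boundaryCost (p : ℝ) : Measurable (boundaryCost (d := d) p) := by
  unfold boundaryCost
  have : Measurable fun x : Pt d => Metric.infDist x (frontier (unitCube d)) :=
    (Metric.continuous_infDist_pt _).measurable
  fun_prop

theorem ofReal_matchingCost {p : ℝ} (hp : 0 < p) (m n : ℕ) (X : Fin m → Pt d) (Y : Fin n → Pt d) :
    ENNReal.ofReal (matchingCost d p m n X Y) =
      fullMatchingCost (powDist p) (toMultiset X) (toMultiset Y) := by
  rw [toMultiset, toMultiset, fullMatchingCost_map, matchingCost]
  split_ifs with hmn
  · rw [fullMatchingCost_univ _ (by simpa using hmn)]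
    have : Nonempty (Fin m ↪ Fin n) := ⟨Fin.castLEEmb hmn⟩
    rw [ENNReal.ofReal_iInf]
    refine iInf_congr fun σ => ?_
    rw [ENNReal.ofReal_sum_of_nonneg fun i _ => by positivity]
    simp_rw [powDist_eq_ofReal hp]
  · rw [fullMatchingCost_symm, fullMatchingCost_univ _ (by simpa using (not_le.1 hmn).le)]
    have : Nonempty (Fin n ↪ Fin m) := ⟨Fin.castLEEmb (not_le.1 hmn).le⟩
    rw [ENNReal.ofReal_iInf]
    refine iInf_congr fun σ => ?_
    rw [ENNReal.ofReal_sum_of_nonneg fun i _ => by positivity]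
    simp_rw [powDist_eq_ofReal hp]

theorem ofReal_boundaryMatchingCost {p : ℝ} (hp : 0 < p) (m n : ℕ) (X : Fin m → Pt d)
    (Y : Fin n → Pt d) :
    ENNReal.ofReal (boundaryMatchingCost d p (unitCube d) m n X Y) =
      transportCost (powDist p) (boundaryCost p) (boundaryCost p) (toMultiset X) (toMultiset Y) := by
  rw [toMultiset, toMultiset, transportCost_map, boundaryMatchingCost, transportCost_univ]
  have : Nonempty ((A : Finset (Fin m)) × (B : Finset (Fin n)) × (A ≃ B)) :=
    ⟨(∅ : Finset (Fin m)), (∅ : Finset (Fin n)), Equiv.equivOfIsEmpty _ _⟩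
  rw [ENNReal.ofReal_iInf]
  refine iInf_congr fun τ => ?_
  have hq : ∀ x : Pt d,
      0 ≤ min ((2 : ℝ) ^ (p - 1)) 1 * Metric.infDist x (frontier (unitCube d)) ^ p := fun x => by
    have := Metric.infDist_nonneg (x := x) (s := frontier (unitCube d))
    positivity
  have h1 : 0 ≤ ∑ i : τ.1, ‖X i - Y (τ.2.2 i)‖ ^ p := by positivity
  rw [ENNReal.ofReal_add (add_nonneg h1 (Finset.sum_nonneg fun i _ => hq _))
      (Finset.sum_nonneg fun i _ => hq _), ENNReal.ofReal_add h1 (Finset.sum_nonneg fun i _ => hq _),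
    ENNReal.ofReal_sum_of_nonneg fun i _ => by positivity,
    ENNReal.ofReal_sum_of_nonneg fun i _ => hq _, ENNReal.ofReal_sum_of_nonneg fun i _ => hq _]
  simp_rw [powDist_eq_ofReal hp]
  rfl

theorem poissonExpectation_matchingCost {p : ℝ} (hp : 0 < p) (ν : Measure (Pt d))
    [IsFiniteMeasure ν] : poissonExpectation (matchingCost d p) ν = matchingMean p ν := by
  rw [matchingMean, (measurableFunctional₂_fullMatchingCost (measurable_powDist p)).poissonMean₂_eq]
  exact lintegral_congr fun Z => ofReal_matchingCost hp _ _ _ _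

theorem poissonExpectation_boundaryMatchingCost {p : ℝ} (hp : 0 < p) (ν : Measure (Pt d))
    [IsFiniteMeasure ν] : poissonExpectation (boundaryMatchingCost d p (unitCube d)) ν =
      transportMean p (boundaryCost p) ν := by
  rw [transportMean, (measurableFunctional₂_transportCost (measurable_powDist p)
    (measurable_boundaryCost p)).poissonMean₂_eq]
  exact lintegral_congr fun Z => ofReal_boundaryMatchingCost hp _ _ _ _

end BipartiteMatching

/-! ### The expected transport cost as a function of the intensity -/

namespace BipartiteMatching

variable {d : ℕ}

/-! ### Superposition and transport costs -/

theorem poissonMean₂_add_measure (μ ν : Measure (Pt d)) [IsFiniteMeasure μ] [IsFiniteMeasure ν]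
    {F : Multiset (Pt d) → Multiset (Pt d) → ℝ≥0∞} (hF : MeasurableFunctional₂ F) :
    poissonMean₂ (μ + ν) F = poissonMean μ fun X => poissonMean ν fun X' =>
      poissonMean μ fun Y => poissonMean ν fun Y' => F (X + X') (Y + Y') := by
  rw [poissonMean₂, poissonMean_add_measure μ ν (hF.poissonMean (μ + ν))]
  simp_rw [fun X => poissonMean_add_measure μ ν (hF.right X)]

theorem poissonMean_split_left (μ ν : Measure (Pt d)) [IsFiniteMeasure μ] [IsFiniteMeasure ν]
    (F : Multiset (Pt d) → Multiset (Pt d) → ℝ≥0∞) :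
    (poissonMean μ fun X => poissonMean ν fun _ => poissonMean μ fun Y => poissonMean ν fun _ =>
      F X Y) = poissonMean₂ μ F := by
  simp_rw [poissonMean_const]
  rfl

/-- The term `F` depends only on the ν-points, so the two μ-expectations integrate it to itself.
Measurability is required of `F` alone, because it is always the right summand. -/
theorem poissonMean_split_add (μ ν : Measure (Pt d)) [IsFiniteMeasure μ] [IsFiniteMeasure ν]
    (A : Multiset (Pt d) → Multiset (Pt d) → Multiset (Pt d) → Multiset (Pt d) → ℝ≥0∞)
    {F : Multiset (Pt d) → Multiset (Pt d) → ℝ≥0∞} (hF : MeasurableFunctional₂ F) :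
    (poissonMean μ fun X => poissonMean ν fun X' => poissonMean μ fun Y => poissonMean ν fun Y' =>
      (A X X' Y Y' + F X' Y')) =
    (poissonMean μ fun X => poissonMean ν fun X' => poissonMean μ fun Y => poissonMean ν fun Y' =>
      A X X' Y Y') + poissonMean₂ ν F := by
  have hc : ∀ a : ℝ≥0∞, MeasurableFunctional (d := d) fun _ => a := fun a _ => measurable_const
  have e1 : ∀ X X' Y, (poissonMean ν fun Y' => A X X' Y Y' + F X' Y') =
      (poissonMean ν fun Y' => A X X' Y Y') + poissonMean ν (F X') :=
    fun X X' Y => poissonMean_add_right ν (hF.right X')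
  have e2 : ∀ X X', (poissonMean μ fun Y => (poissonMean ν fun Y' => A X X' Y Y') +
      poissonMean ν (F X')) = (poissonMean μ fun Y => poissonMean ν fun Y' => A X X' Y Y') +
      poissonMean ν (F X') := fun X X' => by
    rw [poissonMean_add_right μ (hc _), poissonMean_const]
  have e3 : ∀ X, (poissonMean ν fun X' => (poissonMean μ fun Y => poissonMean ν fun Y' =>
      A X X' Y Y') + poissonMean ν (F X')) = (poissonMean ν fun X' => poissonMean μ fun Y =>
      poissonMean ν fun Y' => A X X' Y Y') + poissonMean₂ ν F :=
    fun X => poissonMean_add_right ν (hF.poissonMean ν)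
  simp only [e1, e2, e3]
  rw [poissonMean_add_right μ (hc _), poissonMean_const]

/-- A measurable exit cost which is Lipschitz for the `p`-th power of the distance. -/
structure IsExitCost (p : ℝ) (h : Pt d → ℝ≥0∞) : Prop where
  measurable : Measurable h
  le_add : ∀ x y, h x ≤ powDist p x y + h y

theorem IsExitCost.measurableFunctional₂ {p : ℝ} {h : Pt d → ℝ≥0∞} (hh : Measurable h) :
    MeasurableFunctional₂ (transportCost (powDist p) h h) :=
  measurableFunctional₂_transportCost (measurable_powDist p) hh

section TransportMean

variable {p : ℝ} {h : Pt d → ℝ≥0∞}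

theorem transportMean_add_le (hh : Measurable h) (μ ν : Measure (Pt d)) [IsFiniteMeasure μ]
    [IsFiniteMeasure ν] :
    transportMean p h (μ + ν) ≤ transportMean p h μ + transportMean p h ν := by
  have hF := IsExitCost.measurableFunctional₂ (p := p) hh
  rw [transportMean, poissonMean₂_add_measure μ ν hF, transportMean, transportMean,
    ← poissonMean_split_left μ ν, ← poissonMean_split_add μ ν _ hF]
  exact poissonMean_mono _ fun X => poissonMean_mono _ fun X' => poissonMean_mono _ fun Y =>
    poissonMean_mono _ fun Y' => transportCost_add_le _ _ _ _ _ _ _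

/-- Together with subadditivity this says that adding ν to an intensity changes the cost by at most
the cost of ν. The triangle inequality, hence p ≤ 1, enters here. -/
theorem transportMean_le_add (hp : 0 < p) (hp1 : p ≤ 1) (hh : IsExitCost p h)
    (μ ν : Measure (Pt d)) [IsFiniteMeasure μ] [IsFiniteMeasure ν] :
    transportMean p h μ ≤ transportMean p h (μ + ν) + transportMean p h ν := by
  have hF := IsExitCost.measurableFunctional₂ (p := p) hh.measurable
  rw [transportMean, transportMean, transportMean, poissonMean₂_add_measure μ ν hF,
    ← poissonMean_split_left μ ν, ← poissonMean_split_add μ ν _ hF]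
  exact poissonMean_mono _ fun X => poissonMean_mono _ fun X' => poissonMean_mono _ fun Y =>
    poissonMean_mono _ fun Y' => transportCost_le_add (powDist_comm p)
      (powDist_triangle hp hp1) hh.le_add _ _ _ _

theorem add_transportMean_le (hh : Measurable h) {μ ν : Measure (Pt d)} [IsFiniteMeasure μ]
    [IsFiniteMeasure ν] {A B : Set (Pt d)} (hA : ∀ᵐ x ∂μ, x ∈ A) (hB : ∀ᵐ x ∂ν, x ∈ B)
    (hAB : Disjoint A B) (hc : ∀ x ∈ A, ∀ y ∈ B, h x + h y ≤ powDist p x y) :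
    transportMean p h μ + transportMean p h ν ≤ transportMean p h (μ + ν) := by
  have hF := IsExitCost.measurableFunctional₂ (p := p) hh
  rw [transportMean, transportMean, transportMean, poissonMean₂_add_measure μ ν hF,
    ← poissonMean_split_left μ ν, ← poissonMean_split_add μ ν _ hF]
  refine poissonMean_mono_of_mem hA fun X hX => poissonMean_mono_of_mem hB fun X' hX' =>
    poissonMean_mono_of_mem hA fun Y hY => poissonMean_mono_of_mem hB fun Y' hY' => ?_
  have hBA : ∀ x ∈ B, x ∉ A := fun x hx hx' => Set.disjoint_left.1 hAB hx' hx
  refine add_transportCost_le hX hY (fun x hx => hBA x (hX' x hx)) (fun x hx => hBA x (hY' x hx))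
    (fun x hx y hy => hc x (hX x hx) y (hY' y hy)) fun x hx y hy => ?_
  rw [add_comm, powDist_comm]
  exact hc y (hY y hy) x (hX' x hx)

/-- No point is matched; Campbell's formula gives the mean exit price of each family. -/
theorem transportMean_le_lintegral (hh : Measurable h) (ν : Measure (Pt d)) [IsFiniteMeasure ν] :
    transportMean p h ν ≤ 2 * ∫⁻ x, h x ∂ν := by
  have hm := MeasurableFunctional.sum_map hh
  refine (poissonMean₂_mono ν fun X Y => transportCost_le_sum _ _ _ X Y).trans (le_of_eq ?_)
  simp_rw [poissonMean₂, fun a : ℝ≥0∞ => poissonMean_add_right ν (G := fun _ => a) hm,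
    poissonMean_const, poissonMean_sum_map ν hh]
  rw [poissonMean_add_left ν hm, poissonMean_sum_map ν hh, poissonMean_const, two_mul]

theorem transportMean_zero (hh : Measurable h) : transportMean p h (0 : Measure (Pt d)) = 0 := by
  have := transportMean_le_lintegral (p := p) hh (0 : Measure (Pt d))
  simpa using this

theorem transportMean_sum_le (hh : Measurable h) {ι : Type*} (s : Finset ι)
    (ν : ι → Measure (Pt d)) [∀ i, IsFiniteMeasure (ν i)] :
    transportMean p h (∑ i ∈ s, ν i) ≤ ∑ i ∈ s, transportMean p h (ν i) := by
  classical
  induction s using Finset.induction with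
  | empty => simp [transportMean_zero hh]
  | insert i s hi ih =>
    rw [Finset.sum_insert hi, Finset.sum_insert hi]
    exact (transportMean_add_le hh _ _).trans (by gcongr)

theorem sum_transportMean_le (hh : Measurable h) {ι : Type*} (s : Finset ι)
    (ν : ι → Measure (Pt d)) [∀ i, IsFiniteMeasure (ν i)] (A : ι → Set (Pt d))
    (hA : ∀ i ∈ s, ∀ᵐ x ∂ν i, x ∈ A i) (hdisj : ∀ i ∈ s, ∀ j ∈ s, i ≠ j → Disjoint (A i) (A j))
    (hc : ∀ i ∈ s, ∀ j ∈ s, i ≠ j → ∀ x ∈ A i, ∀ y ∈ A j, h x + h y ≤ powDist p x y) :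
    ∑ i ∈ s, transportMean p h (ν i) ≤ transportMean p h (∑ i ∈ s, ν i) := by
  classical
  induction s using Finset.induction with
  | empty => simp
  | insert i s hi ih =>
    rw [Finset.sum_insert hi, Finset.sum_insert hi]
    have h1 := ih (fun j hj => hA j (Finset.mem_insert_of_mem hj))
      (fun j hj k hk => hdisj j (Finset.mem_insert_of_mem hj) k (Finset.mem_insert_of_mem hk))
      (fun j hj k hk => hc j (Finset.mem_insert_of_mem hj) k (Finset.mem_insert_of_mem hk))
    have hne : ∀ j ∈ s, i ≠ j := fun j hj hij => hi (hij ▸ hj)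
    refine (add_le_add_right h1 _).trans (add_transportMean_le hh
      (B := ⋃ j ∈ s, A j) (hA i (Finset.mem_insert_self i s)) ?_ ?_ ?_)
    · rw [← Measure.sum_coe_finset, Measure.ae_sum_iff]
      rintro ⟨j, hj⟩
      filter_upwards [hA j (Finset.mem_insert_of_mem hj)] with x hx
      exact Set.mem_biUnion hj hx
    · refine Set.disjoint_iUnion₂_right.2 fun j hj => hdisj i (Finset.mem_insert_self i s) j
        (Finset.mem_insert_of_mem hj) (hne j hj)
    · intro x hx y hy
      obtain ⟨j, hj, hy⟩ := Set.mem_iUnion₂.1 hy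
      exact hc i (Finset.mem_insert_self i s) j (Finset.mem_insert_of_mem hj) (hne j hj) x hx y hy

theorem transportMean_mono_exit {h' : Pt d → ℝ≥0∞} {ν : Measure (Pt d)} [IsFiniteMeasure ν]
    (hle : ∀ᵐ x ∂ν, h x ≤ h' x) : transportMean p h ν ≤ transportMean p h' ν := by
  refine poissonMean_mono_of_mem (A := {x | h x ≤ h' x}) hle fun X hX =>
    poissonMean_mono_of_mem (A := {x | h x ≤ h' x}) hle fun Y hY => ?_
  refine iInf_mono fun M => ?_
  rw [PartialMatching.cost, PartialMatching.cost]
  refine add_le_add (add_le_add_right ?_ _) ?_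
  · refine Multiset.sum_map_le_sum_map _ _ fun x hx => hX x ?_
    rw [M.fst_eq]
    exact Multiset.mem_add.2 (Or.inr hx)
  · refine Multiset.sum_map_le_sum_map _ _ fun x hx => hY x ?_
    rw [M.snd_eq]
    exact Multiset.mem_add.2 (Or.inr hx)

theorem poissonMean₂_map (ν : Measure (Pt d)) [IsFiniteMeasure ν] {φ : Pt d → Pt d}
    (hφ : Measurable φ) {F : Multiset (Pt d) → Multiset (Pt d) → ℝ≥0∞}
    (hF : MeasurableFunctional₂ F) :
    poissonMean₂ (ν.map φ) F = poissonMean₂ ν fun X Y => F (X.map φ) (Y.map φ) := by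
  rw [poissonMean₂, poissonMean_map ν hφ (hF.poissonMean _)]
  simp_rw [fun X => poissonMean_map ν hφ (hF.right X)]
  rfl

theorem transportMean_map {h' : Pt d → ℝ≥0∞} (hh : Measurable h) (hh' : Measurable h')
    (ν : Measure (Pt d)) [IsFiniteMeasure ν] {φ : Pt d → Pt d} (hφ : Measurable φ) {a : ℝ≥0∞}
    (ha0 : a ≠ 0) (ha : a ≠ ∞) (hd : ∀ x y, powDist p (φ x) (φ y) = a * powDist p x y)
    (he : ∀ x, h (φ x) = a * h' x) :
    transportMean p h (ν.map φ) = a * transportMean p h' ν := by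
  rw [transportMean, poissonMean₂_map ν hφ (IsExitCost.measurableFunctional₂ hh), transportMean,
    ← poissonMean₂_const_mul ν (IsExitCost.measurableFunctional₂ hh')]
  simp_rw [transportCost_map, hd, Function.comp_def, he, transportCost_const_mul ha0 ha]

theorem matchingMean_le_transportMean (ν : Measure (Pt d))
    (hc : ∀ x y, powDist p x y ≤ h x + h y) : matchingMean p ν ≤ transportMean p h ν :=
  poissonMean₂_mono ν fun X Y => fullMatchingCost_le_transportCost hc X Y

/-- The bounded part `H` of the exit price is paid by the surplus points only, whose mean number is
of the order of the square root of the mass; the excess `k` is paid by all points and evaluated by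
Campbell's formula. -/
theorem transportMean_le_matchingMean (ν : Measure (Pt d)) [IsFiniteMeasure ν] {H : ℝ≥0∞}
    {k : Pt d → ℝ≥0∞} (hk : Measurable k) (hle : ∀ x, h x ≤ H + k x) :
    transportMean p h ν ≤
      matchingMean p ν + H * (2 * ν Set.univ ^ (1 / 2 : ℝ)) + 2 * ∫⁻ x, k x ∂ν := by
  have hm := MeasurableFunctional.sum_map hk
  have hM := measurableFunctional₂_fullMatchingCost (d := d) (measurable_powDist p)
  have hD : MeasurableFunctional₂ (d := d) cardDist :=
    measurableFunctional₂_card fun m n => (((m - n : ℕ) + (n - m : ℕ)) : ℝ≥0∞)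
  have hHD : MeasurableFunctional₂ (d := d) fun X Y => H * cardDist X Y :=
    fun m n => (hD m n).const_mul H
  have hX : MeasurableFunctional₂ (d := d) fun X _ => (X.map k).sum :=
    fun m n => (hm m).comp measurable_fst
  have hle' : transportMean p h ν ≤ poissonMean₂ ν fun X Y => fullMatchingCost (powDist p) X Y +
      H * cardDist X Y + (X.map k).sum + (Y.map k).sum :=
    poissonMean₂_mono ν fun X Y => transportCost_le_fullMatchingCost hle hle X Y
  refine hle'.trans ?_
  rw [poissonMean₂_add_left ν (F := fun X Y => fullMatchingCost (powDist p) X Y +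
      H * cardDist X Y + (X.map k).sum) (fun m n => ((hM m n).add (hHD m n)).add (hX m n)),
    poissonMean₂_add_left ν (F := fun X Y => fullMatchingCost (powDist p) X Y +
      H * cardDist X Y) (fun m n => (hM m n).add (hHD m n)),
    poissonMean₂_add_left ν hM, poissonMean₂_const_mul ν hD, add_assoc, two_mul (∫⁻ x, k x ∂ν)]
  have h1 : poissonMean₂ ν (fun X _ => (X.map k).sum) = ∫⁻ x, k x ∂ν := by
    simp_rw [poissonMean₂, poissonMean_const, poissonMean_sum_map ν hk]
  have h2 : poissonMean₂ ν (fun _ Y => (Y.map k).sum) = ∫⁻ x, k x ∂ν := by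
    simp_rw [poissonMean₂, poissonMean_sum_map ν hk, poissonMean_const]
  rw [h1, h2]
  gcongr
  · exact le_rfl
  · exact poissonMean₂_cardDist_le ν

theorem transportMean_le_matchingMean_of_ae_le (hh : Measurable h) (ν : Measure (Pt d))
    [IsFiniteMeasure ν] {H : ℝ≥0∞} (hle : ∀ᵐ x ∂ν, h x ≤ H) :
    transportMean p h ν ≤ matchingMean p ν + H * (2 * ν Set.univ ^ (1 / 2 : ℝ)) := by
  have hs : MeasurableSet {x | H < h x} := measurableSet_lt measurable_const hh
  -- The excess is taken infinite where the bound by `H` fails, a null set.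
  have h1 := transportMean_le_matchingMean (p := p) (h := h) (H := H) ν
    (k := {x | H < h x}.indicator fun _ => ∞) (measurable_const.indicator hs) fun x => by
      by_cases hx : H < h x
      · simp [Set.indicator_of_mem (s := {x | H < h x}) hx]
      · exact (not_lt.1 hx).trans le_self_add
  have h2 : ∫⁻ x, {x | H < h x}.indicator (fun _ => ∞) x ∂ν = 0 := by
    rw [lintegral_indicator hs, lintegral_const, Measure.restrict_apply_univ]
    have : ν {x | H < h x} = 0 := by
      rw [ae_iff] at hle
      simpa using hle
    rw [this, mul_zero]
  rwa [h2, mul_zero, add_zero] at h1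

/-- The full matching cost serves as an intermediate, since it knows no exit price. Changing the
exit rule therefore costs only the square root of the mass, which is negligible in the limit. -/
theorem transportMean_change_exit {h' : Pt d → ℝ≥0∞} (hh : Measurable h)
    (hc : ∀ x y, powDist p x y ≤ h' x + h' y) (ν : Measure (Pt d)) [IsFiniteMeasure ν] {H : ℝ≥0∞}
    (hle : ∀ᵐ x ∂ν, h x ≤ H) :
    transportMean p h ν ≤ transportMean p h' ν + H * (2 * ν Set.univ ^ (1 / 2 : ℝ)) :=
  (transportMean_le_matchingMean_of_ae_le hh ν hle).trans
    (by gcongr; exact matchingMean_le_transportMean ν hc)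

end TransportMean

/-! ### Leaving at a given point -/

/-- The cost of leaving at the point `a`. -/
noncomputable def pointCost (p : ℝ) (a x : Pt d) : ℝ≥0∞ := powDist p x a

theorem isExitCost_pointCost {p : ℝ} (hp : 0 < p) (hp1 : p ≤ 1) (a : Pt d) :
    IsExitCost p (pointCost p a) where
  measurable := (measurable_powDist p).comp (f := fun x : Pt d => (x, a)) (by fun_prop)
  le_add x y := powDist_triangle hp hp1 x y a

theorem powDist_le_pointCost {p : ℝ} (hp : 0 < p) (hp1 : p ≤ 1) (a x y : Pt d) :
    powDist p x y ≤ pointCost p a x + pointCost p a y := by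
  rw [pointCost, pointCost, powDist_comm p y a]
  exact powDist_triangle hp hp1 x a y

/-- The homothety of ratio `r` that sends the origin to `a`. -/
noncomputable def homothety (a : Pt d) (r : ℝ) (x : Pt d) : Pt d := a + r • x

theorem measurable_homothety (a : Pt d) (r : ℝ) : Measurable (homothety a r) := by
  unfold homothety
  fun_prop

theorem powDist_homothety {p : ℝ} (hp : 0 < p) (a : Pt d) {r : ℝ} (hr : 0 < r) (x y : Pt d) :
    powDist p (homothety a r x) (homothety a r y) = ENNReal.ofReal (r ^ p) * powDist p x y := by
  rw [powDist_eq_ofReal hp, powDist_eq_ofReal hp, ← ENNReal.ofReal_mul (by positivity), homothety,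
    homothety, add_sub_add_left_eq_sub, ← smul_sub, norm_smul, Real.norm_of_nonneg hr.le,
    Real.mul_rpow hr.le (norm_nonneg _)]

theorem transportMean_homothety {p : ℝ} (hp : 0 < p) (hp1 : p ≤ 1) (a : Pt d) {r : ℝ} (hr : 0 < r)
    (ν : Measure (Pt d)) [IsFiniteMeasure ν] :
    transportMean p (pointCost p a) (ν.map (homothety a r)) =
      ENNReal.ofReal (r ^ p) * transportMean p (pointCost p 0) ν := by
  refine transportMean_map (isExitCost_pointCost hp hp1 a).measurable
    (isExitCost_pointCost hp hp1 0).measurable ν (measurable_homothety a r) ?_ ENNReal.ofReal_ne_top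
    (powDist_homothety hp a hr) fun x => ?_
  · have : 0 < r ^ p := by positivity
    simpa using this
  · have := powDist_homothety hp a hr x 0
    rwa [homothety, homothety, smul_zero, add_zero] at this

/-- A homothety scales the cost exactly if the exit point moves along with it, to `a`; the second
term pays for moving the exit back to the origin. -/
theorem transportMean_homothety_le {p : ℝ} (hp : 0 < p) (hp1 : p ≤ 1) (a : Pt d) {r : ℝ}
    (hr : 0 < r) (ν : Measure (Pt d)) [IsFiniteMeasure ν] {H : ℝ≥0∞}
    (hle : ∀ᵐ x ∂ν.map (homothety a r), pointCost p 0 x ≤ H) :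
    transportMean p (pointCost p 0) (ν.map (homothety a r)) ≤
      ENNReal.ofReal (r ^ p) * transportMean p (pointCost p 0) ν +
        H * (2 * ν Set.univ ^ (1 / 2 : ℝ)) := by
  refine (transportMean_change_exit (isExitCost_pointCost hp hp1 0).measurable
    (powDist_le_pointCost hp hp1 a) _ hle).trans (le_of_eq ?_)
  rw [transportMean_homothety hp hp1 a hr, Measure.map_apply (measurable_homothety a r)
    MeasurableSet.univ, Set.preimage_univ]

theorem le_transportMean_homothety {p : ℝ} (hp : 0 < p) (hp1 : p ≤ 1) (a : Pt d) {r : ℝ}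
    (hr : 0 < r) (ν : Measure (Pt d)) [IsFiniteMeasure ν] {H : ℝ≥0∞}
    (hle : ∀ᵐ x ∂ν.map (homothety a r), pointCost p a x ≤ H) :
    ENNReal.ofReal (r ^ p) * transportMean p (pointCost p 0) ν ≤
      transportMean p (pointCost p 0) (ν.map (homothety a r)) +
        H * (2 * ν Set.univ ^ (1 / 2 : ℝ)) := by
  have := transportMean_change_exit (isExitCost_pointCost hp hp1 a).measurable
    (powDist_le_pointCost hp hp1 0) _ hle
  rwa [transportMean_homothety hp hp1 a hr, Measure.map_apply (measurable_homothety a r)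
    MeasurableSet.univ, Set.preimage_univ] at this

end BipartiteMatching

/-! ### Cubic grids and the homotheties between their cells -/

namespace BipartiteMatching

variable {d : ℕ}

/-! ### Cells -/

/-- The index of the cell of the grid of mesh `r` which contains a point. -/
noncomputable def gridIndex (r : ℝ) (x : Pt d) : Fin d → ℤ := fun i => ⌊x i / r⌋

/-- The cells of the grid of mesh `r`. -/
def cell (r : ℝ) (z : Fin d → ℤ) : Set (Pt d) := {x | gridIndex r x = z}

/-- The lower corner of a cell. -/
noncomputable def corner (r : ℝ) (z : Fin d → ℤ) : Pt d := WithLp.toLp 2 fun i => r * z i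

@[simp]
theorem corner_apply (r : ℝ) (z : Fin d → ℤ) (i : Fin d) : corner r z i = r * z i := rfl

theorem measurable_gridIndex (r : ℝ) : Measurable (gridIndex (d := d) r) := by
  unfold gridIndex
  refine measurable_pi_lambda _ fun i => Int.measurable_floor.comp ?_
  fun_prop

theorem measurableSet_cell (r : ℝ) (z : Fin d → ℤ) : MeasurableSet (cell r z) :=
  measurable_gridIndex r (measurableSet_singleton z)

theorem mem_cell_iff {r : ℝ} (hr : 0 < r) {z : Fin d → ℤ} {x : Pt d} :
    x ∈ cell r z ↔ ∀ i, r * z i ≤ x i ∧ x i < r * (z i + 1) := by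
  simp only [cell, gridIndex, Set.mem_ofPred_eq, funext_iff, Int.floor_eq_iff, le_div_iff₀ hr,
    div_lt_iff₀ hr, mul_comm r]

theorem disjoint_cell {r : ℝ} {z w : Fin d → ℤ} (h : z ≠ w) : Disjoint (cell r z) (cell r w) :=
  Set.disjoint_left.2 fun _ hx hx' => h (hx.symm.trans hx')

theorem homothety_apply (a : Pt d) (r : ℝ) (x : Pt d) (i : Fin d) :
    homothety a r x i = a i + r * x i := by
  simp [homothety]

theorem homothety_mem_cell {r : ℝ} (hr : 0 < r) {z : Fin d → ℤ} {x : Pt d} :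
    homothety (corner r z) r x ∈ cell r z ↔ x ∈ cell 1 0 := by
  rw [mem_cell_iff hr, mem_cell_iff one_pos]
  simp only [homothety_apply, corner_apply, ← mul_add, mul_le_mul_iff_right₀ hr,
    mul_lt_mul_iff_right₀ hr, Pi.zero_apply]
  refine forall_congr' fun i => ?_
  simp

theorem preimage_homothety_cell {r : ℝ} (hr : 0 < r) (z : Fin d → ℤ) :
    homothety (corner r z) r ⁻¹' cell r z = cell 1 0 :=
  Set.ext fun _ => homothety_mem_cell hr

theorem eq_sum_restrict_cell {ν : Measure (Pt d)} {r : ℝ} {Z : Finset (Fin d → ℤ)}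
    (hZ : ∀ᵐ x ∂ν, gridIndex r x ∈ Z) : ν = ∑ z ∈ Z, ν.restrict (cell r z) := by
  ext s hs
  rw [Measure.finsetSum_apply]
  simp_rw [Measure.restrict_apply hs]
  rw [← measure_biUnion_finset]
  · refine measure_congr (eventuallyEq_set.2 ?_)
    filter_upwards [hZ] with x hx
    constructor
    · exact fun h => Set.mem_iUnion₂.2 ⟨_, hx, h, rfl⟩
    · intro h
      obtain ⟨z, _, h, _⟩ := Set.mem_iUnion₂.1 h
      exact h
  · intro z _ w _ hzw
    exact (disjoint_cell hzw).mono Set.inter_subset_right Set.inter_subset_right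
  · exact fun z _ => hs.inter (measurableSet_cell r z)

theorem homothety_homothety_inv (a : Pt d) {r : ℝ} (hr : 0 < r) (x : Pt d) :
    homothety a r (homothety (-(r⁻¹ • a)) r⁻¹ x) = x := by
  simp [homothety, smul_smul, hr.ne']

theorem exists_map_homothety_eq (ν : Measure (Pt d)) [IsFiniteMeasure ν] (a : Pt d) {r : ℝ}
    (hr : 0 < r) : ∃ ν' : Measure (Pt d), IsFiniteMeasure ν' ∧ ν'.map (homothety a r) = ν ∧
      ν' Set.univ = ν Set.univ := by
  refine ⟨ν.map (homothety (-(r⁻¹ • a)) r⁻¹), inferInstance, ?_, ?_⟩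
  · rw [Measure.map_map (measurable_homothety _ _) (measurable_homothety _ _)]
    have : homothety a r ∘ homothety (-(r⁻¹ • a)) r⁻¹ = id :=
      funext fun x => homothety_homothety_inv a hr x
    rw [this, Measure.map_id]
  · rw [Measure.map_apply (measurable_homothety _ _) MeasurableSet.univ, Set.preimage_univ]

/-- The uniform probability measure on the unit cell. -/
noncomputable def unitMeasure (d : ℕ) : Measure (Pt d) := volume.restrict (cell 1 0)

theorem unitCube_eq_preimage : (unitCube d : Set (Pt d)) =
    (MeasurableEquiv.toLp 2 (Fin d → ℝ)).symm ⁻¹' Set.Icc (fun _ => 0) fun _ => 1 := by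
  refine Set.ext fun x => ?_
  simp only [unitCube, Set.mem_ofPred_eq, Set.mem_preimage, Set.mem_Icc, Pi.le_def]
  exact forall_and

theorem unitCube_ae_eq : (unitCube d : Set (Pt d)) =ᵐ[volume] cell 1 0 := by
  have h := (Measure.univ_pi_Ico_ae_eq_Icc (μ := fun _ : Fin d => (volume : Measure ℝ))
    (f := fun _ => 0) (g := fun _ => 1)).symm
  have h2 := (EuclideanSpace.volume_preserving_symm_measurableEquiv_toLp
    (Fin d)).quasiMeasurePreserving.preimage_ae_eq h
  have h3 : (MeasurableEquiv.toLp 2 (Fin d → ℝ)).symm ⁻¹' (Set.univ.pi fun _ => Set.Ico 0 1) =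
      (cell 1 0 : Set (Pt d)) := by
    refine Set.ext fun x => ?_
    rw [mem_cell_iff one_pos]
    simp only [Set.mem_preimage, Set.mem_pi, Set.mem_univ, true_imp_iff, Set.mem_Ico]
    refine forall_congr' fun i => ?_
    simp
  rwa [h3, ← unitCube_eq_preimage] at h2

theorem restrict_unitCube : volume.restrict (unitCube d) = unitMeasure d :=
  Measure.restrict_congr_set unitCube_ae_eq

theorem volume_unitCell : volume (cell 1 0 : Set (Pt d)) = 1 := by
  rw [← measure_congr unitCube_ae_eq]
  have h := (EuclideanSpace.volume_preserving_symm_measurableEquiv_toLp (Fin d)).measure_preimage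
    (s := Set.Icc (fun _ => 0) fun _ => 1) measurableSet_Icc.nullMeasurableSet
  rw [Real.volume_Icc_pi] at h
  simp only [sub_zero, ENNReal.ofReal_one, Finset.prod_const_one] at h
  rw [unitCube_eq_preimage]
  exact h

instance : IsProbabilityMeasure (unitMeasure d) :=
  ⟨by rw [unitMeasure, Measure.restrict_apply_univ, volume_unitCell]⟩

theorem map_homothety_volume (a : Pt d) {r : ℝ} (hr : 0 < r) :
    ENNReal.ofReal (r ^ d) • (volume : Measure (Pt d)).map (homothety a r) = volume := by
  have h1 : homothety a r = (fun x => a + x) ∘ fun x => r • x := rfl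
  rw [h1, ← Measure.map_map (by fun_prop) (by fun_prop), Measure.map_addHaar_smul _ hr.ne',
    Measure.map_smul, map_add_left_eq_self, smul_smul, ← ENNReal.ofReal_mul (by positivity)]
  simp [abs_of_pos hr, hr.ne']

theorem restrict_cell_eq {r : ℝ} (hr : 0 < r) (z : Fin d → ℤ) :
    volume.restrict (cell r z) =
      ENNReal.ofReal (r ^ d) • (unitMeasure d).map (homothety (corner r z) r) := by
  conv_lhs => rw [← map_homothety_volume (corner r z) hr]
  rw [Measure.restrict_smul, Measure.restrict_map (measurable_homothety _ _)
    (measurableSet_cell r z), preimage_homothety_cell hr, unitMeasure]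

theorem volume_cell {r : ℝ} (hr : 0 < r) (z : Fin d → ℤ) :
    volume (cell r z) = ENNReal.ofReal (r ^ d) := by
  have := congrArg (fun μ => μ Set.univ) (restrict_cell_eq hr z)
  simpa [Measure.map_apply (measurable_homothety _ _)] using this

theorem norm_le_of_mem_cell {r : ℝ} (hr : 0 < r) {z : Fin d → ℤ} {x : Pt d} (hx : x ∈ cell r z) :
    ‖x - corner r z‖ ≤ r * d := by
  rw [mem_cell_iff hr] at hx
  rw [EuclideanSpace.norm_eq, Real.sqrt_le_iff]
  refine ⟨by positivity, ?_⟩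
  calc ∑ i, ‖(x - corner r z) i‖ ^ 2 ≤ ∑ _i : Fin d, r ^ 2 := by
        refine Finset.sum_le_sum fun i _ => ?_
        have h1 := hx i
        simp only [PiLp.sub_apply, corner_apply, Real.norm_eq_abs, sq_abs]
        rw [sq_le_sq₀ (by linarith) hr.le]
        linarith
    _ = r ^ 2 * d := by simp [mul_comm]
    _ ≤ (r * d) ^ 2 := by
        rw [mul_pow]
        gcongr
        exact_mod_cast Nat.le_self_pow two_ne_zero d

end BipartiteMatching

namespace BipartiteMatching

variable {d : ℕ}

/-! ### A scale invariant upper bound -/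

/-- The expected transport cost when unmatched points leave at the origin. -/
noncomputable def originMean (p : ℝ) (ν : Measure (Pt d)) : ℝ≥0∞ :=
  transportMean p (pointCost p 0) ν

/-- The power mean inequality with exponent 1/θ applied to the numbers `f i ^ θ`. It controls the
errors when a mass is distributed over many cells. -/
theorem sum_rpow_le {ι : Type*} (s : Finset ι) (f : ι → ℝ≥0∞) {θ : ℝ} (h0 : 0 < θ) (h1 : θ ≤ 1) :
    ∑ i ∈ s, f i ^ θ ≤ (s.card : ℝ≥0∞) ^ (1 - θ) * (∑ i ∈ s, f i) ^ θ := by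
  have h := ENNReal.rpow_sum_le_const_mul_sum_rpow s (fun i => f i ^ θ) (p := θ⁻¹)
    ((one_le_inv₀ h0).2 h1)
  simp_rw [← ENNReal.rpow_mul, mul_inv_cancel₀ h0.ne', ENNReal.rpow_one] at h
  have h2 := ENNReal.rpow_le_rpow h h0.le
  rw [← ENNReal.rpow_mul, inv_mul_cancel₀ h0.ne', ENNReal.rpow_one,
    ENNReal.mul_rpow_of_nonneg _ _ h0.le, ← ENNReal.rpow_mul] at h2
  convert h2 using 3
  field_simp

theorem pointCost_le_of_norm_le {p : ℝ} (hp : 0 < p) {a x : Pt d} {s : ℝ} (h : ‖x - a‖ ≤ s) :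
    pointCost p a x ≤ ENNReal.ofReal (s ^ p) := by
  rw [pointCost, powDist_eq_ofReal hp]
  gcongr

theorem ae_restrict_cell (ν : Measure (Pt d)) (r : ℝ) (z : Fin d → ℤ) :
    ∀ᵐ x ∂ν.restrict (cell r z), x ∈ cell r z :=
  ae_restrict_mem (measurableSet_cell r z)

theorem originMean_cell_le {p : ℝ} (hp : 0 < p) (hp1 : p ≤ 1) {ν : Measure (Pt d)}
    [IsFiniteMeasure ν] {r : ℝ} (hr : 0 < r) {z : Fin d → ℤ} (hν : ∀ᵐ x ∂ν, x ∈ cell r z)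
    {H : ℝ≥0∞} (hH : ∀ᵐ x ∂ν, pointCost p 0 x ≤ H) :
    ∃ ν' : Measure (Pt d), IsFiniteMeasure ν' ∧ (∀ᵐ x ∂ν', x ∈ cell 1 0) ∧
      ν' Set.univ = ν Set.univ ∧ originMean p ν ≤
        ENNReal.ofReal (r ^ p) * originMean p ν' + H * (2 * ν Set.univ ^ (1 / 2 : ℝ)) := by
  obtain ⟨ν', hf, rfl, hm⟩ := exists_map_homothety_eq ν (corner r z) hr
  refine ⟨ν', hf, ?_, hm, ?_⟩
  · have := ae_of_ae_map (measurable_homothety _ _).aemeasurable hν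
    exact this.mono fun x hx => (homothety_mem_cell hr).1 hx
  · rw [← hm]
    exact transportMean_homothety_le hp hp1 _ hr ν' hH

theorem gridIndex_mem_of_mem_unitCell {m : ℕ} (hm : 0 < m) {x : Pt d} (hx : x ∈ cell 1 0) :
    gridIndex (1 / m) x ∈ Fintype.piFinset fun _ : Fin d => Finset.Ico (0 : ℤ) m := by
  rw [mem_cell_iff one_pos] at hx
  rw [Fintype.mem_piFinset]
  intro i
  have hi := hx i
  simp only [Pi.zero_apply, Int.cast_zero, mul_zero, zero_add, mul_one] at hi
  have hm' : (0 : ℝ) < m := by exact_mod_cast hm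
  rw [Finset.mem_Ico, gridIndex, Int.le_floor, Int.floor_lt, div_div_eq_mul_div, div_one]
  constructor
  · push_cast
    exact mul_nonneg hi.1 hm'.le
  · push_cast
    nlinarith

theorem card_piFinset_Ico (m : ℕ) :
    (Fintype.piFinset fun _ : Fin d => Finset.Ico (0 : ℤ) m).card = m ^ d := by
  simp

theorem pointCost_zero_le_of_mem_unitCell {p : ℝ} (hp : 0 < p) {x : Pt d} (hx : x ∈ cell 1 0) :
    pointCost p 0 x ≤ ENNReal.ofReal ((d : ℝ) ^ p) := by
  have h := norm_le_of_mem_cell one_pos hx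
  have h0 : corner (d := d) 1 0 = 0 := by ext i; simp
  rw [h0, one_mul] at h
  exact pointCost_le_of_norm_le hp h

theorem originMean_le_two_mul {p : ℝ} (hp : 0 < p) (hp1 : p ≤ 1) {ν : Measure (Pt d)}
    [IsFiniteMeasure ν] {H : ℝ≥0∞} (hH : ∀ᵐ x ∂ν, pointCost p 0 x ≤ H) :
    originMean p ν ≤ 2 * H * ν Set.univ := by
  refine (transportMean_le_lintegral (isExitCost_pointCost hp hp1 0).measurable ν).trans ?_
  rw [mul_assoc, ← lintegral_const]
  gcongr 2 * ?_
  exact lintegral_mono_ae hH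

theorem sum_restrict_univ {ν : Measure (Pt d)} {r : ℝ} {Z : Finset (Fin d → ℤ)}
    (hZ : ∀ᵐ x ∂ν, gridIndex r x ∈ Z) :
    ∑ z ∈ Z, ν.restrict (cell r z) Set.univ = ν Set.univ := by
  conv_rhs => rw [eq_sum_restrict_cell hZ]
  rw [Measure.finsetSum_apply]

/-- The cell is cut into 2^d halves. Each is a copy of the unit cell, with costs multiplied by
2^(-p), and moving its exit to the origin costs the square root of its mass. By concavity these
roots add up to at most 2^(d/2) times the root of the total mass. Hence consecutive scales differ by
the factor 2^(d/2 - p), and after k steps the remaining points exit within a cell of side 2^(-k). -/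
theorem originMean_le_dyadic {p : ℝ} (hp : 0 < p) (hp1 : p ≤ 1) (k : ℕ) :
    ∀ (ν : Measure (Pt d)) [IsFiniteMeasure ν], (∀ᵐ x ∂ν, x ∈ cell 1 0) → originMean p ν ≤
      2 * ENNReal.ofReal ((d : ℝ) ^ p) * ENNReal.ofReal ((1 / 2) ^ p) ^ k * ν Set.univ +
      2 * ENNReal.ofReal ((d : ℝ) ^ p) * (2 ^ d) ^ (1 / 2 : ℝ) *
        (∑ j ∈ Finset.range k, (ENNReal.ofReal ((1 / 2) ^ p) * (2 ^ d) ^ (1 / 2 : ℝ)) ^ j) *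
        ν Set.univ ^ (1 / 2 : ℝ) := by
  set D := ENNReal.ofReal ((d : ℝ) ^ p)
  set a := ENNReal.ofReal ((1 / 2) ^ p) with ha
  set w : ℝ≥0∞ := (2 ^ d) ^ (1 / 2 : ℝ) with hw
  induction k with
  | zero =>
    intro ν _ hν
    have := originMean_le_two_mul hp hp1
      (hν.mono fun x hx => pointCost_zero_le_of_mem_unitCell hp hx)
    simpa using this
  | succ k ih =>
    intro ν _ hν
    set S := ∑ j ∈ Finset.range k, (a * w) ^ j with hS
    set Z := Fintype.piFinset fun _ : Fin d => Finset.Ico (0 : ℤ) (2 : ℕ)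
    have hZ : ∀ᵐ x ∂ν, gridIndex (1 / (2 : ℕ)) x ∈ Z :=
      hν.mono fun x hx => gridIndex_mem_of_mem_unitCell two_pos hx
    have hsum := sum_restrict_univ hZ
    push_cast at hZ hsum
    have hstep : ∀ z ∈ Z, originMean p (ν.restrict (cell (1 / 2) z)) ≤
        2 * D * a ^ (k + 1) * ν.restrict (cell (1 / 2) z) Set.univ +
        (a * (2 * D * w * S) + 2 * D) * ν.restrict (cell (1 / 2) z) Set.univ ^ (1 / 2 : ℝ) := by
      intro z _
      obtain ⟨ν', hf, hν', hm, hle⟩ := originMean_cell_le (ν := ν.restrict (cell (1 / 2) z))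
        (H := D) hp hp1 one_half_pos (ae_restrict_cell ν (1 / 2) z)
        (ae_restrict_of_ae (hν.mono fun x hx => pointCost_zero_le_of_mem_unitCell hp hx))
      refine hle.trans ?_
      rw [← ha, ← hm]
      calc a * originMean p ν' + D * (2 * ν' Set.univ ^ (1 / 2 : ℝ))
          ≤ a * (2 * D * a ^ k * ν' Set.univ + 2 * D * w * S * ν' Set.univ ^ (1 / 2 : ℝ))
            + D * (2 * ν' Set.univ ^ (1 / 2 : ℝ)) := by gcongr; exact ih ν' hν'
        _ = _ := by ring
    have hcard : (Z.card : ℝ≥0∞) = 2 ^ d := by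
      rw [card_piFinset_Ico]
      push_cast
      rfl
    calc originMean p ν = originMean p (∑ z ∈ Z, ν.restrict (cell (1 / 2) z)) := by
          rw [← eq_sum_restrict_cell hZ]
      _ ≤ ∑ z ∈ Z, originMean p (ν.restrict (cell (1 / 2) z)) :=
          transportMean_sum_le (isExitCost_pointCost hp hp1 0).measurable Z _
      _ ≤ ∑ z ∈ Z, (2 * D * a ^ (k + 1) * ν.restrict (cell (1 / 2) z) Set.univ +
        (a * (2 * D * w * S) + 2 * D) * ν.restrict (cell (1 / 2) z) Set.univ ^ (1 / 2 : ℝ)) :=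
          Finset.sum_le_sum hstep
      _ = 2 * D * a ^ (k + 1) * ν Set.univ + (a * (2 * D * w * S) + 2 * D) *
          ∑ z ∈ Z, ν.restrict (cell (1 / 2) z) Set.univ ^ (1 / 2 : ℝ) := by
          rw [Finset.sum_add_distrib, ← Finset.mul_sum, ← Finset.mul_sum, hsum]
      _ ≤ 2 * D * a ^ (k + 1) * ν Set.univ + (a * (2 * D * w * S) + 2 * D) *
          (w * ν Set.univ ^ (1 / 2 : ℝ)) := by
          gcongr
          refine (sum_rpow_le Z _ one_half_pos (by norm_num)).trans (le_of_eq ?_)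
          rw [hsum, hcard, hw]
          norm_num
      _ = _ := by
          rw [geom_sum_succ, ← hS]
          ring

theorem exists_geom_sum_le {A : ℝ≥0∞} (hA : 1 < A) (hA' : A ≠ ∞) :
    ∃ K : ℝ≥0∞, K ≠ ∞ ∧ ∀ k : ℕ, ∑ j ∈ Finset.range k, A ^ j ≤ K * A ^ k := by
  have h0 : A - 1 ≠ 0 := (tsub_pos_of_lt hA).ne'
  have h1 : A - 1 ≠ ∞ := ENNReal.sub_ne_top hA'
  have h2 : A * (A - 1)⁻¹ = 1 + (A - 1)⁻¹ := by
    calc A * (A - 1)⁻¹ = (A - 1 + 1) * (A - 1)⁻¹ := by rw [tsub_add_cancel_of_le hA.le]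
      _ = _ := by rw [add_mul, ENNReal.mul_inv_cancel h0 h1, one_mul]
  refine ⟨(A - 1)⁻¹, ENNReal.inv_ne_top.2 h0, fun k => ?_⟩
  -- The closed form of the sum, with the subtracted term moved to the left so that no truncated
  -- subtraction of sums occurs.
  have key : ∑ j ∈ Finset.range k, A ^ j + (A - 1)⁻¹ ≤ (A - 1)⁻¹ * A ^ k := by
    induction k with
    | zero => simp
    | succ k ih =>
      rw [geom_sum_succ, add_assoc, ← h2, ← mul_add, pow_succ', mul_left_comm]
      gcongr
  exact le_self_add.trans key

/-- The dyadic bound is stopped when the average mass of a cell is of order one. As p < d/2, the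
ratio n^(1/2 - p/d), with n = 2^d, exceeds 1, so the geometric sum is comparable to its last term
and both terms of the bound become |ν|^(1-p/d). -/
theorem exists_originMean_unitCell_le {p : ℝ} (hp : 0 < p) (hp1 : p ≤ 1)
    (hpd : p < (d : ℝ) / 2) : ∃ C : ℝ≥0∞, C ≠ ∞ ∧ ∀ (ν : Measure (Pt d)) [IsFiniteMeasure ν],
      (∀ᵐ x ∂ν, x ∈ cell 1 0) → 1 ≤ ν Set.univ →
      originMean p ν ≤ C * ν Set.univ ^ (1 - p / d) := by
  have hd : (0 : ℝ) < d := by linarith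
  have hd0 : d ≠ 0 := by
    rintro rfl
    simp at hd
  set n : ℝ := 2 ^ d with hn
  have hn1 : 1 < n := one_lt_pow₀ one_lt_two hd0
  have hn0 : 0 < n := by positivity
  have h2p : (2 : ℝ) ^ p = n ^ (p / d) := by
    rw [hn, ← Real.rpow_natCast, ← Real.rpow_mul two_pos.le]
    congr 1
    field_simp
  have hθ : 0 < 1 / 2 - p / d := by
    rw [sub_pos, div_lt_iff₀ hd]
    linarith
  have hAr : ENNReal.ofReal ((1 / 2) ^ p) * (2 ^ d) ^ (1 / 2 : ℝ) =
      ENNReal.ofReal (n ^ (1 / 2 - p / d)) := by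
    have : (2 ^ d : ℝ≥0∞) = ENNReal.ofReal n := by
      rw [hn, ENNReal.ofReal_pow two_pos.le]
      simp
    rw [this, ENNReal.ofReal_rpow_of_pos hn0, ← ENNReal.ofReal_mul (by positivity),
      Real.rpow_sub hn0, ← h2p, Real.div_rpow zero_le_one two_pos.le, Real.one_rpow]
    congr 1
    ring
  obtain ⟨K, hK, hKS⟩ := exists_geom_sum_le (A := ENNReal.ofReal (n ^ (1 / 2 - p / d)))
    (by rw [ENNReal.one_lt_ofReal]; exact Real.one_lt_rpow hn1 hθ) ENNReal.ofReal_ne_top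
  set D := ENNReal.ofReal ((d : ℝ) ^ p)
  have hw : ((2 : ℝ≥0∞) ^ d) ^ (1 / 2 : ℝ) ≠ ∞ :=
    ENNReal.rpow_ne_top_of_nonneg (by norm_num) (by simp)
  refine ⟨2 * D * ENNReal.ofReal (2 ^ p) + 2 * D * (2 ^ d) ^ (1 / 2 : ℝ) * K, ?_, ?_⟩
  · exact ENNReal.add_ne_top.2 ⟨by simp [ENNReal.mul_eq_top, D],
      ENNReal.mul_ne_top (ENNReal.mul_ne_top (by simp [ENNReal.mul_eq_top, D]) hw) hK⟩
  intro ν _ hν hm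
  set M := (ν Set.univ).toReal with hM
  have hMm : ν Set.univ = ENNReal.ofReal M := (ENNReal.ofReal_toReal (measure_ne_top _ _)).symm
  have hM1 : 1 ≤ M := by
    rw [hMm] at hm
    simpa using hm
  have hM0 : 0 < M := by linarith
  -- The stopping scale: n^k ≤ M < n^(k+1).
  obtain ⟨k, hk1, hk2⟩ := exists_nat_pow_near hM1 hn1
  have e1 : ((1 / 2 : ℝ) ^ p) ^ k * M ≤ 2 ^ p * M ^ (1 - p / d) := by
    have h1 : M = M ^ (1 - p / d) * M ^ (p / d) := by
      rw [← Real.rpow_add hM0]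
      simp
    have h2 : M ^ (p / d) ≤ (2 ^ p) ^ (k + 1) := by
      calc M ^ (p / d) ≤ (n ^ (k + 1)) ^ (p / d) := by gcongr
        _ = _ := by
          rw [h2p, ← Real.rpow_natCast, ← Real.rpow_natCast, ← Real.rpow_mul hn0.le,
            ← Real.rpow_mul hn0.le, mul_comm]
    have h3 : ((1 / 2 : ℝ) ^ p) ^ k * (2 ^ p) ^ (k + 1) = 2 ^ p := by
      rw [pow_succ, ← mul_assoc, ← mul_pow, ← Real.mul_rpow (by norm_num) (by norm_num)]
      norm_num
    calc ((1 / 2 : ℝ) ^ p) ^ k * M = ((1 / 2 : ℝ) ^ p) ^ k * (M ^ (1 - p / d) * M ^ (p / d)) := by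
          rw [← h1]
      _ ≤ ((1 / 2 : ℝ) ^ p) ^ k * (M ^ (1 - p / d) * (2 ^ p) ^ (k + 1)) := by gcongr
      _ = (((1 / 2 : ℝ) ^ p) ^ k * (2 ^ p) ^ (k + 1)) * M ^ (1 - p / d) := by ring
      _ = _ := by rw [h3]
  have e2 : (n ^ (1 / 2 - p / d)) ^ k * M ^ (1 / 2 : ℝ) ≤ M ^ (1 - p / d) := by
    have h1 : (n ^ (1 / 2 - p / d)) ^ k ≤ M ^ (1 / 2 - p / d) := by
      calc (n ^ (1 / 2 - p / d)) ^ k = (n ^ k) ^ (1 / 2 - p / d) := by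
            rw [← Real.rpow_natCast, ← Real.rpow_natCast, ← Real.rpow_mul hn0.le,
              ← Real.rpow_mul hn0.le, mul_comm]
        _ ≤ _ := by gcongr
    calc _ ≤ M ^ (1 / 2 - p / d) * M ^ (1 / 2 : ℝ) := by gcongr
      _ = _ := by
        rw [← Real.rpow_add hM0]
        congr 1
        ring
  have E1 : ENNReal.ofReal ((1 / 2) ^ p) ^ k * ν Set.univ ≤
      ENNReal.ofReal (2 ^ p) * ν Set.univ ^ (1 - p / d) := by
    rw [hMm, ENNReal.ofReal_rpow_of_pos hM0, ← ENNReal.ofReal_pow (by positivity),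
      ← ENNReal.ofReal_mul (by positivity), ← ENNReal.ofReal_mul (by positivity)]
    exact ENNReal.ofReal_le_ofReal e1
  have E2 : ENNReal.ofReal (n ^ (1 / 2 - p / d)) ^ k * ν Set.univ ^ (1 / 2 : ℝ) ≤
      ν Set.univ ^ (1 - p / d) := by
    rw [hMm, ENNReal.ofReal_rpow_of_pos hM0, ENNReal.ofReal_rpow_of_pos hM0,
      ← ENNReal.ofReal_pow (by positivity), ← ENNReal.ofReal_mul (by positivity)]
    exact ENNReal.ofReal_le_ofReal e2
  refine (originMean_le_dyadic hp hp1 k ν hν).trans ?_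
  rw [hAr]
  calc _ ≤ 2 * D * (ENNReal.ofReal ((1 / 2) ^ p) ^ k * ν Set.univ) +
        2 * D * (2 ^ d) ^ (1 / 2 : ℝ) * (K * ENNReal.ofReal (n ^ (1 / 2 - p / d)) ^ k) *
          ν Set.univ ^ (1 / 2 : ℝ) := by
        rw [← mul_assoc (2 * D) _ (ν Set.univ)]
        gcongr
        exact hKS k
    _ = 2 * D * (ENNReal.ofReal ((1 / 2) ^ p) ^ k * ν Set.univ) +
        2 * D * (2 ^ d) ^ (1 / 2 : ℝ) * K * (ENNReal.ofReal (n ^ (1 / 2 - p / d)) ^ k *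
          ν Set.univ ^ (1 / 2 : ℝ)) := by ring
    _ ≤ 2 * D * (ENNReal.ofReal (2 ^ p) * ν Set.univ ^ (1 - p / d)) +
        2 * D * (2 ^ d) ^ (1 / 2 : ℝ) * K * ν Set.univ ^ (1 - p / d) := by gcongr
    _ = _ := by ring

theorem exists_originMean_cell_le {p : ℝ} (hp : 0 < p) (hp1 : p ≤ 1) (hpd : p < (d : ℝ) / 2) :
    ∃ C : ℝ≥0∞, C ≠ ∞ ∧ ∀ (r : ℝ) (z : Fin d → ℤ) (H : ℝ≥0∞) (ν : Measure (Pt d))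
      [IsFiniteMeasure ν], 0 < r → (∀ᵐ x ∂ν, x ∈ cell r z) → (∀ᵐ x ∂ν, pointCost p 0 x ≤ H) →
      ENNReal.ofReal (r ^ p) ≤ H → originMean p ν ≤ C * H * ν Set.univ ^ (1 - p / d) := by
  obtain ⟨C, hC, h⟩ := exists_originMean_unitCell_le hp hp1 hpd
  have hd : (0 : ℝ) < d := by linarith
  have hγ : 1 / 2 ≤ 1 - p / d := by
    have : p / d ≤ 1 / 2 := by
      rw [div_le_iff₀ hd]
      linarith
    linarith
  have hγ1 : 1 - p / d ≤ 1 := by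
    have : 0 ≤ p / d := by positivity
    linarith
  refine ⟨C + 2, by simp [hC], fun r z H ν _ hr hν hH hrH => ?_⟩
  rcases le_total 1 (ν Set.univ) with hm | hm
  · obtain ⟨ν', hf, hν', hm', hle⟩ := originMean_cell_le hp hp1 hr hν hH
    refine hle.trans ?_
    have h1 := h ν' hν' (hm' ▸ hm)
    rw [hm'] at h1
    have h2 : ν Set.univ ^ (1 / 2 : ℝ) ≤ ν Set.univ ^ (1 - p / d) :=
      ENNReal.rpow_le_rpow_of_exponent_le hm hγ
    calc _ ≤ H * (C * ν Set.univ ^ (1 - p / d)) + H * (2 * ν Set.univ ^ (1 - p / d)) := by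
          gcongr
      _ = _ := by ring
  -- For mass at most 1 nothing is matched: the trivial bound is linear in the mass, and m ≤
  -- m^(1-p/d).
  · refine (originMean_le_two_mul hp hp1 hH).trans ?_
    have h2 : ν Set.univ ≤ ν Set.univ ^ (1 - p / d) := by
      simpa using ENNReal.rpow_le_rpow_of_exponent_ge hm hγ1
    calc _ ≤ (C + 2) * H * ν Set.univ := by
          gcongr
          exact le_add_self
      _ ≤ _ := by gcongr

theorem exists_originMean_ball_le {p : ℝ} (hp : 0 < p) (hp1 : p ≤ 1) (hpd : p < (d : ℝ) / 2) :
    ∃ C : ℝ≥0∞, C ≠ ∞ ∧ ∀ (s : ℝ) (ν : Measure (Pt d)) [IsFiniteMeasure ν], 0 < s →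
      (∀ᵐ x ∂ν, ‖x‖ < s) →
      originMean p ν ≤ C * ENNReal.ofReal (s ^ p) * ν Set.univ ^ (1 - p / d) := by
  obtain ⟨C, hC, h⟩ := exists_originMean_cell_le hp hp1 hpd
  -- The 2^d cells of mesh `s` that have the origin as a corner cover the ball.
  set Z := Fintype.piFinset fun _ : Fin d => Finset.Ico (-1 : ℤ) 1
  refine ⟨Z.card * C, ENNReal.mul_ne_top (by simp) hC, fun s ν _ hs hν => ?_⟩
  have hZ : ∀ᵐ x ∂ν, gridIndex s x ∈ Z := by
    filter_upwards [hν] with x hx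
    rw [Fintype.mem_piFinset]
    intro i
    have hi := (PiLp.norm_apply_le x i).trans_lt hx
    rw [Real.norm_eq_abs, abs_lt] at hi
    rw [Finset.mem_Ico, gridIndex, Int.le_floor, Int.floor_lt, le_div_iff₀ hs, div_lt_iff₀ hs]
    push_cast
    constructor <;> linarith
  have hH : ∀ᵐ x ∂ν, pointCost p 0 x ≤ ENNReal.ofReal (s ^ p) :=
    hν.mono fun x hx => pointCost_le_of_norm_le hp (by simpa using hx.le)
  have hγ : 0 ≤ 1 - p / d := by
    have hd : (0 : ℝ) < d := by linarith
    rw [sub_nonneg, div_le_one hd]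
    linarith
  calc originMean p ν = originMean p (∑ z ∈ Z, ν.restrict (cell s z)) := by
        rw [← eq_sum_restrict_cell hZ]
    _ ≤ ∑ z ∈ Z, originMean p (ν.restrict (cell s z)) :=
        transportMean_sum_le (isExitCost_pointCost hp hp1 0).measurable Z _
    _ ≤ ∑ _z ∈ Z, C * ENNReal.ofReal (s ^ p) * ν Set.univ ^ (1 - p / d) := by
        refine Finset.sum_le_sum fun z _ => (h s z _ _ hs (ae_restrict_cell ν s z)
          (ae_restrict_of_ae hH) le_rfl).trans ?_
        gcongr
        exact Measure.restrict_le_self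
    _ = _ := by rw [Finset.sum_const, nsmul_eq_mul]; ring

end BipartiteMatching

/-! ### The boundary exit price and its extension to grids -/

namespace BipartiteMatching

variable {d : ℕ}

/-! ### The boundary of the unit cube -/

theorem isClosed_unitCube : IsClosed (unitCube d) := by
  have : (unitCube d) = ⋂ i, (fun x : Pt d => x i) ⁻¹' Set.Icc 0 1 := by
    refine Set.ext fun x => ?_
    simp [unitCube]
  rw [this]
  exact isClosed_iInter fun i => isClosed_Icc.preimage (by fun_prop)

theorem exists_eq_of_mem_frontier_unitCube {y : Pt d} (hy : y ∈ frontier (unitCube d)) :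
    ∃ i, y i = 0 ∨ y i = 1 := by
  by_contra! h
  rw [isClosed_unitCube.frontier_eq] at hy
  refine hy.2 (mem_interior_iff_mem_nhds.2 ?_)
  have hU : IsOpen (⋂ i, (fun x : Pt d => x i) ⁻¹' Set.Ioo 0 1) :=
    isOpen_iInter_of_finite fun i => isOpen_Ioo.preimage (by fun_prop)
  refine mem_of_superset (hU.mem_nhds ?_) ?_
  · refine Set.mem_iInter.2 fun i => ⟨lt_of_le_of_ne (hy.1 i).1 (h i).1.symm,
      lt_of_le_of_ne (hy.1 i).2 (h i).2⟩
  · intro x hx i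
    have := Set.mem_iInter.1 hx i
    exact ⟨this.1.le, this.2.le⟩

theorem mem_frontier_unitCube {y : Pt d} (hy : y ∈ unitCube d) {i : Fin d}
    (hi : y i = 0 ∨ y i = 1) : y ∈ frontier (unitCube d) := by
  rw [isClosed_unitCube.frontier_eq]
  refine ⟨hy, fun hint => ?_⟩
  rw [mem_interior_iff_mem_nhds] at hint
  have hc : Continuous fun t : ℝ => y + t • EuclideanSpace.single i (1 : ℝ) := by fun_prop
  have h0 : y + (0 : ℝ) • EuclideanSpace.single i (1 : ℝ) = y := by simp
  have hev : ∀ᶠ t : ℝ in 𝓝 0, y + t • EuclideanSpace.single i (1 : ℝ) ∈ unitCube d :=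
    (hc.tendsto' 0 y h0).eventually hint
  obtain ⟨ε, hε, hball⟩ := Metric.eventually_nhds_iff.1 hev
  have h1 := hball (y := ε / 2) (by rw [Real.dist_eq, sub_zero, abs_of_pos] <;> linarith) i
  have h2 := hball (y := -(ε / 2)) (by rw [Real.dist_eq, sub_zero, abs_neg, abs_of_pos] <;> linarith) i
  simp only [PiLp.add_apply, PiLp.smul_apply, PiLp.single_apply, if_true,
    smul_eq_mul, mul_one, Set.mem_Icc] at h1 h2
  rcases hi with hi | hi <;> rw [hi] at h1 h2 <;> linarith [h1.1, h1.2, h2.1, h2.2]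

/-- Replacing the coordinate `x i` by `a` gives a point on a face of the cube. -/
theorem infDist_frontier_le {x : Pt d} (hx : x ∈ unitCube d) (i : Fin d) {a : ℝ}
    (ha : a = 0 ∨ a = 1) : Metric.infDist x (frontier (unitCube d)) ≤ |x i - a| := by
  set y : Pt d := WithLp.toLp 2 (Function.update x.ofLp i a) with hydef
  have hyi : ∀ j, y j = if j = i then a else x j := fun j => by
    simp only [hydef, Function.update_apply]
  have hy : y ∈ unitCube d := by
    intro j
    rw [hyi]
    split_ifs with h
    · rcases ha with rfl | rfl <;> simp
    · exact hx j
  refine (Metric.infDist_le_dist_of_mem (mem_frontier_unitCube hy (i := i)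
    (by rw [hyi, if_pos rfl]; exact ha))).trans (le_of_eq ?_)
  rw [EuclideanSpace.dist_eq, Finset.sum_eq_single i]
  · rw [hyi, if_pos rfl, Real.dist_eq, Real.sqrt_sq_eq_abs, abs_abs]
  · intro j _ hj
    rw [hyi, if_neg hj]
    simp
  · simp

theorem frontier_unitCube_nonempty (hd : 0 < d) : (frontier (unitCube d)).Nonempty :=
  ⟨0, mem_frontier_unitCube (i := ⟨0, hd⟩) (fun i => by simp) (Or.inl rfl)⟩

/-! ### The distance to the boundary of the cells of a grid -/

/-- The point of the unit cell which is congruent to a given point. -/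
noncomputable def fractPt (x : Pt d) : Pt d := WithLp.toLp 2 fun i => Int.fract (x i)

@[simp]
theorem fractPt_apply (x : Pt d) (i : Fin d) : fractPt x i = Int.fract (x i) := rfl

theorem measurable_fractPt : Measurable (fractPt (d := d)) := by
  unfold fractPt
  refine (WithLp.measurable_toLp 2 _).comp (measurable_pi_lambda _ fun _ => ?_)
  exact measurable_fract.comp (by fun_prop)

theorem fractPt_mem_unitCube (x : Pt d) : fractPt x ∈ unitCube d :=
  fun _ => ⟨Int.fract_nonneg _, (Int.fract_lt_one _).le⟩

theorem fractPt_of_mem_unitCell {x : Pt d} (hx : x ∈ cell 1 0) : fractPt x = x := by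
  rw [mem_cell_iff one_pos] at hx
  ext i
  rw [fractPt_apply, Int.fract_eq_self]
  simpa using hx i

/-- The distance to the boundary of the cell of the grid of mesh `r`. -/
noncomputable def gridDist (r : ℝ) (x : Pt d) : ℝ :=
  r * Metric.infDist (fractPt (r⁻¹ • x)) (frontier (unitCube d))

theorem gridDist_nonneg {r : ℝ} (hr : 0 < r) (x : Pt d) : 0 ≤ gridDist r x :=
  mul_nonneg hr.le Metric.infDist_nonneg

/-- For the two hyperplanes adjacent to the cell of `x` this is the projection onto a face; the
parallel ones are farther away. -/
theorem gridDist_le {r : ℝ} (hr : 0 < r) (x : Pt d) (i : Fin d) (k : ℤ) :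
    gridDist r x ≤ |x i - r * k| := by
  have key : ∀ a : ℝ, Metric.infDist (fractPt (r⁻¹ • x)) (frontier (unitCube d)) ≤ |a - k| ∨
      a ≠ (r⁻¹ • x) i := by
    intro a
    by_cases ha : a = (r⁻¹ • x) i
    · left
      have h1 := infDist_frontier_le (fractPt_mem_unitCube (r⁻¹ • x)) i (Or.inl rfl)
      have h2 := infDist_frontier_le (fractPt_mem_unitCube (r⁻¹ • x)) i (Or.inr rfl)
      rw [fractPt_apply, ← ha] at h1 h2
      have h3 := Int.fract_nonneg a
      have h4 := Int.fract_lt_one a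
      have h5 := Int.floor_add_fract a
      rw [sub_zero, abs_of_nonneg h3] at h1
      rw [abs_of_nonpos (by linarith)] at h2
      rcases le_or_gt k ⌊a⌋ with hk | hk
      · have hk' : (k : ℝ) ≤ ⌊a⌋ := by exact_mod_cast hk
        rw [abs_of_nonneg (by linarith)]
        linarith
      · have hk' : (⌊a⌋ : ℝ) + 1 ≤ k := by exact_mod_cast hk
        rw [abs_of_nonpos (by linarith)]
        linarith
    · exact Or.inr ha
  have h := (key ((r⁻¹ • x) i)).resolve_right (by simp)
  calc gridDist r x ≤ r * |(r⁻¹ • x) i - k| := by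
        unfold gridDist
        gcongr
    _ = |r * ((r⁻¹ • x) i - k)| := by rw [abs_mul, abs_of_pos hr]
    _ = _ := by
        rw [PiLp.smul_apply, smul_eq_mul, mul_sub, ← mul_assoc, mul_inv_cancel₀ hr.ne', one_mul]

/-- The price of leaving the cell of the grid of mesh `r`. -/
noncomputable def gridCost (p r : ℝ) (x : Pt d) : ℝ≥0∞ :=
  ENNReal.ofReal (min ((2 : ℝ) ^ (p - 1)) 1 * gridDist r x ^ p)

theorem measurable_gridDist (r : ℝ) : Measurable (gridDist (d := d) r) := by
  unfold gridDist
  have h : Measurable fun x : Pt d => Metric.infDist x (frontier (unitCube d)) :=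
    (Metric.continuous_infDist_pt _).measurable
  exact (h.comp (measurable_fractPt.comp (by fun_prop))).const_mul r

theorem measurable_gridCost (p r : ℝ) : Measurable (gridCost (d := d) p r) := by
  unfold gridCost
  have := measurable_gridDist (d := d) r
  fun_prop

theorem gridCost_homothety {p r : ℝ} (hr : 0 < r) (z : Fin d → ℤ) (x : Pt d) :
    gridCost p r (homothety (corner r z) r x) =
      ENNReal.ofReal (r ^ p) * boundaryCost p (fractPt x) := by
  have h : fractPt (r⁻¹ • homothety (corner r z) r x) = fractPt x := by
    ext i
    rw [fractPt_apply, fractPt_apply, PiLp.smul_apply, homothety_apply, corner_apply, smul_eq_mul,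
      ← mul_add, ← mul_assoc, inv_mul_cancel₀ hr.ne', one_mul, Int.fract_intCast_add]
  rw [gridCost, gridDist, h, boundaryCost, ← ENNReal.ofReal_mul (by positivity),
    Real.mul_rpow hr.le Metric.infDist_nonneg]
  congr 1
  ring

theorem min_two_rpow_nonneg (p : ℝ) : 0 ≤ min ((2 : ℝ) ^ (p - 1)) 1 := by positivity

theorem gridCost_le {p r : ℝ} (hp : 0 < p) (hr : 0 < r) {x : Pt d} {s : ℝ}
    (h : gridDist r x ≤ s) : gridCost p r x ≤ ENNReal.ofReal (min ((2 : ℝ) ^ (p - 1)) 1 * s ^ p) := by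
  unfold gridCost
  have := gridDist_nonneg hr x
  have := min_two_rpow_nonneg p
  gcongr

theorem abs_sub_le_norm (x y : Pt d) (i : Fin d) : |x i - y i| ≤ ‖x - y‖ :=
  PiLp.norm_apply_le (x - y) i

/-- Concavity of the power at the midpoint of `a` and `b`. The constant q = 2^(p-1) is what makes
two exits no dearer than a match across a face. -/
theorem min_mul_add_rpow_le {p : ℝ} (hp : 0 < p) (hp1 : p ≤ 1) {a b : ℝ} (ha : 0 ≤ a)
    (hb : 0 ≤ b) : min ((2 : ℝ) ^ (p - 1)) 1 * (a ^ p + b ^ p) ≤ (a + b) ^ p := by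
  have hconc := (Real.concaveOn_rpow hp.le hp1).2 (Set.mem_Ici.2 ha) (Set.mem_Ici.2 hb)
    (show (0 : ℝ) ≤ 1 / 2 by norm_num) (show (0 : ℝ) ≤ 1 / 2 by norm_num) (by norm_num)
  simp only [smul_eq_mul] at hconc
  rw [← mul_add, ← mul_add, Real.mul_rpow (by norm_num) (by positivity)] at hconc
  have h2 : (2 : ℝ) ^ (p - 1) * 2 = 2 ^ p := by
    rw [← Real.rpow_add_one two_ne_zero]
    simp
  have h3 : (2 : ℝ) ^ p * (1 / 2) ^ p = 1 := by
    rw [← Real.mul_rpow (by norm_num) (by norm_num)]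
    norm_num
  calc min ((2 : ℝ) ^ (p - 1)) 1 * (a ^ p + b ^ p)
      ≤ (2 : ℝ) ^ (p - 1) * (a ^ p + b ^ p) := by gcongr; exact min_le_left _ _
    _ = 2 ^ p * (1 / 2 * (a ^ p + b ^ p)) := by rw [← h2]; ring
    _ ≤ 2 ^ p * ((1 / 2) ^ p * (a + b) ^ p) := by gcongr
    _ = _ := by rw [← mul_assoc, h3, one_mul]

/-- Cells with different indices are separated by a hyperplane of the grid in some coordinate
direction, and the distances of the two points to that hyperplane add up to at most |x - y|. This is
the hypothesis of superadditivity. -/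
theorem gridCost_add_le {p r : ℝ} (hp : 0 < p) (hp1 : p ≤ 1) (hr : 0 < r) {z w : Fin d → ℤ}
    (hzw : z ≠ w) {x y : Pt d} (hx : x ∈ cell r z) (hy : y ∈ cell r w) :
    gridCost p r x + gridCost p r y ≤ powDist p x y := by
  obtain ⟨i, hi⟩ := Function.ne_iff.1 hzw
  have key : gridDist r x + gridDist r y ≤ ‖x - y‖ := by
    refine le_trans ?_ (abs_sub_le_norm x y i)
    have hxi := (mem_cell_iff hr).1 hx i
    have hyi := (mem_cell_iff hr).1 hy i
    rcases lt_or_gt_of_ne hi with h | h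
    -- The separating hyperplane is the lower face of the upper cell.
    · have h' : (z i : ℝ) + 1 ≤ w i := by exact_mod_cast h
      have h2 := mul_le_mul_of_nonneg_left h' hr.le
      have e1 := gridDist_le hr x i (w i)
      have e2 := gridDist_le hr y i (w i)
      rw [abs_of_nonpos (by linarith)] at e1 ⊢
      rw [abs_of_nonneg (by linarith)] at e2
      linarith
    · have h' : (w i : ℝ) + 1 ≤ z i := by exact_mod_cast h
      have h2 := mul_le_mul_of_nonneg_left h' hr.le
      have e1 := gridDist_le hr x i (z i)
      have e2 := gridDist_le hr y i (z i)
      rw [abs_of_nonneg (by linarith)] at e1 ⊢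
      rw [abs_of_nonpos (by linarith)] at e2
      linarith
  have hx0 := gridDist_nonneg hr x
  have hy0 := gridDist_nonneg hr y
  rw [gridCost, gridCost, powDist_eq_ofReal hp, ← ENNReal.ofReal_add (by positivity)
    (by positivity), ← mul_add]
  refine ENNReal.ofReal_le_ofReal ((min_mul_add_rpow_le hp hp1 hx0 hy0).trans ?_)
  gcongr

/-- The origin lies on a hyperplane of every grid, so leaving at the origin is never cheaper than
leaving the cell. -/
theorem gridCost_le_pointCost (hd : 0 < d) {p r : ℝ} (hp : 0 < p) (hr : 0 < r) (x : Pt d) :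
    gridCost p r x ≤ pointCost p 0 x := by
  have h := gridDist_le hr x ⟨0, hd⟩ 0
  simp only [Int.cast_zero, mul_zero, sub_zero] at h
  refine (gridCost_le hp hr (h.trans (PiLp.norm_apply_le x _))).trans ?_
  rw [pointCost, powDist_eq_ofReal hp, sub_zero]
  refine ENNReal.ofReal_le_ofReal ?_
  exact mul_le_of_le_one_left (by positivity) (min_le_right _ _)

/-- With mesh 1/m the faces of the unit cube lie on hyperplanes of the grid. -/
theorem gridCost_le_boundaryCost (hd : 0 < d) {p : ℝ} (hp : 0 < p) {m : ℕ} (hm : 0 < m)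
    (x : Pt d) : gridCost p (1 / m) x ≤ boundaryCost p x := by
  have hm' : (0 : ℝ) < 1 / m := by positivity
  refine gridCost_le hp hm' ((Metric.le_infDist (frontier_unitCube_nonempty hd)).2 fun y hy => ?_)
  obtain ⟨i, hi⟩ := exists_eq_of_mem_frontier_unitCube hy
  rw [dist_eq_norm]
  refine le_trans ?_ (abs_sub_le_norm x y i)
  rcases hi with hi | hi
  · simpa [hi] using gridDist_le hm' x i 0
  · have := gridDist_le hm' x i m
    have hm1 : 1 / (m : ℝ) * ((m : ℤ) : ℝ) = 1 := by
      rw [Int.cast_natCast, one_div_mul_cancel (by positivity)]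
    rw [hm1] at this
    rwa [hi]

theorem gridCost_one_of_mem_unitCell {p : ℝ} {x : Pt d} (hx : x ∈ cell 1 0) :
    gridCost p 1 x = boundaryCost p x := by
  rw [gridCost, gridDist, inv_one, one_smul, one_mul, fractPt_of_mem_unitCell hx, boundaryCost]

theorem isExitCost_boundaryCost {p : ℝ} (hp : 0 < p) (hp1 : p ≤ 1) :
    IsExitCost (d := d) p (boundaryCost p) where
  measurable := measurable_boundaryCost p
  le_add x y := by
    have hq := min_two_rpow_nonneg p
    have h1 : Metric.infDist x (frontier (unitCube d)) ≤
        ‖x - y‖ + Metric.infDist y (frontier (unitCube d)) := by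
      rw [add_comm, ← dist_eq_norm]
      exact Metric.infDist_le_infDist_add_dist
    have h0 : 0 ≤ Metric.infDist x (frontier (unitCube d)) := Metric.infDist_nonneg
    have h0' : 0 ≤ Metric.infDist y (frontier (unitCube d)) := Metric.infDist_nonneg
    rw [boundaryCost, boundaryCost, powDist_eq_ofReal hp, ← ENNReal.ofReal_add (by positivity)
      (by positivity)]
    refine ENNReal.ofReal_le_ofReal ?_
    calc _ ≤ min ((2 : ℝ) ^ (p - 1)) 1 *
          (‖x - y‖ ^ p + Metric.infDist y (frontier (unitCube d)) ^ p) := by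
          gcongr
          exact (Real.rpow_le_rpow h0 h1 hp.le).trans
            (Real.rpow_add_le_add_rpow (norm_nonneg _) h0' hp.le hp1)
      _ ≤ _ := by
          rw [mul_add]
          gcongr
          exact mul_le_of_le_one_left (by positivity) (min_le_right _ _)

theorem boundaryCost_pos (hd : 0 < d) {p : ℝ} {x : Pt d} (hx : x ∉ frontier (unitCube d)) :
    0 < boundaryCost p x := by
  have h1 : 0 < Metric.infDist x (frontier (unitCube d)) :=
    (isClosed_frontier.notMem_iff_infDist_pos (frontier_unitCube_nonempty hd)).1 hx
  rw [boundaryCost, ENNReal.ofReal_pos]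
  positivity

theorem volume_frontier_unitCube : volume (frontier (unitCube d)) = 0 := by
  have hconv : Convex ℝ (unitCube d) := by
    intro x hx y hy a b ha hb hab i
    have hx := hx i
    have hy := hy i
    simp only [PiLp.add_apply, PiLp.smul_apply]
    exact convex_Icc (0 : ℝ) 1 hx hy ha hb hab
  exact hconv.addHaar_frontier volume

end BipartiteMatching

namespace BipartiteMatching

variable {d : ℕ}

/-! ### Scaled expectations of the uniform measure on the unit cube -/

instance isFiniteMeasure_ofReal_smul (t : ℝ) (ν : Measure (Pt d)) [IsFiniteMeasure ν] :
    IsFiniteMeasure (ENNReal.ofReal t • ν) := Measure.smul_finite ν ENNReal.ofReal_ne_top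

theorem ae_ofReal_smul {ν : Measure (Pt d)} {P : Pt d → Prop} (h : ∀ᵐ x ∂ν, P x) (t : ℝ) :
    ∀ᵐ x ∂(ENNReal.ofReal t • ν), P x := Measure.ae_smul_measure h _

theorem ofReal_smul_univ (t : ℝ) (ν : Measure (Pt d)) :
    (ENNReal.ofReal t • ν) Set.univ = ENNReal.ofReal t * ν Set.univ := rfl

/-- The ratio of the expected transport cost to `t ^ (1 - p / d)`. -/
noncomputable def scaledMean (p : ℝ) (h : Pt d → ℝ≥0∞) (ν : Measure (Pt d)) (t : ℝ) : ℝ≥0∞ :=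
  transportMean p h (ENNReal.ofReal t • ν) / ENNReal.ofReal (t ^ (1 - p / (d : ℝ)))

theorem ae_unitMeasure : ∀ᵐ x ∂unitMeasure d, x ∈ cell 1 0 :=
  ae_restrict_mem (measurableSet_cell 1 0)

theorem cell_subset_unitCell {m : ℕ} (hm : 0 < m) {z : Fin d → ℤ}
    (hz : z ∈ Fintype.piFinset fun _ : Fin d => Finset.Ico (0 : ℤ) m) :
    cell (1 / (m : ℝ)) z ⊆ cell 1 0 := by
  intro x hx
  have hm' : (0 : ℝ) < m := by exact_mod_cast hm
  rw [mem_cell_iff (by positivity)] at hx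
  rw [mem_cell_iff one_pos]
  rw [Fintype.mem_piFinset] at hz
  intro i
  obtain ⟨h1, h2⟩ := hx i
  have hzi := Finset.mem_Ico.1 (hz i)
  have hz1 : (0 : ℝ) ≤ z i := by exact_mod_cast hzi.1
  have hz2 : (z i : ℝ) + 1 ≤ m := by exact_mod_cast hzi.2
  simp only [Pi.zero_apply, Int.cast_zero, mul_zero, zero_add, mul_one]
  constructor
  · exact le_trans (by positivity) h1
  · refine h2.trans_le ?_
    rw [one_div_mul_eq_div, div_le_one hm']
    exact hz2

/-- Each of the m^d small cells carries a homothetic copy of the unit cell of mass `s`; the factor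
m^d in the intensity compensates the volume of a cell. -/
theorem smul_unitMeasure_eq_sum {m : ℕ} (hm : 0 < m) (s : ℝ) :
    ENNReal.ofReal ((m : ℝ) ^ d * s) • unitMeasure d =
      ∑ z ∈ Fintype.piFinset fun _ : Fin d => Finset.Ico (0 : ℤ) m,
        (ENNReal.ofReal s • unitMeasure d).map (homothety (corner (1 / (m : ℝ)) z) (1 / m)) := by
  have hm' : (0 : ℝ) < m := by exact_mod_cast hm
  have hZ : ∀ᵐ x ∂unitMeasure d, gridIndex (1 / (m : ℝ)) x ∈
      Fintype.piFinset fun _ : Fin d => Finset.Ico (0 : ℤ) m :=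
    ae_unitMeasure.mono fun x hx => gridIndex_mem_of_mem_unitCell hm hx
  conv_lhs => rw [eq_sum_restrict_cell hZ]
  rw [Finset.smul_sum]
  refine Finset.sum_congr rfl fun z hz => ?_
  rw [unitMeasure, Measure.restrict_restrict (measurableSet_cell _ _),
    Set.inter_eq_left.2 (cell_subset_unitCell hm hz), restrict_cell_eq (by positivity),
    smul_smul, Measure.map_smul, ← ENNReal.ofReal_mul' (by positivity)]
  congr 2
  rw [one_div, inv_pow]
  field_simp

theorem originMean_pow_mul_le {p : ℝ} (hp : 0 < p) (hp1 : p ≤ 1) {m : ℕ} (hm : 0 < m) (s : ℝ) :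
    originMean p (ENNReal.ofReal ((m : ℝ) ^ d * s) • unitMeasure d) ≤
      (m : ℝ≥0∞) ^ d * (ENNReal.ofReal ((1 / m) ^ p) *
        originMean p (ENNReal.ofReal s • unitMeasure d) +
        ENNReal.ofReal ((d : ℝ) ^ p) * (2 * ENNReal.ofReal s ^ (1 / 2 : ℝ))) := by
  have hm' : (0 : ℝ) < m := by exact_mod_cast hm
  have hm'' : (0 : ℝ) < 1 / m := by positivity
  rw [smul_unitMeasure_eq_sum hm s]
  refine (transportMean_sum_le (isExitCost_pointCost hp hp1 0).measurable _ _).trans ?_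
  have hstep : ∀ z ∈ Fintype.piFinset fun _ : Fin d => Finset.Ico (0 : ℤ) m,
      transportMean p (pointCost p 0) ((ENNReal.ofReal s • unitMeasure d).map
        (homothety (corner (1 / (m : ℝ)) z) (1 / m))) ≤
      ENNReal.ofReal ((1 / m) ^ p) * originMean p (ENNReal.ofReal s • unitMeasure d) +
        ENNReal.ofReal ((d : ℝ) ^ p) * (2 * ENNReal.ofReal s ^ (1 / 2 : ℝ)) := by
    intro z hz
    refine (transportMean_homothety_le hp hp1 _ hm'' (H := ENNReal.ofReal ((d : ℝ) ^ p)) _ ?_).trans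
      (le_of_eq ?_)
    · rw [ae_map_iff (measurable_homothety _ _).aemeasurable
        (measurableSet_le (isExitCost_pointCost hp hp1 0).measurable measurable_const)]
      refine ae_ofReal_smul (ae_unitMeasure.mono fun x hx => ?_) s
      exact pointCost_zero_le_of_mem_unitCell hp
        (cell_subset_unitCell hm hz ((homothety_mem_cell hm'').2 hx))
    · rw [ofReal_smul_univ, measure_univ, mul_one]
      rfl
  refine (Finset.sum_le_sum hstep).trans (le_of_eq ?_)
  rw [Finset.sum_const, card_piFinset_Ico, nsmul_eq_mul]
  push_cast
  rfl

theorem transportMean_gridCost_map {p : ℝ} (hp : 0 < p) {r : ℝ} (hr : 0 < r) (s : ℝ)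
    (z : Fin d → ℤ) :
    transportMean p (gridCost p r)
      ((ENNReal.ofReal s • unitMeasure d).map (homothety (corner r z) r)) =
      ENNReal.ofReal (r ^ p) *
        transportMean p (boundaryCost p) (ENNReal.ofReal s • unitMeasure d) := by
  rw [transportMean_map (measurable_gridCost p r)
    ((measurable_boundaryCost p).comp measurable_fractPt) _ (measurable_homothety _ _)
    (by
      have : 0 < r ^ p := by positivity
      simpa using this) ENNReal.ofReal_ne_top (powDist_homothety hp _ hr)
    (gridCost_homothety hr z)]
  congr 1
  apply le_antisymm
  · exact transportMean_mono_exit (ae_ofReal_smul (ae_unitMeasure.mono fun x hx => by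
      rw [Function.comp_apply, fractPt_of_mem_unitCell hx]) s)
  · exact transportMean_mono_exit (ae_ofReal_smul (ae_unitMeasure.mono fun x hx => by
      rw [Function.comp_apply, fractPt_of_mem_unitCell hx]) s)

theorem transportMean_boundaryCost_pow_mul_ge (hd : 0 < d) {p : ℝ} (hp : 0 < p) (hp1 : p ≤ 1)
    {m : ℕ} (hm : 0 < m) (s : ℝ) :
    (m : ℝ≥0∞) ^ d * (ENNReal.ofReal ((1 / m) ^ p) *
      transportMean p (boundaryCost p) (ENNReal.ofReal s • unitMeasure d)) ≤
      transportMean p (boundaryCost p) (ENNReal.ofReal ((m : ℝ) ^ d * s) • unitMeasure d) := by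
  have hm' : (0 : ℝ) < m := by exact_mod_cast hm
  have hm'' : (0 : ℝ) < 1 / m := by positivity
  refine le_trans ?_ (transportMean_mono_exit (h := gridCost p (1 / m))
    (Filter.Eventually.of_forall fun x => gridCost_le_boundaryCost hd hp hm x))
  rw [smul_unitMeasure_eq_sum hm s]
  refine le_trans (le_of_eq ?_) (sum_transportMean_le (measurable_gridCost p (1 / m)) _ _
    (fun z => cell (1 / (m : ℝ)) z) (fun z _ => ?_) (fun z _ w _ hzw => disjoint_cell hzw)
    fun z _ w _ hzw x hx y hy => gridCost_add_le hp hp1 hm'' hzw hx hy)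
  · simp_rw [transportMean_gridCost_map hp hm'']
    rw [Finset.sum_const, card_piFinset_Ico, nsmul_eq_mul]
    push_cast
    rfl
  · exact (ae_map_iff (measurable_homothety _ _).aemeasurable
      (p := fun x => x ∈ cell (1 / (m : ℝ)) z) (measurableSet_cell _ _)).2 <| ae_ofReal_smul (ae_unitMeasure.mono fun x hx => (homothety_mem_cell hm'').2 hx) s

theorem ofReal_pow_mul_rpow (hd : 0 < d) {p s : ℝ} {m : ℕ} (hm : 0 < m) (hs : 0 < s) :
    ENNReal.ofReal (((m : ℝ) ^ d * s) ^ (1 - p / (d : ℝ))) =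
      (m : ℝ≥0∞) ^ d * ENNReal.ofReal ((1 / m) ^ p) * ENNReal.ofReal (s ^ (1 - p / (d : ℝ))) := by
  have hm' : (0 : ℝ) < m := by exact_mod_cast hm
  have hd' : (d : ℝ) ≠ 0 := by positivity
  have h1 : (m : ℝ≥0∞) ^ d = ENNReal.ofReal ((m : ℝ) ^ d) := by
    rw [ENNReal.ofReal_pow hm'.le]
    simp
  rw [h1, ← ENNReal.ofReal_mul (by positivity), ← ENNReal.ofReal_mul (by positivity),
    Real.mul_rpow (by positivity) hs.le]
  congr 2
  rw [Real.rpow_sub (by positivity), Real.rpow_one, ← Real.rpow_natCast, ← Real.rpow_mul hm'.le,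
    mul_div_cancel₀ _ hd', one_div, Real.inv_rpow hm'.le, div_eq_mul_inv]

/-- The factor m^d m^(-p) is exactly the growth of the normalization, so only the price of moving
the exits of the small cells to the origin remains. That error grows with m but decays in s, because
p < d/2. -/
theorem scaledMean_origin_pow_mul_le (hd : 0 < d) {p : ℝ} (hp : 0 < p) (hp1 : p ≤ 1) {m : ℕ}
    (hm : 0 < m) {s : ℝ} (hs : 0 < s) :
    scaledMean p (pointCost p 0) (unitMeasure d) ((m : ℝ) ^ d * s) ≤
      scaledMean p (pointCost p 0) (unitMeasure d) s +
        2 * ENNReal.ofReal ((d : ℝ) ^ p) *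
          ENNReal.ofReal ((m : ℝ) ^ p * s ^ (-(1 - p / (d : ℝ) - 1 / 2))) := by
  have hm' : (0 : ℝ) < m := by exact_mod_cast hm
  have hκ0 : (m : ℝ≥0∞) ^ d * ENNReal.ofReal ((1 / m) ^ p) ≠ 0 := by
    have : (0 : ℝ) < (1 / m) ^ p := by positivity
    have h2 : (m : ℝ≥0∞) ≠ 0 := by exact_mod_cast hm.ne'
    exact mul_ne_zero (pow_ne_zero _ h2) (by simpa using this)
  have hκ : (m : ℝ≥0∞) ^ d * ENNReal.ofReal ((1 / m) ^ p) ≠ ∞ :=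
    ENNReal.mul_ne_top (by simp) ENNReal.ofReal_ne_top
  rw [scaledMean, scaledMean, ofReal_pow_mul_rpow hd hm hs]
  refine (ENNReal.div_le_div_right (originMean_pow_mul_le hp hp1 hm s) _).trans ?_
  rw [mul_add, ← mul_assoc, ENNReal.add_div, ENNReal.mul_div_mul_left _ _ hκ0 hκ]
  refine add_le_add le_rfl (le_of_eq ?_)
  have hm2 : (m : ℝ≥0∞) ^ d ≠ 0 := pow_ne_zero _ (by exact_mod_cast hm.ne')
  rw [mul_assoc ((m : ℝ≥0∞) ^ d), ENNReal.mul_div_mul_left _ _ hm2 (by simp),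
    mul_left_comm, ← mul_assoc, mul_div_assoc, ENNReal.ofReal_rpow_of_pos hs,
    ← ENNReal.ofReal_mul (by positivity), ← ENNReal.ofReal_div_of_pos (by positivity)]
  have key : ∀ γ : ℝ, s ^ (1 / 2 : ℝ) / ((1 / m) ^ p * s ^ γ) =
      (m : ℝ) ^ p * s ^ (-(γ - 1 / 2)) := by
    intro γ
    rw [one_div (m : ℝ), Real.inv_rpow hm'.le, neg_sub, Real.rpow_sub hs]
    field_simp
  rw [key]

/-- No error term here: the exit price of each small cell is the rescaled boundary price, and it
lies below the boundary price of the large cube. -/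
theorem scaledMean_boundary_le_pow_mul (hd : 0 < d) {p : ℝ} (hp : 0 < p) (hp1 : p ≤ 1) {m : ℕ}
    (hm : 0 < m) {s : ℝ} (hs : 0 < s) :
    scaledMean p (boundaryCost p) (unitMeasure d) s ≤
      scaledMean p (boundaryCost p) (unitMeasure d) ((m : ℝ) ^ d * s) := by
  have hm' : (0 : ℝ) < m := by exact_mod_cast hm
  have hκ0 : (m : ℝ≥0∞) ^ d * ENNReal.ofReal ((1 / m) ^ p) ≠ 0 := by
    have : (0 : ℝ) < (1 / m) ^ p := by positivity
    have h2 : (m : ℝ≥0∞) ≠ 0 := by exact_mod_cast hm.ne'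
    exact mul_ne_zero (pow_ne_zero _ h2) (by simpa using this)
  have hκ : (m : ℝ≥0∞) ^ d * ENNReal.ofReal ((1 / m) ^ p) ≠ ∞ :=
    ENNReal.mul_ne_top (by simp) ENNReal.ofReal_ne_top
  rw [scaledMean, scaledMean, ofReal_pow_mul_rpow hd hm hs]
  refine le_trans (le_of_eq ?_)
    (ENNReal.div_le_div_right (transportMean_boundaryCost_pow_mul_ge hd hp hp1 hm s) _)
  rw [← mul_assoc, ENNReal.mul_div_mul_left _ _ hκ0 hκ]

theorem boundaryCost_le_pointCost (hd : 0 < d) {p : ℝ} (hp : 0 < p) {x : Pt d}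
    (hx : x ∈ cell 1 0) : boundaryCost p x ≤ pointCost p 0 x := by
  rw [← gridCost_one_of_mem_unitCell hx]
  exact gridCost_le_pointCost hd hp one_pos x

theorem exists_originMean_smul_unitMeasure_le {p : ℝ} (hp : 0 < p) (hp1 : p ≤ 1)
    (hpd : p < (d : ℝ) / 2) : ∃ C : ℝ≥0∞, C ≠ ∞ ∧ ∀ s : ℝ, 0 ≤ s →
      originMean p (ENNReal.ofReal s • unitMeasure d) ≤ C * ENNReal.ofReal (s ^ (1 - p / (d : ℝ))) := by
  obtain ⟨C, hC, h⟩ := exists_originMean_cell_le hp hp1 hpd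
  have hd : (0 : ℝ) < d := by linarith
  have hd1 : (1 : ℝ) ≤ d := by
    have : 0 < d := by exact_mod_cast hd
    exact_mod_cast this
  have hγ : 0 ≤ 1 - p / d := by
    rw [sub_nonneg, div_le_one hd]
    linarith
  refine ⟨C * ENNReal.ofReal ((d : ℝ) ^ p), ENNReal.mul_ne_top hC ENNReal.ofReal_ne_top,
    fun s hs => ?_⟩
  have := h 1 0 (ENNReal.ofReal ((d : ℝ) ^ p)) (ENNReal.ofReal s • unitMeasure d) one_pos
    (ae_ofReal_smul ae_unitMeasure s)
    (ae_ofReal_smul (ae_unitMeasure.mono fun x hx => pointCost_zero_le_of_mem_unitCell hp hx) s)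
    (ENNReal.ofReal_le_ofReal (Real.rpow_le_rpow zero_le_one hd1 hp.le))
  rwa [ofReal_smul_univ, measure_univ, mul_one, ENNReal.ofReal_rpow_of_nonneg hs hγ] at this

theorem ofReal_smul_add {a b : ℝ} (ha : 0 ≤ a) (hab : a ≤ b) (ν : Measure (Pt d)) :
    ENNReal.ofReal a • ν + ENNReal.ofReal (b - a) • ν = ENNReal.ofReal b • ν := by
  rw [← add_smul, ← ENNReal.ofReal_add ha (by linarith), add_sub_cancel]

/-- Subadditivity in the intensity, with the a priori bound for the added part s' - s. -/
theorem scaledMean_origin_mono_le {p : ℝ} (hp : 0 < p) (hp1 : p ≤ 1) (hpd : p < (d : ℝ) / 2)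
    {C : ℝ≥0∞} (hC : ∀ s : ℝ, 0 ≤ s → originMean p (ENNReal.ofReal s • unitMeasure d) ≤
      C * ENNReal.ofReal (s ^ (1 - p / (d : ℝ)))) {s s' : ℝ} (hs : 0 < s) (hss : s ≤ s') :
    scaledMean p (pointCost p 0) (unitMeasure d) s' ≤
      scaledMean p (pointCost p 0) (unitMeasure d) s +
        C * ENNReal.ofReal ((s' / s - 1) ^ (1 - p / (d : ℝ))) := by
  have hd : (0 : ℝ) < d := by linarith
  have hγ : 0 ≤ 1 - p / d := by
    rw [sub_nonneg, div_le_one hd]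
    linarith
  have h1 := transportMean_add_le (p := p) (isExitCost_pointCost hp hp1 0).measurable
    (ENNReal.ofReal s • unitMeasure d) (ENNReal.ofReal (s' - s) • unitMeasure d)
  rw [ofReal_smul_add hs.le hss] at h1
  have h2 := h1.trans (add_le_add_right (hC (s' - s) (by linarith)) _)
  have hle : s ^ (1 - p / (d : ℝ)) ≤ s' ^ (1 - p / (d : ℝ)) := by gcongr
  calc scaledMean p (pointCost p 0) (unitMeasure d) s'
      ≤ (transportMean p (pointCost p 0) (ENNReal.ofReal s • unitMeasure d) +
        C * ENNReal.ofReal ((s' - s) ^ (1 - p / (d : ℝ)))) /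
          ENNReal.ofReal (s ^ (1 - p / (d : ℝ))) := by
        unfold scaledMean
        exact ENNReal.div_le_div h2 (ENNReal.ofReal_le_ofReal hle)
    _ = _ := by
        rw [ENNReal.add_div, mul_div_assoc, ← ENNReal.ofReal_div_of_pos (by positivity),
          ← Real.div_rpow (by linarith) hs.le, sub_div, div_self hs.ne']
        rfl

theorem scaledMean_origin_le {p : ℝ} {C : ℝ≥0∞} (hC : ∀ s : ℝ, 0 ≤ s →
    originMean p (ENNReal.ofReal s • unitMeasure d) ≤ C * ENNReal.ofReal (s ^ (1 - p / (d : ℝ))))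
    {s : ℝ} (hs : 0 < s) : scaledMean p (pointCost p 0) (unitMeasure d) s ≤ C :=
  ENNReal.div_le_of_le_mul (hC s hs.le)

theorem scaledMean_boundary_le_origin (hd : 0 < d) {p : ℝ} (hp : 0 < p) (s : ℝ) :
    scaledMean p (boundaryCost p) (unitMeasure d) s ≤
      scaledMean p (pointCost p 0) (unitMeasure d) s :=
  ENNReal.div_le_div_right (transportMean_mono_exit (ae_ofReal_smul
    (ae_unitMeasure.mono fun _ hx => boundaryCost_le_pointCost hd hp hx) s)) _

/-- Two errors: the first comes from replacing the normalization at s by the one at s', the second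
from deleting the points of intensity s' - s. -/
theorem scaledMean_boundary_mono_le {p : ℝ} (hp : 0 < p) (hp1 : p ≤ 1)
    (hpd : p < (d : ℝ) / 2) {C : ℝ≥0∞} (hC : ∀ s : ℝ, 0 ≤ s →
      originMean p (ENNReal.ofReal s • unitMeasure d) ≤
      C * ENNReal.ofReal (s ^ (1 - p / (d : ℝ)))) {s s' : ℝ} (hs : 0 < s) (hss : s ≤ s') :
    scaledMean p (boundaryCost p) (unitMeasure d) s ≤
      scaledMean p (boundaryCost p) (unitMeasure d) s' +
        (C * ENNReal.ofReal ((s' / s) ^ (1 - p / (d : ℝ)) - 1) +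
        C * ENNReal.ofReal ((s' / s - 1) ^ (1 - p / (d : ℝ)))) := by
  have hd : (0 : ℝ) < d := by linarith
  have hd' : 0 < d := by exact_mod_cast hd
  have hγ : 0 ≤ 1 - p / d := by
    rw [sub_nonneg, div_le_one hd]
    linarith
  have hs' : 0 < s' := by linarith
  have h1 := transportMean_le_add hp hp1 (isExitCost_boundaryCost hp hp1)
    (ENNReal.ofReal s • unitMeasure d) (ENNReal.ofReal (s' - s) • unitMeasure d)
  rw [ofReal_smul_add hs.le hss] at h1
  have h3 : transportMean p (boundaryCost p) (ENNReal.ofReal (s' - s) • unitMeasure d) ≤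
      C * ENNReal.ofReal ((s' - s) ^ (1 - p / (d : ℝ))) :=
    (transportMean_mono_exit (ae_ofReal_smul (ae_unitMeasure.mono fun _ hx =>
      boundaryCost_le_pointCost hd' hp hx) _)).trans (hC (s' - s) (by linarith))
  have h2 := h1.trans (add_le_add_right h3 _)
  set T := transportMean p (boundaryCost p) (ENNReal.ofReal s' • unitMeasure d) with hT
  have hone : 1 ≤ (s' / s) ^ (1 - p / (d : ℝ)) :=
    Real.one_le_rpow ((one_le_div hs).2 hss) hγ
  have h4 : T / ENNReal.ofReal (s ^ (1 - p / (d : ℝ))) =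
      T / ENNReal.ofReal (s' ^ (1 - p / (d : ℝ))) +
      T / ENNReal.ofReal (s' ^ (1 - p / (d : ℝ))) *
        ENNReal.ofReal ((s' / s) ^ (1 - p / (d : ℝ)) - 1) := by
    have e1 : (1 : ℝ≥0∞) + ENNReal.ofReal ((s' / s) ^ (1 - p / (d : ℝ)) - 1) =
        ENNReal.ofReal ((s' / s) ^ (1 - p / (d : ℝ))) := by
      rw [← ENNReal.ofReal_one, ← ENNReal.ofReal_add zero_le_one (by linarith), add_sub_cancel]
    have hne : ENNReal.ofReal (s' ^ (1 - p / (d : ℝ))) ≠ 0 := by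
      have : 0 < s' ^ (1 - p / (d : ℝ)) := by positivity
      simpa using this
    calc _ = T / ENNReal.ofReal (s' ^ (1 - p / (d : ℝ))) *
          ENNReal.ofReal ((s' / s) ^ (1 - p / (d : ℝ))) := by
          rw [Real.div_rpow hs'.le hs.le, ENNReal.ofReal_div_of_pos (by positivity),
            ← mul_div_assoc, ENNReal.div_mul_cancel hne ENNReal.ofReal_ne_top]
      _ = _ := by rw [← e1, mul_add, mul_one]
  have h5 : T / ENNReal.ofReal (s' ^ (1 - p / (d : ℝ))) ≤ C :=
    (scaledMean_boundary_le_origin hd' hp s').trans (scaledMean_origin_le hC hs')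
  calc scaledMean p (boundaryCost p) (unitMeasure d) s
      ≤ (T + C * ENNReal.ofReal ((s' - s) ^ (1 - p / (d : ℝ)))) /
          ENNReal.ofReal (s ^ (1 - p / (d : ℝ))) := ENNReal.div_le_div_right h2 _
    _ = T / ENNReal.ofReal (s' ^ (1 - p / (d : ℝ))) +
      T / ENNReal.ofReal (s' ^ (1 - p / (d : ℝ))) *
        ENNReal.ofReal ((s' / s) ^ (1 - p / (d : ℝ)) - 1) +
        C * ENNReal.ofReal ((s' / s - 1) ^ (1 - p / (d : ℝ))) := by
        rw [ENNReal.add_div, h4, mul_div_assoc, ← ENNReal.ofReal_div_of_pos (by positivity),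
          ← Real.div_rpow (by linarith) hs.le, sub_div, div_self hs.ne']
    _ ≤ T / ENNReal.ofReal (s' ^ (1 - p / (d : ℝ))) +
      C * ENNReal.ofReal ((s' / s) ^ (1 - p / (d : ℝ)) - 1) +
        C * ENNReal.ofReal ((s' / s - 1) ^ (1 - p / (d : ℝ))) := by gcongr
    _ = _ := by rw [add_assoc]; rfl

end BipartiteMatching

namespace BipartiteMatching

variable {d : ℕ}

/-! ### Existence of limits -/

theorem tendsto_floor_ratio_pow (hd : 0 < d) {s : ℝ} (hs : 0 < s) :
    Tendsto (fun t : ℝ => t / (⌊(t / s) ^ (1 / (d : ℝ))⌋₊ : ℝ) ^ d / s) atTop (𝓝 1) := by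
  have hd' : (0 : ℝ) < d := by exact_mod_cast hd
  have hx : Tendsto (fun t : ℝ => (t / s) ^ (1 / (d : ℝ))) atTop atTop :=
    (tendsto_rpow_atTop (by positivity)).comp (tendsto_id.atTop_div_const hs)
  have h1 := (tendsto_nat_floor_div_atTop (R := ℝ)).comp hx
  have h2 := (h1.inv₀ one_ne_zero).pow d
  rw [inv_one, one_pow] at h2
  refine h2.congr' ?_
  filter_upwards [eventually_gt_atTop 0] with t ht
  have hts : 0 < t / s := by positivity
  rw [Function.comp_apply, inv_div, div_pow, ← Real.rpow_natCast ((t / s) ^ _),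
    ← Real.rpow_mul hts.le, one_div_mul_cancel hd'.ne', Real.rpow_one]
  rw [div_right_comm]

/-- For fixed s, write t = m^d s' with m the integer part of (t/s)^(1/d). Then s' ≥ s and s'/s → 1,
so b s is at most b t up to a vanishing error. Every value is thus at most the lower limit, and so
is the upper limit. -/
theorem exists_tendsto_of_superadditive (hd : 0 < d) {b e : ℝ → ℝ≥0∞}
    (hmul : ∀ m : ℕ, 0 < m → ∀ s : ℝ, 0 < s → b s ≤ b ((m : ℝ) ^ d * s))
    (hmono : ∀ s s' : ℝ, 0 < s → s ≤ s' → b s ≤ b s' + e (s' / s))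
    (he : Tendsto e (𝓝 1) (𝓝 0)) :
    ∃ l, Tendsto b atTop (𝓝 l) ∧ ∀ s, 0 < s → b s ≤ l := by
  have hd' : (0 : ℝ) < d := by exact_mod_cast hd
  have key : ∀ s, 0 < s → b s ≤ liminf b atTop := by
    intro s hs
    have h1 : Tendsto (fun t : ℝ => b s - e (t / (⌊(t / s) ^ (1 / (d : ℝ))⌋₊ : ℝ) ^ d / s))
        atTop (𝓝 (b s - 0)) :=
      ENNReal.Tendsto.sub tendsto_const_nhds (he.comp (tendsto_floor_ratio_pow hd hs))
        (Or.inr ENNReal.zero_ne_top)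
    rw [tsub_zero] at h1
    rw [← h1.liminf_eq]
    refine liminf_le_liminf ?_
    filter_upwards [eventually_ge_atTop s] with t ht
    have ht0 : 0 < t := by linarith
    set x := (t / s) ^ (1 / (d : ℝ)) with hx
    have hts : 1 ≤ t / s := (one_le_div hs).2 ht
    have hx1 : 1 ≤ x := Real.one_le_rpow hts (by positivity)
    have hxd : x ^ d = t / s := by
      rw [← Real.rpow_natCast, hx, ← Real.rpow_mul (by positivity),
        one_div_mul_cancel hd'.ne', Real.rpow_one]
    have hm : 0 < ⌊x⌋₊ := Nat.floor_pos.2 hx1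
    have hm' : (0 : ℝ) < (⌊x⌋₊ : ℝ) ^ d := by positivity
    have hle : s ≤ t / (⌊x⌋₊ : ℝ) ^ d := by
      rw [le_div_iff₀ hm', mul_comm, ← le_div_iff₀ hs, ← hxd]
      gcongr
      exact Nat.floor_le (by linarith)
    rw [tsub_le_iff_right]
    refine (hmono s _ hs hle).trans (add_le_add_left ?_ _)
    have := hmul ⌊x⌋₊ hm (t / (⌊x⌋₊ : ℝ) ^ d) (by positivity)
    rwa [mul_div_cancel₀ _ hm'.ne'] at this
  refine ⟨liminf b atTop, tendsto_of_le_liminf_of_limsup_le le_rfl ?_, key⟩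
  exact limsup_le_of_le (by isBoundedDefault)
    ((eventually_gt_atTop 0).mono fun s hs => key s hs)

/-- Using m = 2^k at once would produce the unbounded error 2^(kp). Doubling k times instead gives
errors that decrease geometrically with ratio `r`, and `A` is 2^p times the sum of the series. -/
theorem le_add_of_dyadic {b : ℝ → ℝ≥0∞} {K : ℝ≥0∞} {p δ : ℝ} (hd : 0 < d) (hδ : 0 < δ)
    (hmul : ∀ m : ℕ, 0 < m → ∀ s : ℝ, 0 < s →
      b ((m : ℝ) ^ d * s) ≤ b s + K * ENNReal.ofReal ((m : ℝ) ^ p * s ^ (-δ))) :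
    ∃ A : ℝ, 0 ≤ A ∧ ∀ (k : ℕ) (s : ℝ), 0 < s →
      b (((2 : ℝ) ^ k) ^ d * s) ≤ b s + K * ENNReal.ofReal (A * s ^ (-δ)) := by
  have hd' : (0 : ℝ) < d := by exact_mod_cast hd
  set r : ℝ := ((2 : ℝ) ^ d) ^ (-δ) with hr
  have hr0 : 0 < r := by positivity
  have hr1 : r < 1 := Real.rpow_lt_one_of_one_lt_of_neg (one_lt_pow₀ one_lt_two hd.ne') (by linarith)
  set A : ℝ := 2 ^ p / (1 - r) with hA
  have h1r : 0 < 1 - r := by linarith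
  have hA0 : 0 < A := by positivity
  have hA2 : A * (1 - r) = 2 ^ p := div_mul_cancel₀ _ h1r.ne'
  -- The factor 1 - r^k records the partial sum, which lets the induction close.
  have key : ∀ (k : ℕ) (s : ℝ), 0 < s →
      b (((2 : ℝ) ^ k) ^ d * s) ≤ b s + K * ENNReal.ofReal (A * (1 - r ^ k) * s ^ (-δ)) := by
    intro k s hs
    induction k with
    | zero => simp
    | succ k ih =>
      have h1 := hmul 2 two_pos (((2 : ℝ) ^ k) ^ d * s) (by positivity)
      have e1 : ((2 : ℕ) : ℝ) ^ d * (((2 : ℝ) ^ k) ^ d * s) = ((2 : ℝ) ^ (k + 1)) ^ d * s := by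
        rw [pow_succ, mul_pow]; push_cast; ring
      have e2 : (((2 : ℝ) ^ k) ^ d * s) ^ (-δ) = r ^ k * s ^ (-δ) := by
        rw [Real.mul_rpow (by positivity) hs.le, hr, ← Real.rpow_natCast (_ ^ (-δ)),
          ← Real.rpow_mul (by positivity), mul_comm (-δ), Real.rpow_mul (by positivity),
          Real.rpow_natCast, ← pow_mul, ← pow_mul, Nat.mul_comm d k]
      have hk1 : r ^ k ≤ 1 := pow_le_one₀ hr0.le hr1.le
      rw [e1, e2] at h1
      refine (h1.trans (add_le_add_left ih _)).trans (le_of_eq ?_)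
      rw [add_assoc, ← mul_add, ← ENNReal.ofReal_add
        (mul_nonneg (mul_nonneg hA0.le (by linarith)) (by positivity)) (by positivity)]
      congr 3
      rw [Nat.cast_ofNat, ← hA2]
      ring
  refine ⟨A, hA0.le, fun k s hs => (key k s hs).trans ?_⟩
  gcongr
  have : 0 ≤ r ^ k := by positivity
  nlinarith

/-- For t large, t = (2^k)^d m^d s' with m₀ ≤ m ≤ 2m₀. The lower bound on m forces s'/s ≤ (1 +
1/m₀)^d, the upper bound controls the error m^p, and the factor 2^k is handled by repeated doubling.
First s → ∞, then m₀ → ∞. -/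
theorem exists_tendsto_of_almost_subadditive (hd : 0 < d) {b e : ℝ → ℝ≥0∞} {C K : ℝ≥0∞}
    {p δ : ℝ} (hp : 0 < p) (hδ : 0 < δ) (hC : C ≠ ∞) (hK : K ≠ ∞)
    (hmul : ∀ m : ℕ, 0 < m → ∀ s : ℝ, 0 < s →
      b ((m : ℝ) ^ d * s) ≤ b s + K * ENNReal.ofReal ((m : ℝ) ^ p * s ^ (-δ)))
    (hmono : ∀ s s' : ℝ, 0 < s → s ≤ s' → b s' ≤ b s + e (s' / s))
    (hbC : ∀ s, 0 < s → b s ≤ C)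
    (he : Tendsto e (𝓝 1) (𝓝 0)) (he_mono : MonotoneOn e (Set.Ici 1)) :
    ∃ l, Tendsto b atTop (𝓝 l) := by
  have hd' : (0 : ℝ) < d := by exact_mod_cast hd
  obtain ⟨A, hA, hdy⟩ := le_add_of_dyadic hd hδ hmul
  have key : ∀ m₀ : ℕ, 0 < m₀ → ∀ s, 0 < s → limsup b atTop ≤
      b s + (e ((1 + 1 / m₀) ^ d) +
        K * ENNReal.ofReal ((A + (2 * m₀) ^ p) * s ^ (-δ))) := by
    intro m₀ hm₀ s hs
    have hm₀' : (0 : ℝ) < m₀ := by exact_mod_cast hm₀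
    refine limsup_le_of_le (by isBoundedDefault) ?_
    filter_upwards [eventually_ge_atTop ((m₀ : ℝ) ^ d * s)] with t ht
    have ht0 : 0 < t := lt_of_lt_of_le (by positivity) ht
    set x := (t / s) ^ (1 / (d : ℝ)) with hx
    have hxd : x ^ d = t / s := by
      rw [← Real.rpow_natCast, hx, ← Real.rpow_mul (by positivity),
        one_div_mul_cancel hd'.ne', Real.rpow_one]
    have hx0 : 0 ≤ x := by positivity
    have hxm : (m₀ : ℝ) ≤ x := by
      refine le_of_pow_le_pow_left₀ hd.ne' hx0 ?_
      rw [hxd, le_div_iff₀ hs]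
      exact ht
    -- With this k, x / 2^k lies between m₀ and 2m₀, and its integer part is m.
    obtain ⟨k, hk1, hk2⟩ := exists_nat_pow_near (x := x / m₀) (y := 2)
      ((one_le_div hm₀').2 hxm) one_lt_two
    rw [le_div_iff₀ hm₀'] at hk1
    rw [div_lt_iff₀ hm₀'] at hk2
    have h2k : (0 : ℝ) < 2 ^ k := by positivity
    set m := ⌊x / 2 ^ k⌋₊ with hm
    have hm1 : m₀ ≤ m := Nat.le_floor (by rw [le_div_iff₀ h2k, mul_comm]; exact hk1)
    have hmx : (m : ℝ) ≤ x / 2 ^ k := Nat.floor_le (by positivity)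
    have hmx' : x / 2 ^ k < m + 1 := Nat.lt_floor_add_one _
    have hm1' : (m₀ : ℝ) ≤ m := by exact_mod_cast hm1
    have hm0' : (0 : ℝ) < m := by linarith
    have hm2 : (m : ℝ) ≤ 2 * m₀ := by
      refine hmx.trans ?_
      rw [div_le_iff₀ h2k]
      rw [pow_succ] at hk2
      linarith
    set s' := t / (2 ^ k * m) ^ d with hs'
    have hs'0 : 0 < s' := by positivity
    have hratio : s' / s = (x / 2 ^ k / m) ^ d := by
      rw [hs', div_right_comm, ← hxd, ← div_pow, div_div]
    have hone : 1 ≤ s' / s := by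
      rw [hratio]
      exact one_le_pow₀ ((one_le_div hm0').2 hmx)
    have hss : s ≤ s' := (one_le_div hs).1 hone
    have hr2 : s' / s ≤ (1 + 1 / m₀) ^ d := by
      rw [hratio]
      refine pow_le_pow_left₀ (by positivity) ?_ d
      rw [div_le_iff₀ hm0']
      have : (1 : ℝ) ≤ 1 / m₀ * m := by
        rw [one_div_mul_eq_div]; exact (one_le_div hm₀').2 hm1'
      nlinarith
    have ht' : t = (2 ^ k) ^ d * ((m : ℝ) ^ d * s') := by
      rw [hs', mul_pow]; field_simp
    have hneg : s' ^ (-δ) ≤ s ^ (-δ) := Real.rpow_le_rpow_of_nonpos hs hss (by linarith)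
    have hneg2 : ((m : ℝ) ^ d * s') ^ (-δ) ≤ s ^ (-δ) := by
      refine Real.rpow_le_rpow_of_nonpos hs (hss.trans ?_) (by linarith)
      have : (1 : ℝ) ≤ (m : ℝ) ^ d := one_le_pow₀ (by exact_mod_cast (hm₀.trans_le hm1))
      nlinarith
    calc b t ≤ b ((m : ℝ) ^ d * s') + K * ENNReal.ofReal (A * ((m : ℝ) ^ d * s') ^ (-δ)) := by
          conv_lhs => rw [ht']
          exact hdy k _ (by positivity)
      _ ≤ (b s' + K * ENNReal.ofReal ((m : ℝ) ^ p * s' ^ (-δ))) +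
          K * ENNReal.ofReal (A * ((m : ℝ) ^ d * s') ^ (-δ)) :=
          add_le_add_left (hmul m (hm₀.trans_le hm1) s' hs'0) _
      _ ≤ ((b s + e ((1 + 1 / m₀) ^ d)) + K * ENNReal.ofReal ((2 * m₀) ^ p * s ^ (-δ))) +
          K * ENNReal.ofReal (A * s ^ (-δ)) := by
          gcongr
          exact (hmono s s' hs hss).trans
            (add_le_add_right (he_mono hone (hone.trans hr2) hr2) _)
      _ = _ := by
          rw [add_mul A, ENNReal.ofReal_add (by positivity) (by positivity)]
          ring
  -- Finiteness of the upper limit makes the subtraction from it continuous.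
  have hLtop : limsup b atTop ≠ ∞ := by
    refine ne_top_of_le_ne_top hC (limsup_le_of_le (by isBoundedDefault) ?_)
    exact (eventually_gt_atTop 0).mono hbC
  have key2 : ∀ m₀ : ℕ, 0 < m₀ → limsup b atTop ≤ liminf b atTop + e ((1 + 1 / m₀) ^ d) := by
    intro m₀ hm₀
    rw [← tsub_le_iff_right]
    have h0 : Tendsto (fun s : ℝ => K * ENNReal.ofReal ((A + (2 * m₀) ^ p) * s ^ (-δ)))
        atTop (𝓝 0) := by
      have h := (tendsto_rpow_neg_atTop hδ).const_mul (A + (2 * (m₀ : ℝ)) ^ p)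
      rw [mul_zero] at h
      have h' := ENNReal.Tendsto.const_mul (a := K) (ENNReal.tendsto_ofReal h) (Or.inr hK)
      simpa using h'
    have h1 := ENNReal.Tendsto.sub (tendsto_const_nhds (x := limsup b atTop))
      (tendsto_const_nhds (x := e ((1 + 1 / m₀) ^ d)) |>.add h0) (Or.inl hLtop)
    rw [add_zero] at h1
    rw [← h1.liminf_eq]
    refine liminf_le_liminf ((eventually_gt_atTop 0).mono fun s hs => ?_)
    rw [tsub_le_iff_right]
    exact key m₀ hm₀ s hs
  refine ⟨liminf b atTop, tendsto_of_le_liminf_of_limsup_le le_rfl ?_⟩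
  have hlim : Tendsto (fun m₀ : ℕ => liminf b atTop + e ((1 + 1 / (m₀ : ℝ)) ^ d)) atTop
      (𝓝 (liminf b atTop + 0)) := by
    refine tendsto_const_nhds.add (he.comp ?_)
    have := (tendsto_const_nhds (x := (1 : ℝ))).add (tendsto_one_div_atTop_nhds_zero_nat (𝕜 := ℝ))
    simpa using this.pow d
  rw [add_zero] at hlim
  exact ge_of_tendsto hlim ((eventually_gt_atTop 0).mono key2)

end BipartiteMatching

namespace BipartiteMatching

variable {d : ℕ}

/-! ### The limit constants -/

theorem exitCost_le_transportCost_singleton {α β : Type*} (c : α → β → ℝ≥0∞) (h : α → ℝ≥0∞)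
    (k : β → ℝ≥0∞) (x : α) : h x ≤ transportCost c h k {x} 0 := by
  refine le_iInf fun M => ?_
  have h0 : M.pairs = 0 := by
    have := M.snd_eq.symm
    rw [add_eq_zero, Multiset.map_eq_zero] at this
    exact this.1
  have h1 : M.left = {x} := by
    have := M.fst_eq
    rw [h0, Multiset.map_zero, zero_add] at this
    exact this.symm
  rw [PartialMatching.cost, h0, h1]
  simp

theorem poissonWeight_ne_zero (ν : Measure (Pt d)) (k : ℕ) : poissonWeight ν k ≠ 0 := by
  have : 0 < Real.exp (-(ν.real Set.univ)) / (Nat.factorial k : ℝ) := by positivity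
  simpa [poissonWeight] using this

/-- When one process has a single point and the other none, that point has to exit. -/
theorem mul_lintegral_le_transportMean {p : ℝ} {h : Pt d → ℝ≥0∞} (hh : Measurable h)
    (ν : Measure (Pt d)) [IsFiniteMeasure ν] :
    poissonWeight ν 1 * (poissonWeight ν 0 * ∫⁻ x, h x ∂ν) ≤ transportMean p h ν := by
  have hF := IsExitCost.measurableFunctional₂ (p := p) hh
  refine le_trans ?_ (lintegral_singleton_le_poissonMean ν (hF.poissonMean ν))
  rw [← lintegral_const_mul _ hh]
  gcongr with x
  refine le_trans ?_ (poissonWeight_mul_empty_le_poissonMean ν (hF.right {x}))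
  gcongr
  exact exitCost_le_transportCost_singleton _ _ _ x

theorem scaledMean_boundary_pos (hd : 0 < d) (p : ℝ) :
    0 < scaledMean p (boundaryCost p) (unitMeasure d) 1 := by
  have h1 : 0 < ∫⁻ x, boundaryCost p x ∂(ENNReal.ofReal 1 • unitMeasure d) := by
    rw [ENNReal.ofReal_one, one_smul, lintegral_pos_iff_support (measurable_boundaryCost p)]
    have hsub : (frontier (unitCube d))ᶜ ⊆ Function.support (boundaryCost (d := d) p) :=
      fun x hx => (boundaryCost_pos hd hx).ne'
    refine lt_of_lt_of_le ?_ (measure_mono hsub)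
    have h0 : unitMeasure d (frontier (unitCube d)) = 0 :=
      le_antisymm ((Measure.restrict_apply_le _ _).trans volume_frontier_unitCube.le) zero_le
    rw [measure_compl isClosed_frontier.measurableSet (measure_ne_top _ _), h0, measure_univ,
      tsub_zero]
    exact one_pos
  refine ENNReal.div_pos (ne_of_gt (lt_of_lt_of_le ?_ (mul_lintegral_le_transportMean
    (measurable_boundaryCost p) _))) ENNReal.ofReal_ne_top
  exact pos_iff_ne_zero.2 (mul_ne_zero (poissonWeight_ne_zero _ _)
    (mul_ne_zero (poissonWeight_ne_zero _ _) h1.ne'))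

theorem tendsto_ofReal_sub_one_rpow {γ : ℝ} (hγ : 0 < γ) :
    Tendsto (fun x : ℝ => ENNReal.ofReal ((x - 1) ^ γ)) (𝓝 1) (𝓝 0) := by
  have h : Continuous fun x : ℝ => ENNReal.ofReal ((x - 1) ^ γ) :=
    ENNReal.continuous_ofReal.comp ((continuous_id.sub continuous_const).rpow_const
      fun _ => Or.inr hγ.le)
  simpa [Real.zero_rpow hγ.ne'] using h.tendsto 1

theorem tendsto_ofReal_rpow_sub_one {γ : ℝ} (hγ : 0 < γ) :
    Tendsto (fun x : ℝ => ENNReal.ofReal (x ^ γ - 1)) (𝓝 1) (𝓝 0) := by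
  have h : Continuous fun x : ℝ => ENNReal.ofReal (x ^ γ - 1) :=
    ENNReal.continuous_ofReal.comp ((continuous_id.rpow_const
      fun _ => Or.inr hγ.le).sub continuous_const)
  simpa using h.tendsto 1

theorem exists_tendsto_scaledMean {p : ℝ} (hp : 0 < p) (hp1 : p ≤ 1) (hpd : p < (d : ℝ) / 2) :
    ∃ β β' : ℝ, 0 < β ∧ 0 < β' ∧
      Tendsto (scaledMean p (pointCost p 0) (unitMeasure d)) atTop (𝓝 (ENNReal.ofReal β)) ∧
      Tendsto (scaledMean p (boundaryCost p) (unitMeasure d)) atTop (𝓝 (ENNReal.ofReal β')) := by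
  have hd' : (0 : ℝ) < d := by linarith
  have hd : 0 < d := by exact_mod_cast hd'
  have hpd' : p / d < 1 / 2 := by
    rw [div_lt_iff₀ hd']
    linarith
  have hγ : 0 < 1 - p / d := by linarith
  have hδ : 0 < 1 - p / d - 1 / 2 := by linarith
  obtain ⟨C, hCtop, hC⟩ := exists_originMean_smul_unitMeasure_le hp hp1 hpd
  have he : Tendsto (fun x : ℝ => C * ENNReal.ofReal ((x - 1) ^ (1 - p / (d : ℝ)))) (𝓝 1)
      (𝓝 0) := by
    simpa using ENNReal.Tendsto.const_mul (tendsto_ofReal_sub_one_rpow hγ) (Or.inr hCtop)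
  have he' : Tendsto (fun x : ℝ => C * ENNReal.ofReal (x ^ (1 - p / (d : ℝ)) - 1)) (𝓝 1)
      (𝓝 0) := by
    simpa using ENNReal.Tendsto.const_mul (tendsto_ofReal_rpow_sub_one hγ) (Or.inr hCtop)
  obtain ⟨l', hl', hle'⟩ := exists_tendsto_of_superadditive
    (b := scaledMean p (boundaryCost p) (unitMeasure d)) hd
    (fun m hm s hs => scaledMean_boundary_le_pow_mul hd hp hp1 hm hs)
    (fun s s' hs hss => scaledMean_boundary_mono_le hp hp1 hpd hC hs hss)
    (by simpa using he'.add he)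
  obtain ⟨l, hl⟩ := exists_tendsto_of_almost_subadditive
    (b := scaledMean p (pointCost p 0) (unitMeasure d))
    (K := 2 * ENNReal.ofReal ((d : ℝ) ^ p)) hd hp hδ hCtop
    (ENNReal.mul_ne_top (by simp) ENNReal.ofReal_ne_top)
    (fun m hm s hs => scaledMean_origin_pow_mul_le hd hp hp1 hm hs)
    (fun s s' hs hss => scaledMean_origin_mono_le hp hp1 hpd hC hs hss)
    (fun s hs => scaledMean_origin_le hC hs) he (by
      intro x hx y hy hxy
      have h1 : (0 : ℝ) ≤ x - 1 := sub_nonneg.2 hx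
      dsimp only
      gcongr)
  -- The boundary price is below the origin price on the unit cell. So finiteness passes from the
  -- origin limit to the boundary limit, and positivity in the other direction.
  have hl'l : l' ≤ l := le_of_tendsto_of_tendsto' hl' hl fun s =>
    scaledMean_boundary_le_origin hd hp s
  have hltop : l ≠ ∞ := ne_top_of_le_ne_top hCtop
    (le_of_tendsto hl ((eventually_gt_atTop 0).mono fun s hs => scaledMean_origin_le hC hs))
  have hl'top : l' ≠ ∞ := ne_top_of_le_ne_top hltop hl'l
  have hl'0 : 0 < l' := (scaledMean_boundary_pos hd p).trans_le (hle' 1 one_pos)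
  refine ⟨l.toReal, l'.toReal, ENNReal.toReal_pos (hl'0.trans_le hl'l).ne' hltop,
    ENNReal.toReal_pos hl'0.ne' hl'top, ?_, ?_⟩
  · rwa [ENNReal.ofReal_toReal hltop]
  · rwa [ENNReal.ofReal_toReal hl'top]

end BipartiteMatching

namespace BipartiteMatching

variable {d : ℕ}

/-! ### Stability of the scaled transport mean -/

/-- The scaled transport mean with an exit at the origin. -/
noncomputable abbrev originScaled (p : ℝ) (ν : Measure (Pt d)) (t : ℝ) : ℝ≥0∞ :=
  scaledMean p (pointCost p 0) ν t

theorem originScaled_add_le {p : ℝ} (hp : 0 < p) (hp1 : p ≤ 1) (μ ν : Measure (Pt d))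
    [IsFiniteMeasure μ] [IsFiniteMeasure ν] (t : ℝ) :
    originScaled p (μ + ν) t ≤ originScaled p μ t + originScaled p ν t := by
  unfold originScaled scaledMean
  rw [smul_add, ← ENNReal.add_div]
  exact ENNReal.div_le_div_right
    (transportMean_add_le (isExitCost_pointCost hp hp1 0).measurable _ _) _

theorem originScaled_le_add {p : ℝ} (hp : 0 < p) (hp1 : p ≤ 1) (μ ν : Measure (Pt d))
    [IsFiniteMeasure μ] [IsFiniteMeasure ν] (t : ℝ) :
    originScaled p μ t ≤ originScaled p (μ + ν) t + originScaled p ν t := by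
  unfold originScaled scaledMean
  rw [smul_add, ← ENNReal.add_div]
  exact ENNReal.div_le_div_right (transportMean_le_add hp hp1 (isExitCost_pointCost hp hp1 0) _ _) _

/-- Used with `e` and `e'` the two positive parts of the difference of two densities. -/
theorem originScaled_le_of_add_eq {p : ℝ} (hp : 0 < p) (hp1 : p ≤ 1) {μ ν e e' : Measure (Pt d)}
    [IsFiniteMeasure μ] [IsFiniteMeasure ν] [IsFiniteMeasure e] [IsFiniteMeasure e']
    (h : μ + e' = ν + e) (t : ℝ) :
    originScaled p μ t ≤ originScaled p ν t + (originScaled p e t + originScaled p e' t) := by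
  refine (originScaled_le_add hp hp1 μ e' t).trans ?_
  rw [h, ← add_assoc]
  exact add_le_add_left (originScaled_add_le hp hp1 ν e t) _

theorem ofReal_smul_univ_rpow {γ : ℝ} (hγ : 0 ≤ γ) {t : ℝ} (ht : 0 < t) (ν : Measure (Pt d)) :
    (ENNReal.ofReal t • ν) Set.univ ^ γ = ENNReal.ofReal (t ^ γ) * ν Set.univ ^ γ := by
  rw [ofReal_smul_univ, ENNReal.mul_rpow_of_nonneg _ _ hγ, ENNReal.ofReal_rpow_of_pos ht]

theorem scaledMean_le_of_le {p : ℝ} {h : Pt d → ℝ≥0∞} {ν : Measure (Pt d)} {t : ℝ} {K : ℝ≥0∞}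
    (hK : transportMean p h (ENNReal.ofReal t • ν) ≤
      K * ENNReal.ofReal (t ^ (1 - p / (d : ℝ)))) : scaledMean p h ν t ≤ K :=
  ENNReal.div_le_of_le_mul hK

theorem exists_originScaled_ball_le {p : ℝ} (hp : 0 < p) (hp1 : p ≤ 1) (hpd : p < (d : ℝ) / 2) :
    ∃ C : ℝ≥0∞, C ≠ ∞ ∧ ∀ (s : ℝ) (ν : Measure (Pt d)) [IsFiniteMeasure ν], 0 < s →
      (∀ᵐ x ∂ν, ‖x‖ < s) → ∀ t : ℝ, 0 < t →
      originScaled p ν t ≤ C * ENNReal.ofReal (s ^ p) * ν Set.univ ^ (1 - p / (d : ℝ)) := by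
  obtain ⟨C, hC, h⟩ := exists_originMean_ball_le hp hp1 hpd
  have hd : (0 : ℝ) < d := by linarith
  have hγ : 0 ≤ 1 - p / d := by
    rw [sub_nonneg, div_le_one hd]
    linarith
  refine ⟨C, hC, fun s ν _ hs hν t ht => scaledMean_le_of_le ?_⟩
  refine (h s (ENNReal.ofReal t • ν) hs (ae_ofReal_smul hν t)).trans (le_of_eq ?_)
  rw [ofReal_smul_univ_rpow hγ ht]
  ring

/-! ### Tails -/

theorem pointCost_zero_eq {p : ℝ} (hp : 0 < p) (x : Pt d) :
    pointCost p 0 x = ENNReal.ofReal (‖x‖ ^ p) := by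
  rw [pointCost, powDist_eq_ofReal hp, sub_zero]

theorem lintegral_norm_rpow_ne_top {p α : ℝ} (hp : 0 < p) (hpα : p ≤ α) {ν : Measure (Pt d)}
    [IsFiniteMeasure ν] (hν : ∫⁻ x, ENNReal.ofReal (‖x‖ ^ α) ∂ν ≠ ∞) :
    ∫⁻ x, pointCost p 0 x ∂ν ≠ ∞ := by
  have h1 : ∫⁻ x, (1 + ENNReal.ofReal (‖x‖ ^ α)) ∂ν ≠ ∞ := by
    rw [lintegral_add_left measurable_const]
    simpa using hν
  refine ne_top_of_le_ne_top h1 (lintegral_mono fun x => ?_)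
  rw [pointCost_zero_eq hp]
  rcases le_total ‖x‖ 1 with h | h
  · refine le_add_right ?_
    rw [← ENNReal.ofReal_one]
    exact ENNReal.ofReal_le_ofReal (Real.rpow_le_one (norm_nonneg _) h hp.le)
  · exact le_add_left (ENNReal.ofReal_le_ofReal (Real.rpow_le_rpow_of_exponent_le h hpα))

theorem measure_le_norm_le {α : ℝ} (hα : 0 < α) (ν : Measure (Pt d)) {s : ℝ} (hs : 0 < s) :
    ν {x | s ≤ ‖x‖} ≤ (∫⁻ x, ENNReal.ofReal (‖x‖ ^ α) ∂ν) * ENNReal.ofReal (s ^ (-α)) := by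
  have hm : Measurable fun x : Pt d => ENNReal.ofReal (‖x‖ ^ α) := by fun_prop
  have h := mul_meas_ge_le_lintegral (μ := ν) hm (ENNReal.ofReal (s ^ α))
  have hsub : {x : Pt d | s ≤ ‖x‖} ⊆ {x | ENNReal.ofReal (s ^ α) ≤ ENNReal.ofReal (‖x‖ ^ α)} :=
    fun x hx => ENNReal.ofReal_le_ofReal (Real.rpow_le_rpow hs.le hx hα.le)
  have h2 : ENNReal.ofReal (s ^ α) * ENNReal.ofReal (s ^ (-α)) = 1 := by
    rw [← ENNReal.ofReal_mul (by positivity), ← Real.rpow_add hs, add_neg_cancel, Real.rpow_zero,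
      ENNReal.ofReal_one]
  calc ν {x | s ≤ ‖x‖} = ENNReal.ofReal (s ^ α) * ν {x | s ≤ ‖x‖} * ENNReal.ofReal (s ^ (-α)) := by
        rw [mul_right_comm, h2, one_mul]
    _ ≤ _ := by
        gcongr
        exact (by gcongr : _ ≤ _).trans h

theorem restrict_norm_ge_eq_add (ν : Measure (Pt d)) {s s' : ℝ} (hs : s ≤ s') :
    ν.restrict {x | s ≤ ‖x‖} =
      ν.restrict {x | s ≤ ‖x‖ ∧ ‖x‖ < s'} + ν.restrict {x | s' ≤ ‖x‖} := by
  rw [← Measure.restrict_union _ (measurableSet_le measurable_const measurable_norm)]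
  · congr 1
    refine Set.ext fun x => ?_
    simp only [Set.mem_ofPred_eq, Set.mem_union]
    constructor
    · intro h
      rcases lt_or_ge ‖x‖ s' with h' | h'
      · exact Or.inl ⟨h, h'⟩
      · exact Or.inr h'
    · rintro (h | h)
      · exact h.1
      · exact hs.trans h
  · exact Set.disjoint_left.2 fun x hx hx' => absurd hx.2 (not_lt.2 hx')

/-- The trivial bound by exit prices, at fixed t and with no uniformity in t. It only disposes of
the remainder after finitely many annuli. -/
theorem tendsto_originScaled_tail {p : ℝ} (hp : 0 < p) (hp1 : p ≤ 1) {ν : Measure (Pt d)}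
    [IsFiniteMeasure ν] (hν : ∫⁻ x, pointCost p 0 x ∂ν ≠ ∞) {t : ℝ} (ht : 0 < t) :
    Tendsto (fun n : ℕ => originScaled p (ν.restrict {x | (2 : ℝ) ^ n ≤ ‖x‖}) t) atTop (𝓝 0) := by
  have hmeas : Measurable (pointCost (d := d) p 0) := (isExitCost_pointCost hp hp1 0).measurable
  have hsets : ∀ n : ℕ, MeasurableSet {x : Pt d | (2 : ℝ) ^ n ≤ ‖x‖} := fun n =>
    measurableSet_le measurable_const measurable_norm
  have h1 : Tendsto (fun n : ℕ => ν {x | (2 : ℝ) ^ n ≤ ‖x‖}) atTop (𝓝 0) := by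
    have h := tendsto_measure_iInter_atTop (μ := ν) (s := fun n : ℕ => {x | (2 : ℝ) ^ n ≤ ‖x‖})
      (fun n => (hsets n).nullMeasurableSet)
      (fun m n hmn x (hx : (2 : ℝ) ^ n ≤ ‖x‖) => (pow_le_pow_right₀ one_le_two hmn).trans hx) ⟨0, measure_ne_top _ _⟩
    have hempty : ⋂ n : ℕ, {x : Pt d | (2 : ℝ) ^ n ≤ ‖x‖} = ∅ := by
      refine Set.eq_empty_of_forall_notMem fun x hx => ?_
      obtain ⟨n, hn⟩ := pow_unbounded_of_one_lt ‖x‖ one_lt_two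
      exact absurd (Set.mem_iInter.1 hx n) (not_le.2 hn)
    rwa [hempty, measure_empty] at h
  have h2 := tendsto_setLIntegral_zero hν h1
  set K : ℝ≥0∞ := 2 * ENNReal.ofReal t / ENNReal.ofReal (t ^ (1 - p / (d : ℝ))) with hK
  have hKtop : K ≠ ∞ := by
    have : 0 < t ^ (1 - p / (d : ℝ)) := by positivity
    exact ENNReal.div_ne_top (ENNReal.mul_ne_top (by simp) ENNReal.ofReal_ne_top) (by simpa using this)
  have h3 := ENNReal.Tendsto.const_mul (a := K) h2 (Or.inr hKtop)
  rw [mul_zero] at h3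
  refine tendsto_of_tendsto_of_tendsto_of_le_of_le tendsto_const_nhds h3 (fun _ => zero_le)
    fun n => ?_
  refine (ENNReal.div_le_div_right (transportMean_le_lintegral hmeas _) _).trans (le_of_eq ?_)
  rw [lintegral_smul_measure, smul_eq_mul, hK, ← mul_assoc, ENNReal.mul_div_right_comm]

/-- On the annulus 2^k ≤ |x| < 2^(k+1) the ball bound gives a constant times 2^(kp) ν(|x| ≥
2^k)^(1-p/d). By Markov's inequality this is geometric with ratio 2^(p - α(1-p/d)) < 1. The sum over
the annuli is uniform in t. -/
theorem exists_tail_le {p α : ℝ} (hp : 0 < p) (hp1 : p ≤ 1) (hpd : p < (d : ℝ) / 2)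
    (hα : p < α * (1 - p / (d : ℝ))) {ν : Measure (Pt d)}
    [IsFiniteMeasure ν] (hν : ∫⁻ x, ENNReal.ofReal (‖x‖ ^ α) ∂ν ≠ ∞) {ε : ℝ≥0∞} (hε : 0 < ε)
    (R₀ : ℝ) : ∃ R : ℝ, R₀ ≤ R ∧ 0 < R ∧ ∀ t : ℝ, 0 < t → originScaled p (ν.restrict {x | R ≤ ‖x‖}) t ≤ ε := by
  obtain ⟨C, hC, hball⟩ := exists_originScaled_ball_le hp hp1 hpd
  have hd : (0 : ℝ) < d := by linarith
  set γ : ℝ := 1 - p / d with hγ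
  have hγ0 : 0 < γ := by
    rw [hγ, sub_pos, div_lt_one hd]
    linarith
  have hγ1 : γ ≤ 1 := by
    have : 0 ≤ p / d := by positivity
    linarith
  have hα0 : 0 < α := pos_of_mul_pos_left (hp.trans hα) hγ0.le
  have hpα : p ≤ α := hα.le.trans (mul_le_of_le_one_right hα0.le hγ1)
  have hpt := lintegral_norm_rpow_ne_top hp hpα hν
  set M := ∫⁻ x, ENNReal.ofReal (‖x‖ ^ α) ∂ν with hM
  set θ : ℝ≥0∞ := ENNReal.ofReal ((2 : ℝ) ^ (p - α * γ)) with hθ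
  have hθ1 : θ < 1 := by
    rw [hθ, ← ENNReal.ofReal_one, ENNReal.ofReal_lt_ofReal_iff one_pos]
    exact Real.rpow_lt_one_of_one_lt_of_neg one_lt_two (by linarith)
  set D : ℝ≥0∞ := C * ENNReal.ofReal ((2 : ℝ) ^ p) * M ^ γ with hD
  have hDtop : D ≠ ∞ := ENNReal.mul_ne_top (ENNReal.mul_ne_top hC ENNReal.ofReal_ne_top)
    (ENNReal.rpow_ne_top_of_nonneg hγ0.le hν)
  have hann : ∀ (k : ℕ) (t : ℝ), 0 < t →
      originScaled p (ν.restrict {x | (2 : ℝ) ^ k ≤ ‖x‖ ∧ ‖x‖ < 2 ^ (k + 1)}) t ≤ D * θ ^ k := by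
    intro k t ht
    have hset : MeasurableSet {x : Pt d | (2 : ℝ) ^ k ≤ ‖x‖ ∧ ‖x‖ < 2 ^ (k + 1)} :=
      (measurableSet_le measurable_const measurable_norm).inter
        (measurableSet_lt measurable_norm measurable_const)
    refine (hball (2 ^ (k + 1)) _ (by positivity)
      ((ae_restrict_mem hset).mono fun x hx => hx.2) t ht).trans ?_
    rw [Measure.restrict_apply_univ]
    have h1 : ν {x : Pt d | (2 : ℝ) ^ k ≤ ‖x‖ ∧ ‖x‖ < 2 ^ (k + 1)} ≤
        M * ENNReal.ofReal (((2 : ℝ) ^ k) ^ (-α)) :=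
      (measure_mono fun x hx => hx.1).trans (measure_le_norm_le hα0 ν (by positivity))
    calc _ ≤ C * ENNReal.ofReal (((2 : ℝ) ^ (k + 1)) ^ p) *
          (M * ENNReal.ofReal (((2 : ℝ) ^ k) ^ (-α))) ^ γ := by gcongr
      _ = D * (ENNReal.ofReal (((2 : ℝ) ^ k) ^ p) * ENNReal.ofReal ((((2 : ℝ) ^ k) ^ (-α)) ^ γ)) := by
          rw [ENNReal.mul_rpow_of_nonneg _ _ hγ0.le, ENNReal.ofReal_rpow_of_pos (by positivity),
            pow_succ, Real.mul_rpow (by positivity) (by positivity),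
            ENNReal.ofReal_mul (by positivity), hD]
          ring
      _ = D * θ ^ k := by
          rw [← ENNReal.ofReal_mul (by positivity), hθ, ← ENNReal.ofReal_pow (by positivity),
            ← Real.rpow_mul (by positivity), ← Real.rpow_add (by positivity),
            ← Real.rpow_natCast, ← Real.rpow_natCast, ← Real.rpow_mul (by positivity),
            ← Real.rpow_mul (by positivity)]
          congr 3
          ring
  have hsum : ∀ (k L : ℕ) (t : ℝ), 0 < t → originScaled p (ν.restrict {x | (2 : ℝ) ^ k ≤ ‖x‖}) t ≤
      (∑ j ∈ Finset.range L, D * θ ^ (k + j)) +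
        originScaled p (ν.restrict {x | (2 : ℝ) ^ (k + L) ≤ ‖x‖}) t := by
    intro k L t ht
    induction L with
    | zero => simp
    | succ L ih =>
      refine ih.trans ?_
      rw [Finset.sum_range_succ, add_assoc]
      refine add_le_add_right ?_ _
      rw [restrict_norm_ge_eq_add ν (s := 2 ^ (k + L)) (s' := 2 ^ (k + (L + 1)))
        (pow_le_pow_right₀ one_le_two (by omega))]
      exact (originScaled_add_le hp hp1 _ _ t).trans (add_le_add_left (hann (k + L) t ht) _)
  have htail : ∀ (k : ℕ) (t : ℝ), 0 < t →
      originScaled p (ν.restrict {x | (2 : ℝ) ^ k ≤ ‖x‖}) t ≤ D * (1 - θ)⁻¹ * θ ^ k := by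
    intro k t ht
    -- At fixed t the number L of annuli tends to infinity.
    have h1 := (tendsto_originScaled_tail hp hp1 hpt ht).comp (tendsto_add_atTop_nat k)
    have h2 := (tendsto_const_nhds (x := D * (1 - θ)⁻¹ * θ ^ k)).add h1
    rw [add_zero] at h2
    refine ge_of_tendsto' h2 fun L => (hsum k L t ht).trans ?_
    rw [Function.comp_apply, add_comm L k]
    refine add_le_add_left ?_ _
    rw [← Finset.mul_sum]
    simp_rw [pow_add]
    rw [← Finset.mul_sum, mul_right_comm D, mul_assoc D]
    gcongr
    rw [← ENNReal.tsum_geometric]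
    exact ENNReal.sum_le_tsum _
  have hlim : Tendsto (fun k : ℕ => D * (1 - θ)⁻¹ * θ ^ k) atTop (𝓝 0) := by
    have := ENNReal.Tendsto.const_mul (a := D * (1 - θ)⁻¹)
      (ENNReal.tendsto_pow_atTop_nhds_zero_of_lt_one hθ1)
      (Or.inr (ENNReal.mul_ne_top hDtop (ENNReal.inv_ne_top.2 (tsub_pos_of_lt hθ1).ne')))
    simpa using this
  obtain ⟨k, hk, hkR⟩ := ((hlim.eventually (ge_mem_nhds hε)).and
    ((tendsto_pow_atTop_atTop_of_one_lt (one_lt_two (α := ℝ))).eventually_ge_atTop R₀)).exists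
  exact ⟨2 ^ k, hkR, by positivity, fun t ht => (htail k t ht).trans hk⟩

end BipartiteMatching

namespace BipartiteMatching

variable {d : ℕ}

/-! ### Singular measures -/

theorem ofReal_rpow_half_div {γ t : ℝ} (ht : 0 < t) :
    ENNReal.ofReal t ^ (1 / 2 : ℝ) / ENNReal.ofReal (t ^ γ) =
      ENNReal.ofReal (t ^ (-(γ - 1 / 2))) := by
  rw [ENNReal.ofReal_rpow_of_pos ht, ← ENNReal.ofReal_div_of_pos (by positivity),
    ← Real.rpow_sub ht, neg_sub]

/-- The exit is first placed at `a`, where the ball bound sees only the small radius `s`; moving it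
to the origin costs the square root of the mass and vanishes as t grows. -/
theorem exists_originScaled_near_le {p : ℝ} (hp : 0 < p) (hp1 : p ≤ 1) (hpd : p < (d : ℝ) / 2) :
    ∃ C : ℝ≥0∞, C ≠ ∞ ∧ ∀ (a : Pt d) (s : ℝ) (H : ℝ≥0∞) (ν : Measure (Pt d)) [IsFiniteMeasure ν],
      0 < s → (∀ᵐ x ∂ν, ‖x - a‖ < s) → (∀ᵐ x ∂ν, pointCost p 0 x ≤ H) → ∀ t : ℝ, 0 < t →
      originScaled p ν t ≤ C * ENNReal.ofReal (s ^ p) * ν Set.univ ^ (1 - p / (d : ℝ)) +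
        H * (2 * ν Set.univ ^ (1 / 2 : ℝ)) *
          ENNReal.ofReal (t ^ (-(1 - p / (d : ℝ) - 1 / 2))) := by
  obtain ⟨C, hC, h⟩ := exists_originMean_ball_le hp hp1 hpd
  have hd : (0 : ℝ) < d := by linarith
  have hγ : 0 ≤ 1 - p / d := by
    rw [sub_nonneg, div_le_one hd]
    linarith
  refine ⟨C, hC, fun a s H ν _ hs hν hH t ht => ?_⟩
  obtain ⟨ν', _, hmap, huniv⟩ := exists_map_homothety_eq ν a one_pos
  have hν' : ∀ᵐ x ∂ν', ‖x‖ < s := by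
    rw [← hmap] at hν
    refine (ae_of_ae_map (measurable_homothety a 1).aemeasurable hν).mono fun x hx => ?_
    simpa [homothety] using hx
  have h1 : transportMean p (pointCost p a) (ENNReal.ofReal t • ν) ≤
      C * ENNReal.ofReal (s ^ p) * (ENNReal.ofReal (t ^ (1 - p / (d : ℝ))) *
        ν Set.univ ^ (1 - p / (d : ℝ))) := by
    rw [← hmap, ← Measure.map_smul, transportMean_homothety hp hp1 a one_pos, Real.one_rpow,
      ENNReal.ofReal_one, one_mul, hmap, ← huniv, ← ofReal_smul_univ_rpow hγ ht]
    exact h s (ENNReal.ofReal t • ν') hs (ae_ofReal_smul hν' t)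
  have h2 := (transportMean_change_exit (isExitCost_pointCost hp hp1 0).measurable
    (powDist_le_pointCost hp hp1 a) _ (ae_ofReal_smul hH t)).trans (add_le_add_left h1 _)
  have hne : ENNReal.ofReal (t ^ (1 - p / (d : ℝ))) ≠ 0 := by
    have : 0 < t ^ (1 - p / (d : ℝ)) := by positivity
    simpa using this
  refine (ENNReal.div_le_div_right h2 _).trans (le_of_eq ?_)
  rw [ENNReal.add_div, ← ofReal_rpow_half_div ht]
  congr 1
  · rw [mul_comm (ENNReal.ofReal (t ^ _)), ← mul_assoc,
      ENNReal.mul_div_cancel_right hne ENNReal.ofReal_ne_top]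
  · rw [ofReal_smul_univ, ENNReal.mul_rpow_of_nonneg _ _ (by norm_num), ← mul_div_assoc]
    congr 1
    ring

theorem finite_image_gridIndex {r : ℝ} (hr : 0 < r) {K : Set (Pt d)} {R : ℝ}
    (hK : ∀ x ∈ K, ‖x‖ ≤ R) : (gridIndex r '' K).Finite := by
  refine (Set.finite_Icc (fun _ : Fin d => ⌊-R / r⌋) fun _ => ⌊R / r⌋).subset ?_
  rintro _ ⟨x, hx, rfl⟩
  have h : ∀ i, |x i| ≤ R := fun i => (PiLp.norm_apply_le x i).trans (hK x hx)
  refine ⟨fun i => ?_, fun i => ?_⟩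
  · exact Int.floor_le_floor (div_le_div_of_nonneg_right (abs_le.1 (h i)).1 hr.le)
  · exact Int.floor_le_floor (div_le_div_of_nonneg_right (abs_le.1 (h i)).2 hr.le)

theorem volume_setOf_gridIndex_mem {r : ℝ} (hr : 0 < r) (Z : Finset (Fin d → ℤ)) :
    volume {x : Pt d | gridIndex r x ∈ Z} = Z.card * ENNReal.ofReal (r ^ d) := by
  have h : {x : Pt d | gridIndex r x ∈ Z} = ⋃ z ∈ Z, cell r z :=
    Set.ext fun x => by simp [cell]
  rw [h, measure_biUnion_finset (fun z _ w _ hzw => disjoint_cell hzw)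
    fun z _ => measurableSet_cell r z]
  simp [volume_cell hr]

theorem norm_sub_le_of_gridIndex_eq {r : ℝ} (hr : 0 < r) {x y : Pt d}
    (h : gridIndex r x = gridIndex r y) : ‖x - y‖ ≤ 2 * r * d := by
  have h1 : ‖x - corner r (gridIndex r y)‖ ≤ r * d := norm_le_of_mem_cell hr h
  have h2 : ‖y - corner r (gridIndex r y)‖ ≤ r * d := norm_le_of_mem_cell hr rfl
  have h3 := norm_sub_le (x - corner r (gridIndex r y)) (y - corner r (gridIndex r y))
  rw [sub_sub_sub_cancel_right] at h3
  linarith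

/-- With N cells of mesh r meeting K, concavity bounds the sum over cells by r^p N^(p/d) |ν|^(1-p/d)
= (N r^d)^(p/d) |ν|^(1-p/d), and N r^d is at most the volume of a neighbourhood of K. The constant
`B` may depend on K, r and ν, but not on t. -/
theorem exists_originScaled_compact_le {p : ℝ} (hp : 0 < p) (hp1 : p ≤ 1)
    (hpd : p < (d : ℝ) / 2) : ∃ C : ℝ≥0∞, C ≠ ∞ ∧ ∀ (K : Set (Pt d)) (r : ℝ)
      (ν : Measure (Pt d)) [IsFiniteMeasure ν], IsCompact K → (∀ᵐ x ∂ν, x ∈ K) → 0 < r →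
      ∃ B : ℝ≥0∞, B ≠ ∞ ∧ ∀ t : ℝ, 0 < t → originScaled p ν t ≤
        C * volume (Metric.cthickening (2 * r * d) K) ^ (p / d) *
          ν Set.univ ^ (1 - p / (d : ℝ)) +
        B * ENNReal.ofReal (t ^ (-(1 - p / (d : ℝ) - 1 / 2))) := by
  obtain ⟨C, hC, h⟩ := exists_originScaled_near_le hp hp1 hpd
  have hd : (0 : ℝ) < d := by linarith
  have hpd0 : 0 ≤ p / d := by positivity
  have hγ : 0 < 1 - p / d := by
    rw [sub_pos, div_lt_one hd]
    linarith
  refine ⟨C * ENNReal.ofReal (((d : ℝ) + 1) ^ p), ENNReal.mul_ne_top hC ENNReal.ofReal_ne_top,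
    fun K r ν _ hK hν hr => ?_⟩
  obtain ⟨R, hR⟩ := hK.isBounded.exists_norm_le
  have hfin := finite_image_gridIndex hr hR
  set Z := hfin.toFinset with hZdef
  have hZ : ∀ᵐ x ∂ν, gridIndex r x ∈ Z := hν.mono fun x hx =>
    hfin.mem_toFinset.2 (Set.mem_image_of_mem _ hx)
  set H : ℝ≥0∞ := ENNReal.ofReal (R ^ p) with hH
  have hHν : ∀ᵐ x ∂ν, pointCost p 0 x ≤ H := hν.mono fun x hx => by
    rw [pointCost_zero_eq hp]
    exact ENNReal.ofReal_le_ofReal (Real.rpow_le_rpow (norm_nonneg _) (hR x hx) hp.le)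
  set B : ℝ≥0∞ := ∑ z ∈ Z, H * (2 * (ν.restrict (cell r z)) Set.univ ^ (1 / 2 : ℝ)) with hB
  refine ⟨B, ?_, fun t ht => ?_⟩
  · refine ENNReal.sum_ne_top.2 fun z _ => ENNReal.mul_ne_top ENNReal.ofReal_ne_top
      (ENNReal.mul_ne_top (by simp) (ENNReal.rpow_ne_top_of_nonneg (by norm_num)
        (measure_ne_top _ _)))
  · have hsum : originScaled p ν t ≤ ∑ z ∈ Z, originScaled p (ν.restrict (cell r z)) t := by
      conv_lhs => rw [eq_sum_restrict_cell hZ]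
      unfold originScaled scaledMean
      simp_rw [div_eq_mul_inv]
      rw [Finset.smul_sum, ← Finset.sum_mul]
      gcongr
      exact transportMean_sum_le (isExitCost_pointCost hp hp1 0).measurable _ _
    have hs : 0 < r * (d + 1) := by positivity
    have hcell : ∀ z ∈ Z, originScaled p (ν.restrict (cell r z)) t ≤
        C * ENNReal.ofReal ((r * (d + 1)) ^ p) *
          (ν.restrict (cell r z)) Set.univ ^ (1 - p / (d : ℝ)) +
        H * (2 * (ν.restrict (cell r z)) Set.univ ^ (1 / 2 : ℝ)) *
          ENNReal.ofReal (t ^ (-(1 - p / (d : ℝ) - 1 / 2))) := fun z _ =>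
      h (corner r z) (r * (d + 1)) H _ hs
        ((ae_restrict_mem (measurableSet_cell r z)).mono fun x hx =>
          (norm_le_of_mem_cell hr hx).trans_lt (by gcongr; linarith))
        (ae_restrict_of_ae hHν) t ht
    refine hsum.trans ((Finset.sum_le_sum hcell).trans ?_)
    rw [Finset.sum_add_distrib, ← Finset.sum_mul, ← Finset.mul_sum]
    refine add_le_add_left ?_ _
    have hpow := sum_rpow_le Z (fun z => (ν.restrict (cell r z)) Set.univ) hγ
      (by linarith : 1 - p / (d : ℝ) ≤ 1)
    rw [sum_restrict_univ hZ, sub_sub_cancel] at hpow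
    have hvol : (Z.card : ℝ≥0∞) * ENNReal.ofReal (r ^ d) ≤
        volume (Metric.cthickening (2 * r * d) K) := by
      rw [← volume_setOf_gridIndex_mem hr]
      refine measure_mono fun x hx => ?_
      obtain ⟨y, hy, hyx⟩ := hfin.mem_toFinset.1 hx
      refine Metric.mem_cthickening_of_dist_le x y _ _ hy ?_
      rw [dist_eq_norm]
      exact norm_sub_le_of_gridIndex_eq hr hyx.symm
    calc C * ENNReal.ofReal ((r * (d + 1)) ^ p) *
          ∑ z ∈ Z, (ν.restrict (cell r z)) Set.univ ^ (1 - p / (d : ℝ))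
        ≤ C * ENNReal.ofReal ((r * (d + 1)) ^ p) *
          ((Z.card : ℝ≥0∞) ^ (p / d) * ν Set.univ ^ (1 - p / (d : ℝ))) := by gcongr
      _ = C * ENNReal.ofReal (((d : ℝ) + 1) ^ p) *
          ((Z.card : ℝ≥0∞) * ENNReal.ofReal (r ^ d)) ^ (p / d) *
          ν Set.univ ^ (1 - p / (d : ℝ)) := by
          rw [ENNReal.mul_rpow_of_nonneg _ _ hpd0, ENNReal.ofReal_rpow_of_pos (by positivity),
            ← Real.rpow_natCast, ← Real.rpow_mul hr.le, mul_div_cancel₀ _ hd.ne',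
            Real.mul_rpow hr.le (by positivity), ENNReal.ofReal_mul (by positivity)]
          ring
      _ ≤ _ := by gcongr

theorem eventually_const_mul_rpow_neg_le {B ε : ℝ≥0∞} (hB : B ≠ ∞) (hε : 0 < ε) {δ : ℝ}
    (hδ : 0 < δ) : ∀ᶠ t : ℝ in atTop, B * ENNReal.ofReal (t ^ (-δ)) ≤ ε := by
  have h := ENNReal.Tendsto.const_mul (a := B) (ENNReal.tendsto_ofReal (tendsto_rpow_neg_atTop hδ))
    (Or.inr hB)
  rw [ENNReal.ofReal_zero, mul_zero] at h
  exact h.eventually (ge_mem_nhds hε)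

theorem exists_pos_const_mul_rpow_le {B ε : ℝ≥0∞} (hB : B ≠ ∞) (hε : 0 < ε) {γ : ℝ}
    (hγ : 0 < γ) : ∃ η : ℝ≥0∞, 0 < η ∧ ∀ m ≤ η, B * m ^ γ ≤ ε := by
  have h : Tendsto (fun m : ℝ≥0∞ => B * m ^ γ) (𝓝 0) (𝓝 0) := by
    have := ENNReal.Tendsto.const_mul (a := B) ((ENNReal.continuous_rpow_const (y := γ)).tendsto 0)
      (Or.inr hB)
    simpa [ENNReal.zero_rpow_of_pos hγ] using this
  obtain ⟨η, hη, hη'⟩ := ENNReal.nhds_zero_basis_Iic.eventually_iff.1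
    (h.eventually (ge_mem_nhds hε))
  exact ⟨η, hη, fun m hm => hη' hm⟩

/-- A Lebesgue-null set carries ν, and it contains a compact K with ν(Kᶜ) small. The part outside K
is handled by the ball bound; for the part on K the mesh is chosen so small that the neighbourhood
of K has small volume. -/
theorem eventually_originScaled_le_of_ball {p : ℝ} (hp : 0 < p) (hp1 : p ≤ 1)
    (hpd : p < (d : ℝ) / 2) {ν : Measure (Pt d)} [IsFiniteMeasure ν] (hν : ν ⟂ₘ volume) {R : ℝ}
    (hR : 0 < R) (hνR : ∀ᵐ x ∂ν, ‖x‖ < R) {ε : ℝ≥0∞} (hε : 0 < ε) :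
    ∀ᶠ t : ℝ in atTop, originScaled p ν t ≤ ε := by
  obtain ⟨C, hC, hball⟩ := exists_originScaled_ball_le hp hp1 hpd
  obtain ⟨C', hC', hcomp⟩ := exists_originScaled_compact_le hp hp1 hpd
  have hd : (0 : ℝ) < d := by linarith
  have hpd0 : 0 < p / d := by positivity
  have hpd' : p / d < 1 / 2 := by
    rw [div_lt_iff₀ hd]
    linarith
  have hε3 : 0 < ε / 3 := ENNReal.div_pos hε.ne' (by simp)
  obtain ⟨η, hη, hη'⟩ := exists_pos_const_mul_rpow_le (B := C * ENNReal.ofReal (R ^ p))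
    (ENNReal.mul_ne_top hC ENNReal.ofReal_ne_top) hε3 (γ := 1 - p / d) (by linarith)
  obtain ⟨A, hA, hνA, hvolA⟩ := hν
  obtain ⟨K, hKA, hK, hKη⟩ := hA.compl.exists_isCompact_sdiff_lt (measure_ne_top ν _) hη.ne'
  have hvolK : volume K = 0 := measure_mono_null hKA hvolA
  have hνK : ν Kᶜ ≤ η := by
    have hsub : Kᶜ ⊆ A ∪ Aᶜ \ K := fun x hx => by
      by_cases hxA : x ∈ A
      · exact Or.inl hxA
      · exact Or.inr ⟨hxA, hx⟩
    refine (measure_mono hsub).trans ((measure_union_le _ _).trans ?_)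
    rw [hνA, zero_add]
    exact hKη.le
  obtain ⟨ρ, hρ, hρ'⟩ := exists_pos_const_mul_rpow_le (B := C' * ν Set.univ ^ (1 - p / (d : ℝ)))
    (ENNReal.mul_ne_top hC' (ENNReal.rpow_ne_top_of_nonneg (by linarith) (measure_ne_top _ _)))
    hε3 hpd0
  -- For compact K the volumes of the closed neighbourhoods decrease to the volume of K, which is
  -- zero.
  have hthick : Tendsto (fun r : ℝ => volume (Metric.cthickening (2 * r * d) K)) (𝓝 0) (𝓝 0) := by
    have h := tendsto_measure_cthickening_of_isCompact (μ := (volume : Measure (Pt d))) hK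
    rw [hvolK] at h
    refine h.comp ?_
    have : Continuous fun r : ℝ => 2 * r * d := by fun_prop
    simpa using this.tendsto 0
  obtain ⟨r, hr, hr0⟩ := ((hthick.eventually (ge_mem_nhds hρ)).filter_mono
    (nhdsWithin_le_nhds (s := Set.Ioi 0)) |>.and self_mem_nhdsWithin).exists
  obtain ⟨B, hB, hBt⟩ := hcomp K r (ν.restrict K) hK
    (ae_restrict_mem hK.measurableSet) hr0
  filter_upwards [eventually_const_mul_rpow_neg_le hB hε3
    (δ := 1 - p / d - 1 / 2) (by linarith), eventually_gt_atTop 0] with t htB ht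
  calc originScaled p ν t = originScaled p (ν.restrict K + ν.restrict Kᶜ) t := by
        rw [Measure.restrict_add_restrict_compl hK.measurableSet]
    _ ≤ originScaled p (ν.restrict K) t + originScaled p (ν.restrict Kᶜ) t :=
        originScaled_add_le hp hp1 _ _ t
    _ ≤ (ε / 3 + ε / 3) + ε / 3 := by
        refine add_le_add ((hBt t ht).trans (add_le_add ?_ htB)) ?_
        · refine le_trans ?_ (hρ' _ hr)
          rw [mul_right_comm]
          gcongr
          · linarith
          · exact Measure.restrict_le_self
        · refine (hball R _ hR (ae_restrict_of_ae hνR) t ht).trans (hη' _ ?_)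
          rwa [Measure.restrict_apply_univ]
    _ = ε := ENNReal.add_thirds ε

theorem eventually_originScaled_le_of_mutuallySingular {p α : ℝ} (hp : 0 < p) (hp1 : p ≤ 1)
    (hpd : p < (d : ℝ) / 2) (hα : p < α * (1 - p / (d : ℝ))) {ν : Measure (Pt d)}
    [IsFiniteMeasure ν] (hν : ν ⟂ₘ volume) (hνα : ∫⁻ x, ENNReal.ofReal (‖x‖ ^ α) ∂ν ≠ ∞)
    {ε : ℝ≥0∞} (hε : 0 < ε) : ∀ᶠ t : ℝ in atTop, originScaled p ν t ≤ ε := by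
  have hε2 : 0 < ε / 2 := ENNReal.div_pos hε.ne' (by simp)
  obtain ⟨R, -, hR, htail⟩ := exists_tail_le hp hp1 hpd hα hνα hε2 0
  have hset : MeasurableSet {x : Pt d | R ≤ ‖x‖} := measurableSet_le measurable_const measurable_norm
  have hball : ∀ᵐ x ∂ν.restrict {x | R ≤ ‖x‖}ᶜ, ‖x‖ < R :=
    (ae_restrict_mem hset.compl).mono fun x hx => not_le.1 hx
  filter_upwards [eventually_originScaled_le_of_ball hp hp1 hpd
    (hν.restrict {x | R ≤ ‖x‖}ᶜ) hR hball hε2, eventually_gt_atTop 0] with t h1 ht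
  calc originScaled p ν t
      = originScaled p (ν.restrict {x | R ≤ ‖x‖} + ν.restrict {x | R ≤ ‖x‖}ᶜ) t := by
        rw [Measure.restrict_add_restrict_compl hset]
    _ ≤ ε / 2 + ε / 2 :=
        (originScaled_add_le hp hp1 _ _ t).trans (add_le_add (htail t ht) h1)
    _ = ε := ENNReal.add_halves ε

end BipartiteMatching

namespace BipartiteMatching

variable {d : ℕ}

/-! ### Step densities -/

theorem tendsto_of_le_add_of_le_add {u A e : ℝ → ℝ≥0∞} {l : ℝ≥0∞} (hA : Tendsto A atTop (𝓝 l))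
    (he : Tendsto e atTop (𝓝 0)) (h1 : ∀ᶠ t in atTop, u t ≤ A t + e t)
    (h2 : ∀ᶠ t in atTop, A t ≤ u t + e t) : Tendsto u atTop (𝓝 l) := by
  have hlow : Tendsto (fun t => A t - e t) atTop (𝓝 l) := by
    simpa using ENNReal.Tendsto.sub hA he (Or.inr ENNReal.zero_ne_top)
  have hup : Tendsto (fun t => A t + e t) atTop (𝓝 l) := by
    simpa using hA.add he
  exact tendsto_of_tendsto_of_tendsto_of_le_of_le' hlow hup
    (h2.mono fun t ht => tsub_le_iff_right.2 ht) h1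

theorem tendsto_const_mul_rpow_neg {B : ℝ≥0∞} (hB : B ≠ ∞) {δ : ℝ} (hδ : 0 < δ) :
    Tendsto (fun t : ℝ => B * ENNReal.ofReal (t ^ (-δ))) atTop (𝓝 0) := by
  have h := ENNReal.Tendsto.const_mul (a := B) (ENNReal.tendsto_ofReal (tendsto_rpow_neg_atTop hδ))
    (Or.inr hB)
  rwa [ENNReal.ofReal_zero, mul_zero] at h

theorem pointCost_homothety {p : ℝ} (hp : 0 < p) (a : Pt d) {r : ℝ} (hr : 0 < r) (x : Pt d) :
    pointCost p a (homothety a r x) = ENNReal.ofReal (r ^ p) * pointCost p 0 x := by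
  have h : homothety a r 0 = a := by simp [homothety]
  conv_lhs => rw [pointCost, ← congrArg (powDist p (homothety a r x)) h]
  exact powDist_homothety hp a hr x 0

theorem transportMean_ofReal_mul_div {p : ℝ} {h : Pt d → ℝ≥0∞} {ν : Measure (Pt d)} {κ t : ℝ}
    (hκ : 0 < κ) (ht : 0 < t) :
    transportMean p h (ENNReal.ofReal (t * κ) • ν) / ENNReal.ofReal (t ^ (1 - p / (d : ℝ))) =
      ENNReal.ofReal (κ ^ (1 - p / (d : ℝ))) * scaledMean p h ν (t * κ) := by
  have hne : ENNReal.ofReal (κ ^ (1 - p / (d : ℝ))) ≠ 0 := by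
    have : 0 < κ ^ (1 - p / (d : ℝ)) := by positivity
    simpa using this
  rw [scaledMean, Real.mul_rpow ht.le hκ.le, mul_comm (t ^ _),
    ENNReal.ofReal_mul (p := κ ^ (1 - p / (d : ℝ))) (by positivity),
    ← mul_div_assoc, ENNReal.mul_div_mul_left _ _ hne ENNReal.ofReal_ne_top]

theorem tendsto_rescaled {p : ℝ} {h : Pt d → ℝ≥0∞} {ν : Measure (Pt d)} {L : ℝ≥0∞}
    (hL : Tendsto (scaledMean p h ν) atTop (𝓝 L)) {κ : ℝ} (hκ : 0 < κ) (ρ : ℝ) :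
    Tendsto (fun t : ℝ => ENNReal.ofReal ρ *
      (ENNReal.ofReal (κ ^ (1 - p / (d : ℝ))) * scaledMean p h ν (t * κ))) atTop
      (𝓝 (ENNReal.ofReal ρ * (ENNReal.ofReal (κ ^ (1 - p / (d : ℝ))) * L))) := by
  have h1 := hL.comp (tendsto_id.atTop_mul_const hκ)
  exact ENNReal.Tendsto.const_mul (ENNReal.Tendsto.const_mul h1 (Or.inr ENNReal.ofReal_ne_top))
    (Or.inr ENNReal.ofReal_ne_top)

/-- Exact scaling holds with the exit at `a`, and both comparisons with the exit at the origin cost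
O(√t). The constant `D` bounds the distance, to the power p, from the image of the cell to `a` and
to the origin. -/
theorem tendsto_originScaled_homothety {p : ℝ} (hp : 0 < p) (hp1 : p ≤ 1)
    (hpd : p < (d : ℝ) / 2) {L : ℝ≥0∞}
    (hL : Tendsto (scaledMean p (pointCost p 0) (unitMeasure d)) atTop (𝓝 L)) (a : Pt d) {r : ℝ}
    (hr : 0 < r) {κ : ℝ} (hκ : 0 ≤ κ) :
    Tendsto (originScaled p (ENNReal.ofReal κ • (unitMeasure d).map (homothety a r))) atTop
      (𝓝 (ENNReal.ofReal (r ^ p) * (ENNReal.ofReal (κ ^ (1 - p / (d : ℝ))) * L))) := by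
  have hd : (0 : ℝ) < d := by linarith
  have hpd' : p / d < 1 / 2 := by
    rw [div_lt_iff₀ hd]
    linarith
  have hmeas : Measurable (pointCost (d := d) p 0) := (isExitCost_pointCost hp hp1 0).measurable
  -- For κ = 0 the argument t κ does not tend to infinity; both sides vanish.
  rcases hκ.eq_or_lt with rfl | hκ
  · have h0 : originScaled p (ENNReal.ofReal 0 • (unitMeasure d).map (homothety a r)) =
        fun _ => 0 := by
      funext t
      rw [originScaled, scaledMean, ENNReal.ofReal_zero, zero_smul, smul_zero,
        transportMean_zero hmeas, ENNReal.zero_div]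
    rw [h0, Real.zero_rpow (by linarith), ENNReal.ofReal_zero, zero_mul, mul_zero]
    exact tendsto_const_nhds
  set D : ℝ≥0∞ := ENNReal.ofReal (r ^ p) * ENNReal.ofReal ((d : ℝ) ^ p) + pointCost p 0 a with hD
  have hDtop : D ≠ ∞ := by
    rw [hD, pointCost_zero_eq hp]
    exact ENNReal.add_ne_top.2 ⟨ENNReal.mul_ne_top ENNReal.ofReal_ne_top ENNReal.ofReal_ne_top,
      ENNReal.ofReal_ne_top⟩
  have hDa : ∀ᵐ x ∂unitMeasure d, pointCost p a (homothety a r x) + pointCost p 0 a ≤ D :=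
    ae_unitMeasure.mono fun x hx => by
      rw [pointCost_homothety hp a hr, hD]
      gcongr
      exact pointCost_zero_le_of_mem_unitCell hp hx
  set B : ℝ≥0∞ := D * (2 * ENNReal.ofReal κ ^ (1 / 2 : ℝ)) with hB
  have hBtop : B ≠ ∞ := ENNReal.mul_ne_top hDtop (ENNReal.mul_ne_top (by simp)
    (ENNReal.rpow_ne_top_of_nonneg (by norm_num) ENNReal.ofReal_ne_top))
  have hmap : ∀ t : ℝ, 0 ≤ t →
      ENNReal.ofReal t • ENNReal.ofReal κ • (unitMeasure d).map (homothety a r) =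
        (ENNReal.ofReal (t * κ) • unitMeasure d).map (homothety a r) := by
    intro t ht
    rw [smul_smul, ← ENNReal.ofReal_mul ht, Measure.map_smul]
  have herr : ∀ t : ℝ, 0 < t →
      D * (2 * (ENNReal.ofReal (t * κ) • unitMeasure d) Set.univ ^ (1 / 2 : ℝ)) /
        ENNReal.ofReal (t ^ (1 - p / (d : ℝ))) =
      B * ENNReal.ofReal (t ^ (-(1 - p / (d : ℝ) - 1 / 2))) := by
    intro t ht
    rw [← ofReal_rpow_half_div ht, ofReal_smul_univ, measure_univ, mul_one,
      ENNReal.ofReal_mul ht.le, ENNReal.mul_rpow_of_nonneg _ _ (by norm_num), hB, ← mul_div_assoc]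
    congr 1
    ring
  refine tendsto_of_le_add_of_le_add (tendsto_rescaled hL hκ (r ^ p))
    (tendsto_const_mul_rpow_neg hBtop (δ := 1 - p / d - 1 / 2) (by linarith)) ?_ ?_
  · filter_upwards [eventually_gt_atTop 0] with t ht
    rw [← herr t ht, ← transportMean_ofReal_mul_div hκ ht, originScaled, scaledMean, hmap t ht.le,
      ← mul_div_assoc, ← ENNReal.add_div]
    refine ENNReal.div_le_div_right (transportMean_homothety_le hp hp1 a hr _ ?_) _
    refine (ae_map_iff (measurable_homothety _ _).aemeasurable
      (p := fun x => pointCost p 0 x ≤ D) (measurableSet_le hmeas measurable_const)).2 ?_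
    exact ae_ofReal_smul (hDa.mono fun x hx =>
      (powDist_triangle hp hp1 (homothety a r x) a 0).trans hx) _
  · filter_upwards [eventually_gt_atTop 0] with t ht
    rw [← herr t ht, ← transportMean_ofReal_mul_div hκ ht, originScaled, scaledMean, hmap t ht.le,
      ← mul_div_assoc, ← ENNReal.add_div]
    refine ENNReal.div_le_div_right (le_transportMean_homothety hp hp1 a hr _ ?_) _
    refine (ae_map_iff (measurable_homothety _ _).aemeasurable
      (p := fun x => pointCost p a x ≤ D)
      (measurableSet_le (isExitCost_pointCost hp hp1 a).measurable measurable_const)).2 ?_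
    exact ae_ofReal_smul (hDa.mono fun x hx => le_self_add.trans hx) _

/-- The measure with a constant density on each cell of a grid. -/
noncomputable def stepMeasure (r : ℝ) (Z : Finset (Fin d → ℤ)) (κ : (Fin d → ℤ) → ℝ) :
    Measure (Pt d) :=
  ∑ z ∈ Z, ENNReal.ofReal (κ z) • (unitMeasure d).map (homothety (corner r z) r)

instance isFiniteMeasure_stepMeasure (r : ℝ) (Z : Finset (Fin d → ℤ)) (κ : (Fin d → ℤ) → ℝ) :
    IsFiniteMeasure (stepMeasure r Z κ) := by
  unfold stepMeasure
  infer_instance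

theorem ofReal_smul_stepMeasure (r : ℝ) (Z : Finset (Fin d → ℤ)) (κ : (Fin d → ℤ) → ℝ) {t : ℝ}
    (ht : 0 ≤ t) : ENNReal.ofReal t • stepMeasure r Z κ =
      ∑ z ∈ Z, (ENNReal.ofReal (t * κ z) • unitMeasure d).map (homothety (corner r z) r) := by
  rw [stepMeasure, Finset.smul_sum]
  refine Finset.sum_congr rfl fun z _ => ?_
  rw [smul_smul, ← ENNReal.ofReal_mul ht, Measure.map_smul]

theorem limsup_originScaled_stepMeasure_le {p : ℝ} (hp : 0 < p) (hp1 : p ≤ 1)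
    (hpd : p < (d : ℝ) / 2) {L : ℝ≥0∞}
    (hL : Tendsto (scaledMean p (pointCost p 0) (unitMeasure d)) atTop (𝓝 L)) {r : ℝ}
    (hr : 0 < r) (Z : Finset (Fin d → ℤ)) {κ : (Fin d → ℤ) → ℝ} (hκ : ∀ z, 0 ≤ κ z) :
    limsup (originScaled p (stepMeasure r Z κ)) atTop ≤
      L * ∑ z ∈ Z, ENNReal.ofReal (r ^ p) * ENNReal.ofReal (κ z ^ (1 - p / (d : ℝ))) := by
  have hlim : Tendsto (fun t => ∑ z ∈ Z, originScaled p
      (ENNReal.ofReal (κ z) • (unitMeasure d).map (homothety (corner r z) r)) t) atTop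
      (𝓝 (∑ z ∈ Z, ENNReal.ofReal (r ^ p) * (ENNReal.ofReal (κ z ^ (1 - p / (d : ℝ))) * L))) :=
    tendsto_finsetSum _ fun z _ =>
      tendsto_originScaled_homothety hp hp1 hpd hL (corner r z) hr (hκ z)
  rw [Finset.mul_sum]
  refine (limsup_le_limsup (Eventually.of_forall fun t => ?_)).trans
    (hlim.limsup_eq.le.trans (le_of_eq (Finset.sum_congr rfl fun z _ => by ring)))
  unfold originScaled scaledMean
  simp_rw [div_eq_mul_inv]
  rw [← Finset.sum_mul, stepMeasure, Finset.smul_sum]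
  gcongr
  exact transportMean_sum_le (isExitCost_pointCost hp hp1 0).measurable _ _

/-- The origin price is lowered to the grid price, for which the cost is superadditive over the
cells; each cell then contributes a rescaled boundary cost. -/
theorem le_liminf_originScaled_stepMeasure {p : ℝ} (hp : 0 < p) (hp1 : p ≤ 1)
    (hpd : p < (d : ℝ) / 2) {L : ℝ≥0∞}
    (hL : Tendsto (scaledMean p (boundaryCost p) (unitMeasure d)) atTop (𝓝 L)) {r : ℝ}
    (hr : 0 < r) (Z : Finset (Fin d → ℤ)) {κ : (Fin d → ℤ) → ℝ} (hκ : ∀ z, 0 ≤ κ z) :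
    L * ∑ z ∈ Z, ENNReal.ofReal (r ^ p) * ENNReal.ofReal (κ z ^ (1 - p / (d : ℝ))) ≤
      liminf (originScaled p (stepMeasure r Z κ)) atTop := by
  have hd' : (0 : ℝ) < d := by linarith
  have hd : 0 < d := by exact_mod_cast hd'
  have hpd' : p / d < 1 / 2 := by
    rw [div_lt_iff₀ hd']
    linarith
  have hterm : ∀ z ∈ Z, Tendsto (fun t : ℝ => ENNReal.ofReal (r ^ p) *
      (transportMean p (boundaryCost p) (ENNReal.ofReal (t * κ z) • unitMeasure d) /
        ENNReal.ofReal (t ^ (1 - p / (d : ℝ))))) atTop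
      (𝓝 (ENNReal.ofReal (r ^ p) * (ENNReal.ofReal (κ z ^ (1 - p / (d : ℝ))) * L))) := by
    intro z _
    rcases (hκ z).eq_or_lt with h0 | h0
    · rw [← h0, Real.zero_rpow (by linarith)]
      simp [transportMean_zero (measurable_boundaryCost p)]
    · refine (tendsto_rescaled hL h0 (r ^ p)).congr' ?_
      filter_upwards [eventually_gt_atTop 0] with t ht
      rw [transportMean_ofReal_mul_div h0 ht]
  have hlim := tendsto_finsetSum Z hterm
  rw [Finset.mul_sum]
  refine le_trans (le_of_eq ?_) (hlim.liminf_eq.symm.le.trans (liminf_le_liminf ?_))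
  · exact Finset.sum_congr rfl fun z _ => by ring
  · filter_upwards [eventually_gt_atTop 0] with t ht
    simp_rw [← mul_div_assoc, div_eq_mul_inv]
    rw [← Finset.sum_mul, originScaled, scaledMean, div_eq_mul_inv]
    refine mul_le_mul' ?_ le_rfl
    refine le_trans ?_ (transportMean_mono_exit (h := gridCost p r)
      (Filter.Eventually.of_forall fun x => gridCost_le_pointCost hd hp hr x))
    rw [ofReal_smul_stepMeasure r Z κ ht.le]
    refine le_trans (Finset.sum_le_sum fun z _ =>
      (transportMean_gridCost_map hp hr (t * κ z) z).ge) ?_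
    refine sum_transportMean_le (measurable_gridCost p r) _ _ (fun z => cell r z) (fun z _ => ?_)
      (fun z _ w _ hzw => disjoint_cell hzw)
      fun z _ w _ hzw x hx y hy => gridCost_add_le hp hp1 hr hzw hx hy
    exact (ae_map_iff (measurable_homothety _ _).aemeasurable
      (p := fun x => x ∈ cell r z) (measurableSet_cell _ _)).2 <|
      ae_ofReal_smul (ae_unitMeasure.mono fun x hx => (homothety_mem_cell hr).2 hx) _

end BipartiteMatching

namespace BipartiteMatching

variable {d : ℕ}

/-! ### Approximation of densities by step densities -/

/-- The function with value `g z` on the cell `z` for `z ∈ Z`, and zero elsewhere. -/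
noncomputable def stepDensity (r : ℝ) (Z : Finset (Fin d → ℤ)) (g : (Fin d → ℤ) → ℝ) (x : Pt d) :
    ℝ≥0∞ := by
  classical exact if gridIndex r x ∈ Z then ENNReal.ofReal (g (gridIndex r x)) else 0

theorem stepDensity_of_mem {r : ℝ} {Z : Finset (Fin d → ℤ)} {g : (Fin d → ℤ) → ℝ} {x : Pt d}
    (h : gridIndex r x ∈ Z) : stepDensity r Z g x = ENNReal.ofReal (g (gridIndex r x)) := if_pos h

theorem stepDensity_of_notMem {r : ℝ} {Z : Finset (Fin d → ℤ)} {g : (Fin d → ℤ) → ℝ} {x : Pt d}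
    (h : gridIndex r x ∉ Z) : stepDensity r Z g x = 0 := if_neg h

theorem measurable_stepDensity (r : ℝ) (Z : Finset (Fin d → ℤ)) (g : (Fin d → ℤ) → ℝ) :
    Measurable (stepDensity r Z g) := by
  classical
  exact (measurable_of_countable fun z : Fin d → ℤ =>
    if z ∈ Z then ENNReal.ofReal (g z) else 0).comp (measurable_gridIndex r)

theorem withDensity_stepDensity {r : ℝ} (hr : 0 < r) (Z : Finset (Fin d → ℤ))
    (g : (Fin d → ℤ) → ℝ) :
    volume.withDensity (stepDensity r Z g) = stepMeasure r Z fun z => r ^ d * g z := by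
  have hZ : ∀ᵐ x ∂volume.withDensity (stepDensity r Z g), gridIndex r x ∈ Z := by
    rw [ae_withDensity_iff (measurable_stepDensity r Z g)]
    exact Eventually.of_forall fun x hx => by
      by_contra h
      exact hx (stepDensity_of_notMem h)
  rw [eq_sum_restrict_cell hZ, stepMeasure]
  refine Finset.sum_congr rfl fun z hz => ?_
  have h1 : stepDensity r Z g =ᵐ[volume.restrict (cell r z)] fun _ => ENNReal.ofReal (g z) :=
    (ae_restrict_mem (measurableSet_cell r z)).mono fun x hx => by
      have hx' : gridIndex r x = z := hx
      rw [stepDensity_of_mem (hx' ▸ hz), hx']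
  rw [restrict_withDensity (measurableSet_cell r z), withDensity_congr_ae h1, withDensity_const,
    restrict_cell_eq hr, smul_smul, mul_comm, ← ENNReal.ofReal_mul (by positivity)]

theorem lintegral_stepDensity {r : ℝ} (hr : 0 < r) (Z : Finset (Fin d → ℤ))
    (g : (Fin d → ℤ) → ℝ) :
    ∫⁻ x, stepDensity r Z g x = ∑ z ∈ Z, ENNReal.ofReal (r ^ d * g z) := by
  have h := congrArg (fun ν => ν Set.univ) (withDensity_stepDensity hr Z g)
  simp only [withDensity_apply _ MeasurableSet.univ, Measure.restrict_univ, stepMeasure,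
    Measure.finsetSum_apply, Measure.smul_apply,
    Measure.map_apply (measurable_homothety _ _) MeasurableSet.univ, Set.preimage_univ,
    measure_univ, smul_eq_mul, mul_one] at h
  exact h

theorem lintegral_stepDensity_rpow (hd : 0 < d) {p : ℝ} (hγ : 0 < 1 - p / (d : ℝ)) {r : ℝ}
    (hr : 0 < r) (Z : Finset (Fin d → ℤ)) {g : (Fin d → ℤ) → ℝ} (hg : ∀ z, 0 ≤ g z) :
    ∫⁻ x, stepDensity r Z g x ^ (1 - p / (d : ℝ)) =
      ∑ z ∈ Z, ENNReal.ofReal (r ^ p) * ENNReal.ofReal ((r ^ d * g z) ^ (1 - p / (d : ℝ))) := by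
  have hd' : (d : ℝ) ≠ 0 := by positivity
  have h1 : ∀ x, stepDensity r Z g x ^ (1 - p / (d : ℝ)) =
      stepDensity r Z (fun z => g z ^ (1 - p / (d : ℝ))) x := by
    intro x
    by_cases hx : gridIndex r x ∈ Z
    · rw [stepDensity_of_mem hx, stepDensity_of_mem hx,
        ENNReal.ofReal_rpow_of_nonneg (hg _) hγ.le]
    · rw [stepDensity_of_notMem hx, stepDensity_of_notMem hx, ENNReal.zero_rpow_of_pos hγ]
  simp_rw [h1]
  rw [lintegral_stepDensity hr]
  refine Finset.sum_congr rfl fun z _ => ?_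
  rw [← ENNReal.ofReal_mul (by positivity), Real.mul_rpow (by positivity) (hg z), ← mul_assoc]
  congr 2
  rw [← Real.rpow_natCast, ← Real.rpow_mul hr.le, ← Real.rpow_add hr]
  congr 1
  field_simp
  ring

/-- A continuous compactly supported φ close to `f` in L¹ is sampled at the corners of the cells,
and the positive part is taken; since f ≥ 0, the positive part brings the values no farther from
`f`. -/
theorem exists_stepDensity_approx {f : Pt d → ℝ≥0∞} (hf : Measurable f) (hfi : ∫⁻ x, f x ≠ ∞)
    {R : ℝ} (hfR : ∀ x, R ≤ ‖x‖ → f x = 0) {ε : ℝ≥0∞} (hε : 0 < ε) :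
    ∃ (r : ℝ) (Z : Finset (Fin d → ℤ)) (g : (Fin d → ℤ) → ℝ), 0 < r ∧ (∀ z, 0 ≤ g z) ∧
      (∀ x, R + 1 ≤ ‖x‖ → stepDensity r Z g x = 0) ∧
      ∫⁻ x, (f x - stepDensity r Z g x) ≤ ε ∧ ∫⁻ x, (stepDensity r Z g x - f x) ≤ ε := by
  have hF : Integrable (fun x => (f x).toReal) volume :=
    integrable_toReal_of_lintegral_ne_top hf.aemeasurable hfi
  have hε2 : 0 < ε / 2 := ENNReal.div_pos hε.ne' (by simp)
  obtain ⟨φ, hφc, hφε, hφ, -⟩ := hF.exists_hasCompactSupport_lintegral_sub_le hε2.ne'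
  obtain ⟨η, hη, hη'⟩ := exists_pos_const_mul_rpow_le
    (B := volume (Metric.ball (0 : Pt d) (R + 1))) measure_ball_lt_top.ne hε2 (γ := 1) one_pos
  obtain ⟨η₁, hη₁0, hη₁⟩ := ENNReal.lt_iff_exists_real_btwn.1 hη
  have hη₁pos : 0 < η₁ := by
    have := hη₁.1
    rwa [ENNReal.ofReal_pos] at this
  have huc := hφc.uniformContinuous_of_continuous hφ
  obtain ⟨δ, hδ, hδ'⟩ := Metric.uniformContinuous_iff.1 huc η₁ hη₁pos
  -- The first condition puts the corner within the modulus of continuity of φ; the second keeps the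
  -- cells meeting the ball of radius R inside the ball of radius R + 1.
  obtain ⟨r, hr, hr1, hr2⟩ : ∃ r : ℝ, 0 < r ∧ r * d < δ ∧ 2 * r * d < 1 := by
    have h1 : Tendsto (fun r : ℝ => r * d) (𝓝[>] 0) (𝓝 0) := by
      have : Continuous fun r : ℝ => r * d := by fun_prop
      simpa using (this.tendsto 0).mono_left nhdsWithin_le_nhds
    have h2 : Tendsto (fun r : ℝ => 2 * r * d) (𝓝[>] 0) (𝓝 0) := by
      have : Continuous fun r : ℝ => 2 * r * d := by fun_prop
      simpa using (this.tendsto 0).mono_left nhdsWithin_le_nhds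
    obtain ⟨r, ⟨ha, hb⟩, hc⟩ := ((h1.eventually (gt_mem_nhds hδ)).and
      (h2.eventually (gt_mem_nhds one_pos)) |>.and self_mem_nhdsWithin).exists
    exact ⟨r, hc, ha, hb⟩
  have hfin : (gridIndex r '' Metric.ball (0 : Pt d) R).Finite :=
    finite_image_gridIndex hr (R := R) fun x hx => (mem_ball_zero_iff.1 hx).le
  set Z := hfin.toFinset with hZ
  set g : (Fin d → ℤ) → ℝ := fun z => max (φ (corner r z)) 0 with hg
  have hball : ∀ x, gridIndex r x ∈ Z → x ∈ Metric.ball (0 : Pt d) (R + 1) := by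
    intro x hx
    obtain ⟨y, hy, hyx⟩ := hfin.mem_toFinset.1 hx
    rw [mem_ball_zero_iff] at hy ⊢
    have h1 := norm_sub_le_of_gridIndex_eq hr hyx.symm
    have h2 := norm_le_norm_add_norm_sub' x y
    linarith
  have hout : ∀ x, gridIndex r x ∉ Z → f x = 0 := by
    intro x hx
    refine hfR x (not_lt.1 fun h => hx (hfin.mem_toFinset.2 ⟨x, mem_ball_zero_iff.2 h, rfl⟩))
  have hdist : ∀ x, |(f x).toReal - g (gridIndex r x)| ≤ ‖(f x).toReal - φ x‖ + η₁ := by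
    intro x
    have h1 : |(f x).toReal - g (gridIndex r x)| ≤
        |(f x).toReal - φ (corner r (gridIndex r x))| := by
      have h0 : 0 ≤ (f x).toReal := ENNReal.toReal_nonneg
      have := abs_max_sub_max_le_abs (f x).toReal (φ (corner r (gridIndex r x))) 0
      rwa [max_eq_left h0] at this
    have h2 : |φ x - φ (corner r (gridIndex r x))| ≤ η₁ := by
      refine (hδ' ?_).le
      rw [dist_eq_norm]
      exact (norm_le_of_mem_cell hr rfl).trans_lt hr1
    have h3 := abs_sub_le (f x).toReal (φ x) (φ (corner r (gridIndex r x)))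
    rw [Real.norm_eq_abs]
    linarith
  set E : Pt d → ℝ≥0∞ := fun x => ‖(f x).toReal - φ x‖ₑ +
    (Metric.ball (0 : Pt d) (R + 1)).indicator (fun _ => η) x with hE
  have hEint : ∫⁻ x, E x ≤ ε := by
    rw [hE, lintegral_add_right _ (measurable_const.indicator measurableSet_ball),
      lintegral_indicator_const measurableSet_ball, ← ENNReal.add_halves ε]
    refine add_le_add hφε ?_
    have := hη' η le_rfl
    rwa [ENNReal.rpow_one, mul_comm] at this
  have hbound : ∀ x, gridIndex r x ∈ Z →
      ENNReal.ofReal |(f x).toReal - g (gridIndex r x)| ≤ E x := by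
    intro x hx
    refine (ENNReal.ofReal_le_ofReal (hdist x)).trans ?_
    rw [ENNReal.ofReal_add (norm_nonneg _) hη₁pos.le, ofReal_norm, hE]
    dsimp only
    rw [Set.indicator_of_mem (hball x hx)]
    exact add_le_add_right hη₁.2.le _
  have hfin_ae : ∀ᵐ x : Pt d, f x ≠ ∞ := (ae_lt_top hf hfi).mono fun x hx => hx.ne
  refine ⟨r, Z, g, hr, fun z => le_max_right _ _, fun x hx => stepDensity_of_notMem fun h =>
    not_lt.2 hx (mem_ball_zero_iff.1 (hball x h)), le_trans (lintegral_mono_ae ?_) hEint,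
    le_trans (lintegral_mono_ae ?_) hEint⟩
  · filter_upwards [hfin_ae] with x hx
    by_cases hxZ : gridIndex r x ∈ Z
    · refine le_trans ?_ (hbound x hxZ)
      rw [stepDensity_of_mem hxZ]
      conv_lhs => rw [← ENNReal.ofReal_toReal hx]
      rw [← ENNReal.ofReal_sub _ (le_max_right _ _)]
      exact ENNReal.ofReal_le_ofReal (le_abs_self _)
    · rw [hout x hxZ, zero_tsub]
      exact zero_le
  · filter_upwards [hfin_ae] with x hx
    by_cases hxZ : gridIndex r x ∈ Z
    · refine le_trans ?_ (hbound x hxZ)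
      rw [stepDensity_of_mem hxZ]
      conv_lhs => rw [← ENNReal.ofReal_toReal hx]
      rw [← ENNReal.ofReal_sub _ ENNReal.toReal_nonneg, abs_sub_comm]
      exact ENNReal.ofReal_le_ofReal (le_abs_self _)
    · rw [stepDensity_of_notMem hxZ, zero_tsub]
      exact zero_le

end BipartiteMatching

namespace BipartiteMatching

variable {d : ℕ}

/-! ### Densities with bounded support -/

/-- Hölder's inequality against the indicator of the ball. On bounded sets, L¹ closeness thus
controls the integral of the power. -/
theorem lintegral_rpow_le_of_ball {h : Pt d → ℝ≥0∞} (hh : Measurable h) {s : ℝ}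
    (hs : ∀ x, s ≤ ‖x‖ → h x = 0) {γ : ℝ} (hγ0 : 0 < γ) (hγ1 : γ ≤ 1) :
    ∫⁻ x, h x ^ γ ≤ (∫⁻ x, h x) ^ γ * volume (Metric.ball (0 : Pt d) s) ^ (1 - γ) := by
  have hind : Measurable ((Metric.ball (0 : Pt d) s).indicator fun _ => (1 : ℝ≥0∞)) :=
    measurable_const.indicator measurableSet_ball
  have h1 := ENNReal.lintegral_mul_norm_pow_le (μ := volume) hh.aemeasurable hind.aemeasurable
    hγ0.le (sub_nonneg.2 hγ1) (add_sub_cancel γ 1)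
  rw [lintegral_indicator_const measurableSet_ball, one_mul] at h1
  refine le_trans (lintegral_mono fun x => ?_) h1
  by_cases hx : x ∈ Metric.ball (0 : Pt d) s
  · rw [Set.indicator_of_mem hx, ENNReal.one_rpow, mul_one]
  · rw [hs x (not_lt.1 fun h' => hx (mem_ball_zero_iff.2 h')), ENNReal.zero_rpow_of_pos hγ0]
    exact zero_le

theorem lintegral_rpow_le_add {f g : Pt d → ℝ≥0∞} (hg : Measurable g) {γ : ℝ}
    (hγ0 : 0 < γ) (hγ1 : γ ≤ 1) :
    ∫⁻ x, f x ^ γ ≤ (∫⁻ x, g x ^ γ) + ∫⁻ x, (f x - g x) ^ γ := by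
  rw [← lintegral_add_left (hg.pow_const γ)]
  refine lintegral_mono fun x => ?_
  refine le_trans (ENNReal.rpow_le_rpow (?_ : f x ≤ g x + (f x - g x)) hγ0.le)
    (ENNReal.rpow_add_le_add_rpow _ _ hγ0.le hγ1)
  exact le_add_tsub

theorem liminf_le_liminf_add {u v : ℝ → ℝ≥0∞} {ε : ℝ≥0∞} (h : ∀ᶠ t in atTop, u t ≤ v t + ε) :
    liminf u atTop ≤ liminf v atTop + ε :=
  (liminf_le_liminf h).trans
    (liminf_add_const atTop v ε (by isBoundedDefault) (by isBoundedDefault)).le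

theorem limsup_le_limsup_add {u v : ℝ → ℝ≥0∞} {ε : ℝ≥0∞} (h : ∀ᶠ t in atTop, u t ≤ v t + ε) :
    limsup u atTop ≤ limsup v atTop + ε :=
  (limsup_le_limsup h).trans
    (limsup_add_const atTop v ε (by isBoundedDefault) (by isBoundedDefault)).le

/-- One L¹ approximation serves two purposes: the positive parts of the difference have small mass,
so the ball bound makes their cost small uniformly in t, and Hölder's inequality makes the integrals
of the powers close. -/
theorem exists_stepMeasure_approx {p : ℝ} (hp : 0 < p) (hp1 : p ≤ 1) (hpd : p < (d : ℝ) / 2)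
    {f : Pt d → ℝ≥0∞} (hf : Measurable f) (hfi : ∫⁻ x, f x ≠ ∞) {R : ℝ} (hR : 0 < R)
    (hfR : ∀ x, R ≤ ‖x‖ → f x = 0) {ε : ℝ≥0∞} (hε : 0 < ε) :
    ∃ (r : ℝ) (Z : Finset (Fin d → ℤ)) (κ : (Fin d → ℤ) → ℝ), 0 < r ∧ (∀ z, 0 ≤ κ z) ∧
      (∀ t, 0 < t → originScaled p (volume.withDensity f) t ≤
        originScaled p (stepMeasure r Z κ) t + ε) ∧
      (∀ t, 0 < t → originScaled p (stepMeasure r Z κ) t ≤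
        originScaled p (volume.withDensity f) t + ε) ∧
      ∫⁻ x, f x ^ (1 - p / (d : ℝ)) ≤
        ∑ z ∈ Z, ENNReal.ofReal (r ^ p) * ENNReal.ofReal (κ z ^ (1 - p / (d : ℝ))) + ε ∧
      ∑ z ∈ Z, ENNReal.ofReal (r ^ p) * ENNReal.ofReal (κ z ^ (1 - p / (d : ℝ))) ≤
        (∫⁻ x, f x ^ (1 - p / (d : ℝ))) + ε := by
  obtain ⟨C, hC, hball⟩ := exists_originScaled_ball_le hp hp1 hpd
  have hd' : (0 : ℝ) < d := by linarith
  have hd : 0 < d := by exact_mod_cast hd'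
  set γ : ℝ := 1 - p / d with hγ
  have hpd0 : 0 < p / d := by positivity
  have hγ0 : 0 < γ := by
    rw [hγ, sub_pos, div_lt_one hd']
    linarith
  have hγ1 : γ ≤ 1 := by linarith
  set V := volume (Metric.ball (0 : Pt d) (R + 1)) ^ (1 - γ) with hV
  have hVtop : V ≠ ∞ := ENNReal.rpow_ne_top_of_nonneg (by linarith) measure_ball_lt_top.ne
  set D : ℝ≥0∞ := C * ENNReal.ofReal ((R + 1) ^ p) with hD
  have hDtop : D ≠ ∞ := ENNReal.mul_ne_top hC ENNReal.ofReal_ne_top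
  -- One `D` for each positive part of the difference, and `V` for the integrals.
  obtain ⟨η, hη, hη'⟩ := exists_pos_const_mul_rpow_le (B := D + D + V)
    (ENNReal.add_ne_top.2 ⟨ENNReal.add_ne_top.2 ⟨hDtop, hDtop⟩, hVtop⟩) hε hγ0
  obtain ⟨r, Z, g, hr, hg, hgR, h1, h2⟩ := exists_stepDensity_approx hf hfi hfR hη
  set G := stepDensity r Z g with hG
  have hGm : Measurable G := measurable_stepDensity r Z g
  have hfR' : ∀ x, R + 1 ≤ ‖x‖ → f x = 0 := fun x hx => hfR x (by linarith)
  have hvanish1 : ∀ x, R + 1 ≤ ‖x‖ → f x - G x = 0 := fun x hx => by rw [hfR' x hx, zero_tsub]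
  have hvanish2 : ∀ x, R + 1 ≤ ‖x‖ → G x - f x = 0 := fun x hx => by rw [hgR x hx, zero_tsub]
  have hVη : η ^ γ * V ≤ ε := by
    refine le_trans ?_ (hη' η le_rfl)
    rw [mul_comm]
    gcongr
    exact le_add_self
  have hstep : volume.withDensity G = stepMeasure r Z fun z => r ^ d * g z :=
    withDensity_stepDensity hr Z g
  have hI := lintegral_stepDensity_rpow (p := p) hd hγ0 hr Z hg
  have hS : ∀ e : Pt d → ℝ≥0∞, Measurable e → (∀ x, R + 1 ≤ ‖x‖ → e x = 0) → ∫⁻ x, e x ≤ η →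
      IsFiniteMeasure (volume.withDensity e) → ∀ t, 0 < t →
      originScaled p (volume.withDensity e) t ≤ D * η ^ γ := by
    intro e he heR hei _ t ht
    have hae : ∀ᵐ x ∂volume.withDensity e, ‖x‖ < R + 1 := by
      rw [ae_withDensity_iff he]
      exact Eventually.of_forall fun x hx => not_le.1 fun h => hx (heR x h)
    refine (hball (R + 1) _ (by linarith) hae t ht).trans ?_
    rw [withDensity_apply _ MeasurableSet.univ, Measure.restrict_univ]
    gcongr
  have hGi : ∫⁻ x, G x ≠ ∞ := by
    rw [hG, lintegral_stepDensity hr]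
    exact ENNReal.sum_ne_top.2 fun z _ => ENNReal.ofReal_ne_top
  have := isFiniteMeasure_withDensity hfi
  have := isFiniteMeasure_withDensity hGi
  have hfin1 : IsFiniteMeasure (volume.withDensity fun x => f x - G x) :=
    isFiniteMeasure_withDensity (ne_top_of_le_ne_top hfi (lintegral_mono fun x => tsub_le_self))
  have hfin2 : IsFiniteMeasure (volume.withDensity fun x => G x - f x) :=
    isFiniteMeasure_withDensity (ne_top_of_le_ne_top hGi (lintegral_mono fun x => tsub_le_self))
  -- Both sides have density max f G.
  have hadd : volume.withDensity f + volume.withDensity (fun x => G x - f x) =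
      volume.withDensity G + volume.withDensity fun x => f x - G x := by
    rw [← withDensity_add_left hf, ← withDensity_add_left hGm]
    congr 1
    funext x
    rw [Pi.add_apply, Pi.add_apply, add_tsub_eq_max, add_tsub_eq_max, max_comm]
  have herr : ∀ t, 0 < t → originScaled p (volume.withDensity fun x => f x - G x) t +
      originScaled p (volume.withDensity fun x => G x - f x) t ≤ ε := by
    intro t ht
    refine (add_le_add (hS _ (hf.sub hGm) hvanish1 h1 hfin1 t ht)
      (hS _ (hGm.sub hf) hvanish2 h2 hfin2 t ht)).trans (le_trans ?_ (hη' η le_rfl))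
    rw [← add_mul]
    exact mul_le_mul' le_self_add le_rfl
  refine ⟨r, Z, fun z => r ^ d * g z, hr, fun z => mul_nonneg (by positivity) (hg z),
    fun t ht => ?_, fun t ht => ?_, ?_, ?_⟩
  · rw [← hstep]
    exact (originScaled_le_of_add_eq hp hp1 hadd t).trans (add_le_add_right (herr t ht) _)
  · rw [← hstep]
    refine (originScaled_le_of_add_eq hp hp1 hadd.symm t).trans (add_le_add_right ?_ _)
    rw [add_comm]
    exact herr t ht
  · rw [← hI]
    refine (lintegral_rpow_le_add hGm hγ0 hγ1).trans (add_le_add_right ?_ _)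
    refine (lintegral_rpow_le_of_ball (hf.sub hGm) hvanish1 hγ0 hγ1).trans (le_trans ?_ hVη)
    gcongr
    exact h1
  · rw [← hI]
    refine (lintegral_rpow_le_add hf hγ0 hγ1).trans (add_le_add_right ?_ _)
    refine (lintegral_rpow_le_of_ball (hGm.sub hf) hvanish2 hγ0 hγ1).trans (le_trans ?_ hVη)
    gcongr
    exact h2

theorem le_of_forall_pos_le_mul_add {a b L : ℝ≥0∞} (hL : L ≠ ∞)
    (h : ∀ ε : ℝ≥0∞, 0 < ε → a ≤ b + (L + 1) * ε) : a ≤ b := by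
  have hlim : Tendsto (fun ε : ℝ≥0∞ => b + (L + 1) * ε) (𝓝[>] 0) (𝓝 b) := by
    have h1 := (ENNReal.Tendsto.const_mul (a := L + 1) (tendsto_id (x := 𝓝 (0 : ℝ≥0∞)))
      (Or.inr (ENNReal.add_ne_top.2 ⟨hL, ENNReal.one_ne_top⟩)))
    have h2 := (tendsto_const_nhds (x := b)).add h1
    rw [mul_zero, add_zero] at h2
    exact h2.mono_left nhdsWithin_le_nhds
  exact ge_of_tendsto hlim (eventually_mem_nhdsWithin.mono fun ε hε => h ε hε)

theorem limsup_originScaled_withDensity_le {p : ℝ} (hp : 0 < p) (hp1 : p ≤ 1)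
    (hpd : p < (d : ℝ) / 2) {L : ℝ≥0∞} (hLtop : L ≠ ∞)
    (hL : Tendsto (scaledMean p (pointCost p 0) (unitMeasure d)) atTop (𝓝 L))
    {f : Pt d → ℝ≥0∞} (hf : Measurable f) (hfi : ∫⁻ x, f x ≠ ∞) {R : ℝ} (hR : 0 < R)
    (hfR : ∀ x, R ≤ ‖x‖ → f x = 0) :
    limsup (originScaled p (volume.withDensity f)) atTop ≤
      L * ∫⁻ x, f x ^ (1 - p / (d : ℝ)) := by
  refine le_of_forall_pos_le_mul_add hLtop fun ε hε => ?_
  obtain ⟨r, Z, κ, hr, hκ, h1, -, -, h4⟩ := exists_stepMeasure_approx hp hp1 hpd hf hfi hR hfR hε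
  calc limsup (originScaled p (volume.withDensity f)) atTop
      ≤ limsup (originScaled p (stepMeasure r Z κ)) atTop + ε :=
        limsup_le_limsup_add ((eventually_gt_atTop 0).mono h1)
    _ ≤ L * ((∫⁻ x, f x ^ (1 - p / (d : ℝ))) + ε) + ε :=
        add_le_add_left ((limsup_originScaled_stepMeasure_le hp hp1 hpd hL hr Z hκ).trans
          (mul_le_mul_right h4 L)) _
    _ = _ := by ring

theorem le_liminf_originScaled_withDensity {p : ℝ} (hp : 0 < p) (hp1 : p ≤ 1)
    (hpd : p < (d : ℝ) / 2) {L : ℝ≥0∞} (hLtop : L ≠ ∞)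
    (hL : Tendsto (scaledMean p (boundaryCost p) (unitMeasure d)) atTop (𝓝 L))
    {f : Pt d → ℝ≥0∞} (hf : Measurable f) (hfi : ∫⁻ x, f x ≠ ∞) {R : ℝ} (hR : 0 < R)
    (hfR : ∀ x, R ≤ ‖x‖ → f x = 0) :
    L * ∫⁻ x, f x ^ (1 - p / (d : ℝ)) ≤
      liminf (originScaled p (volume.withDensity f)) atTop := by
  refine le_of_forall_pos_le_mul_add hLtop fun ε hε => ?_
  obtain ⟨r, Z, κ, hr, hκ, -, h2, h3, -⟩ := exists_stepMeasure_approx hp hp1 hpd hf hfi hR hfR hε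
  calc L * ∫⁻ x, f x ^ (1 - p / (d : ℝ))
      ≤ L * (∑ z ∈ Z, ENNReal.ofReal (r ^ p) * ENNReal.ofReal (κ z ^ (1 - p / (d : ℝ))) + ε) :=
        mul_le_mul_right h3 L
    _ ≤ (liminf (originScaled p (volume.withDensity f)) atTop + ε) + L * ε := by
        rw [mul_add]
        refine add_le_add_left ((le_liminf_originScaled_stepMeasure hp hp1 hpd hL hr Z hκ).trans
          (liminf_le_liminf_add ((eventually_gt_atTop 0).mono h2))) _
    _ = _ := by ring

end BipartiteMatching

namespace BipartiteMatching

variable {d : ℕ}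

/-! ### General measures -/

theorem eventually_originScaled_le_add_of_singular {p α : ℝ} (hp : 0 < p) (hp1 : p ≤ 1)
    (hpd : p < (d : ℝ) / 2) (hα : p < α * (1 - p / (d : ℝ))) (μ : Measure (Pt d))
    [IsFiniteMeasure μ] (hμα : ∫⁻ x, ENNReal.ofReal (‖x‖ ^ α) ∂μ ≠ ∞) {ε : ℝ≥0∞} (hε : 0 < ε) :
    ∀ᶠ t : ℝ in atTop,
      originScaled p (volume.withDensity (μ.rnDeriv volume)) t ≤ originScaled p μ t + ε ∧
      originScaled p μ t ≤ originScaled p (volume.withDensity (μ.rnDeriv volume)) t + ε := by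
  have hsing : ∫⁻ x, ENNReal.ofReal (‖x‖ ^ α) ∂μ.singularPart volume ≠ ∞ :=
    ne_top_of_le_ne_top hμα (lintegral_mono' (Measure.singularPart_le _ _) le_rfl)
  have hdec : volume.withDensity (μ.rnDeriv volume) + μ.singularPart volume = μ := by
    rw [add_comm]
    exact (Measure.haveLebesgueDecomposition_add μ volume).symm
  filter_upwards [eventually_originScaled_le_of_mutuallySingular hp hp1 hpd hα
    (Measure.mutuallySingular_singularPart μ volume) hsing hε] with t ht
  constructor
  · have h := originScaled_le_add hp hp1 (volume.withDensity (μ.rnDeriv volume))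
      (μ.singularPart volume) t
    rw [hdec] at h
    exact h.trans (add_le_add_right ht _)
  · have h := originScaled_add_le hp hp1 (volume.withDensity (μ.rnDeriv volume))
      (μ.singularPart volume) t
    rw [hdec] at h
    exact h.trans (add_le_add_right ht _)

theorem ennreal_le_of_forall_pos_le_add {a b : ℝ≥0∞} (h : ∀ ε : ℝ≥0∞, 0 < ε → a ≤ b + ε) : a ≤ b :=
  le_of_forall_pos_le_mul_add ENNReal.zero_ne_top fun ε hε => by simpa using h ε hε

/-- The density is cut off at a radius beyond which the tail costs at most ε for all t. The integral
of the power is then recovered by exhausting the space with balls, so its finiteness need not be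
known. -/
theorem le_liminf_originScaled_withDensity_of_moment {p α : ℝ} (hp : 0 < p) (hp1 : p ≤ 1)
    (hpd : p < (d : ℝ) / 2) (hα : p < α * (1 - p / (d : ℝ))) {L : ℝ≥0∞} (hLtop : L ≠ ∞)
    (hL : Tendsto (scaledMean p (boundaryCost p) (unitMeasure d)) atTop (𝓝 L))
    {f : Pt d → ℝ≥0∞} (hf : Measurable f) (hfi : ∫⁻ x, f x ≠ ∞)
    (hfα : ∫⁻ x, ENNReal.ofReal (‖x‖ ^ α) ∂volume.withDensity f ≠ ∞) :
    L * ∫⁻ x, f x ^ (1 - p / (d : ℝ)) ≤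
      liminf (originScaled p (volume.withDensity f)) atTop := by
  have hd' : (0 : ℝ) < d := by linarith
  have hγ0 : 0 < 1 - p / (d : ℝ) := by
    rw [sub_pos, div_lt_one hd']
    linarith
  have := isFiniteMeasure_withDensity hfi
  have key : ∀ n : ℕ, L * ∫⁻ x in Metric.ball 0 (n : ℝ), f x ^ (1 - p / (d : ℝ)) ≤
      liminf (originScaled p (volume.withDensity f)) atTop := by
    intro n
    refine ennreal_le_of_forall_pos_le_add fun ε hε => ?_
    obtain ⟨R, hnR, hR, htail⟩ := exists_tail_le hp hp1 hpd hα hfα hε n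
    set B : Set (Pt d) := Metric.ball 0 R with hB
    have hcompl : Bᶜ = {x | R ≤ ‖x‖} := Set.ext fun x => by simp [hB]
    have hres : (volume.withDensity f).restrict B = volume.withDensity (B.indicator f) := by
      rw [restrict_withDensity measurableSet_ball, withDensity_indicator measurableSet_ball]
    have h1 := le_liminf_originScaled_withDensity hp hp1 hpd hLtop hL
      (hf.indicator (measurableSet_ball (x := (0 : Pt d)) (ε := R)))
      (ne_top_of_le_ne_top hfi (lintegral_mono fun x => Set.indicator_le_self _ _ x)) hR
      fun x hx => Set.indicator_of_notMem (fun h => not_lt.2 hx (mem_ball_zero_iff.1 h)) _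
    calc L * ∫⁻ x in Metric.ball 0 (n : ℝ), f x ^ (1 - p / (d : ℝ))
        ≤ L * ∫⁻ x, B.indicator f x ^ (1 - p / (d : ℝ)) := by
          rw [← lintegral_indicator measurableSet_ball]
          gcongr with x
          by_cases hx : x ∈ Metric.ball (0 : Pt d) n
          · rw [Set.indicator_of_mem hx, Set.indicator_of_mem (Metric.ball_subset_ball hnR hx)]
          · rw [Set.indicator_of_notMem hx]
            exact zero_le
      _ ≤ liminf (originScaled p (volume.withDensity (B.indicator f))) atTop := h1
      _ ≤ liminf (originScaled p (volume.withDensity f)) atTop + ε := by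
          refine liminf_le_liminf_add ((eventually_gt_atTop 0).mono fun t ht => ?_)
          have h2 := originScaled_le_add hp hp1 ((volume.withDensity f).restrict B)
            ((volume.withDensity f).restrict Bᶜ) t
          rw [Measure.restrict_add_restrict_compl measurableSet_ball, hres, hcompl] at h2
          exact h2.trans (add_le_add_right (htail t ht) _)
  have hcover := (aecover_ball (μ := (volume : Measure (Pt d))) (x := (0 : Pt d))
    (tendsto_natCast_atTop_atTop (R := ℝ))).lintegral_tendsto_of_countably_generated
    (f := fun x => f x ^ (1 - p / (d : ℝ))) (hf.pow_const _).aemeasurable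
  exact le_of_tendsto' (ENNReal.Tendsto.const_mul hcover (Or.inr hLtop)) key

theorem le_liminf_originScaled {p α : ℝ} (hp : 0 < p) (hp1 : p ≤ 1)
    (hpd : p < (d : ℝ) / 2) (hα : p < α * (1 - p / (d : ℝ))) {L : ℝ≥0∞} (hLtop : L ≠ ∞)
    (hL : Tendsto (scaledMean p (boundaryCost p) (unitMeasure d)) atTop (𝓝 L))
    (μ : Measure (Pt d)) [IsFiniteMeasure μ] (hμα : ∫⁻ x, ENNReal.ofReal (‖x‖ ^ α) ∂μ ≠ ∞) :
    L * ∫⁻ x, (μ.rnDeriv volume x) ^ (1 - p / (d : ℝ)) ≤ liminf (originScaled p μ) atTop := by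
  refine ennreal_le_of_forall_pos_le_add fun ε hε => ?_
  refine (le_liminf_originScaled_withDensity_of_moment hp hp1 hpd hα hLtop hL
    (Measure.measurable_rnDeriv μ volume) (Measure.lintegral_rnDeriv_lt_top μ volume).ne
    (ne_top_of_le_ne_top hμα (lintegral_mono' (Measure.withDensity_rnDeriv_le _ _) le_rfl))).trans
    (liminf_le_liminf_add ?_)
  exact (eventually_originScaled_le_add_of_singular hp hp1 hpd hα μ hμα hε).mono fun t ht => ht.1

/-! ### Uniform densities -/

theorem measurableSet_box (R : ℝ) : MeasurableSet {x : Pt d | ∀ i, -R ≤ x i ∧ x i < R} := by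
  rw [Set.ofPred_forall]
  refine MeasurableSet.iInter fun i => ?_
  have hi : Measurable fun x : Pt d => x i := by fun_prop
  exact (measurableSet_le measurable_const hi).inter (measurableSet_lt hi measurable_const)

theorem norm_lt_of_mem_box {R : ℝ} (hR : 0 < R) {x : Pt d} (hx : ∀ i, -R ≤ x i ∧ x i < R) :
    ‖x‖ < R * (d + 2) := by
  have h : ‖x‖ ≤ R * (d + 1) := by
    rw [EuclideanSpace.norm_eq, Real.sqrt_le_iff]
    refine ⟨by positivity, ?_⟩
    calc ∑ i, ‖x i‖ ^ 2 ≤ ∑ _i : Fin d, R ^ 2 := by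
          refine Finset.sum_le_sum fun i _ => pow_le_pow_left₀ (norm_nonneg _) ?_ 2
          rw [Real.norm_eq_abs]
          exact abs_le.2 ⟨(hx i).1, (hx i).2.le⟩
      _ = d * R ^ 2 := by simp
      _ ≤ ((d : ℝ) + 1) ^ 2 * R ^ 2 := by
          gcongr
          nlinarith [Nat.cast_nonneg (α := ℝ) d]
      _ = _ := by ring
  refine h.trans_lt ?_
  gcongr
  norm_num

theorem restrict_box_eq {R : ℝ} (hR : 0 < R) :
    volume.restrict {x : Pt d | ∀ i, -R ≤ x i ∧ x i < R} =
      ENNReal.ofReal ((2 * R) ^ d) •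
        (unitMeasure d).map (homothety (WithLp.toLp 2 fun _ => -R) (2 * R)) := by
  have hR2 : 0 < 2 * R := by positivity
  have hpre : homothety (WithLp.toLp 2 fun _ => -R) (2 * R) ⁻¹'
      {x : Pt d | ∀ i, -R ≤ x i ∧ x i < R} = cell 1 0 := by
    refine Set.ext fun x => ?_
    rw [mem_cell_iff one_pos]
    simp only [Set.mem_preimage, Set.mem_ofPred_eq, homothety_apply]
    refine forall_congr' fun i => ?_
    simp only [Pi.zero_apply, Int.cast_zero, mul_zero, zero_add, mul_one]
    constructor
    · rintro ⟨h1, h2⟩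
      constructor <;> nlinarith
    · rintro ⟨h1, h2⟩
      constructor <;> nlinarith
  conv_lhs => rw [← map_homothety_volume (WithLp.toLp 2 fun _ => -R) hR2]
  rw [Measure.restrict_smul, Measure.restrict_map (measurable_homothety _ _)
    (measurableSet_box R), hpre, unitMeasure]

theorem lintegral_indicator_const_rpow {S : Set (Pt d)} (hS : MeasurableSet S) (c : ℝ≥0∞) {γ : ℝ}
    (hγ : 0 < γ) : ∫⁻ x, S.indicator (fun _ => c) x ^ γ = c ^ γ * volume S := by
  rw [← lintegral_indicator_const hS]
  refine lintegral_congr fun x => ?_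
  by_cases hx : x ∈ S
  · rw [Set.indicator_of_mem hx, Set.indicator_of_mem hx]
  · rw [Set.indicator_of_notMem hx, Set.indicator_of_notMem hx, ENNReal.zero_rpow_of_pos hγ]

theorem withDensity_indicator_const {S : Set (Pt d)} (hS : MeasurableSet S) (c : ℝ≥0∞) :
    volume.withDensity (S.indicator fun _ => c) = c • volume.restrict S := by
  rw [withDensity_indicator hS, withDensity_const]

theorem limsup_originScaled_indicator_le {p : ℝ} (hp : 0 < p) (hp1 : p ≤ 1)
    (hpd : p < (d : ℝ) / 2) {L : ℝ≥0∞} (hLtop : L ≠ ∞)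
    (hL : Tendsto (scaledMean p (pointCost p 0) (unitMeasure d)) atTop (𝓝 L)) (c : ℝ≥0)
    {S : Set (Pt d)} (hS : MeasurableSet S) {R : ℝ} (hR : 0 < R) (hSR : ∀ x ∈ S, ‖x‖ < R) :
    limsup (originScaled p (volume.withDensity (S.indicator fun _ => (c : ℝ≥0∞)))) atTop ≤
      L * ∫⁻ x, S.indicator (fun _ => (c : ℝ≥0∞)) x ^ (1 - p / (d : ℝ)) := by
  refine limsup_originScaled_withDensity_le hp hp1 hpd hLtop hL (measurable_const.indicator hS) ?_
    hR fun x hx => Set.indicator_of_notMem (fun h => not_lt.2 hx (hSR x h)) _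
  rw [lintegral_indicator_const hS]
  exact ENNReal.mul_ne_top ENNReal.coe_ne_top (ne_top_of_le_ne_top
    (measure_ball_lt_top (x := (0 : Pt d)) (r := R)).ne
    (measure_mono fun x hx => mem_ball_zero_iff.2 (hSR x hx)))

/-- A box is a homothetic copy of the unit cell, so the constant β is exact here. -/
theorem tendsto_originScaled_box {p : ℝ} (hp : 0 < p) (hp1 : p ≤ 1)
    (hpd : p < (d : ℝ) / 2) {L : ℝ≥0∞}
    (hL : Tendsto (scaledMean p (pointCost p 0) (unitMeasure d)) atTop (𝓝 L)) (c : ℝ≥0)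
    {R : ℝ} (hR : 0 < R) :
    Tendsto (originScaled p ((c : ℝ≥0∞) • volume.restrict {x : Pt d | ∀ i, -R ≤ x i ∧ x i < R}))
      atTop (𝓝 (L * ((c : ℝ≥0∞) ^ (1 - p / (d : ℝ)) *
        volume {x : Pt d | ∀ i, -R ≤ x i ∧ x i < R}))) := by
  have hd' : (0 : ℝ) < d := by linarith
  have hγ0 : 0 < 1 - p / (d : ℝ) := by
    rw [sub_pos, div_lt_one hd']
    linarith
  have hR2 : 0 < 2 * R := by positivity
  have hvol : volume {x : Pt d | ∀ i, -R ≤ x i ∧ x i < R} = ENNReal.ofReal ((2 * R) ^ d) := by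
    have := congrArg (fun ν => ν Set.univ) (restrict_box_eq (d := d) hR)
    simpa [Measure.map_apply (measurable_homothety _ _)] using this
  have hlim := tendsto_originScaled_homothety hp hp1 hpd hL (WithLp.toLp 2 fun _ => -R) hR2
    (κ := c * (2 * R) ^ d) (by positivity)
  rw [ENNReal.ofReal_mul c.coe_nonneg, ENNReal.ofReal_coe_nnreal, mul_smul, ← restrict_box_eq hR] at hlim
  convert hlim using 2
  rw [hvol, ← ENNReal.ofReal_coe_nnreal, ENNReal.ofReal_rpow_of_nonneg c.coe_nonneg hγ0.le,
    ← ENNReal.ofReal_mul (by positivity), ← mul_assoc, ← ENNReal.ofReal_mul (by positivity),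
    mul_comm L]
  congr 2
  rw [Real.mul_rpow c.coe_nonneg (by positivity), mul_left_comm]
  congr 1
  rw [← Real.rpow_natCast, ← Real.rpow_mul hR2.le, ← Real.rpow_add hR2]
  congr 1
  field_simp
  ring

/-- Only the lower bound is new. In a box Q ⊇ Ω the cost of Q is at most that of Ω plus that of Q \
Ω. The first has limit β c^(1-p/d) |Q|, and the last has upper limit at most β c^(1-p/d) |Q \ Ω|;
the difference is the required bound for Ω. -/
theorem tendsto_originScaled_indicator {p : ℝ} (hp : 0 < p) (hp1 : p ≤ 1)
    (hpd : p < (d : ℝ) / 2) {L : ℝ≥0∞} (hLtop : L ≠ ∞)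
    (hL : Tendsto (scaledMean p (pointCost p 0) (unitMeasure d)) atTop (𝓝 L)) (c : ℝ≥0)
    {Ω : Set (Pt d)} (hΩ : MeasurableSet Ω) (hΩb : Bornology.IsBounded Ω) :
    Tendsto (originScaled p (volume.withDensity (Ω.indicator fun _ => (c : ℝ≥0∞)))) atTop
      (𝓝 (L * ∫⁻ x, Ω.indicator (fun _ => (c : ℝ≥0∞)) x ^ (1 - p / (d : ℝ)))) := by
  have hd' : (0 : ℝ) < d := by linarith
  have hγ0 : 0 < 1 - p / (d : ℝ) := by
    rw [sub_pos, div_lt_one hd']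
    linarith
  obtain ⟨R₀, hR₀⟩ := hΩb.exists_norm_le
  set R : ℝ := max R₀ 0 + 1 with hRdef
  have hR : 0 < R := by positivity
  have hΩR : ∀ x ∈ Ω, ‖x‖ < R := fun x hx =>
    (hR₀ x hx).trans_lt (lt_of_le_of_lt (le_max_left _ 0) (lt_add_one _))
  set Q : Set (Pt d) := {x | ∀ i, -R ≤ x i ∧ x i < R} with hQdef
  have hQ : MeasurableSet Q := measurableSet_box R
  have hΩQ : Ω ⊆ Q := fun x hx i => by
    have := abs_lt.1 (lt_of_le_of_lt (PiLp.norm_apply_le x i) (hΩR x hx))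
    exact ⟨this.1.le, this.2⟩
  have hQR : ∀ x ∈ Q \ Ω, ‖x‖ < R * (d + 2) := fun x hx => norm_lt_of_mem_box hR hx.1
  have hvolQ : volume Q ≠ ∞ := ne_top_of_le_ne_top
    (measure_ball_lt_top (x := (0 : Pt d)) (r := R * (d + 2))).ne
    (measure_mono fun x hx => mem_ball_zero_iff.2 (norm_lt_of_mem_box hR hx))
  refine tendsto_of_le_liminf_of_limsup_le ?_
    (limsup_originScaled_indicator_le hp hp1 hpd hLtop hL c hΩ hR hΩR)
  have hdiff := limsup_originScaled_indicator_le hp hp1 hpd hLtop hL c (hQ.diff hΩ)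
    (by positivity) hQR
  have hbox := tendsto_originScaled_box hp hp1 hpd hL c hR
  rw [← hQdef] at hbox
  rw [lintegral_indicator_const_rpow (hQ.diff hΩ) _ hγ0] at hdiff
  rw [lintegral_indicator_const_rpow hΩ _ hγ0]
  have hctop : (c : ℝ≥0∞) ^ (1 - p / (d : ℝ)) ≠ ∞ :=
    ENNReal.rpow_ne_top_of_nonneg hγ0.le ENNReal.coe_ne_top
  set E := L * ((c : ℝ≥0∞) ^ (1 - p / (d : ℝ)) * volume (Q \ Ω)) with hE
  have hEtop : E ≠ ∞ := ENNReal.mul_ne_top hLtop (ENNReal.mul_ne_top hctop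
    (ne_top_of_le_ne_top hvolQ (measure_mono Set.sdiff_subset)))
  have hsplit : volume Q = volume Ω + volume (Q \ Ω) := by
    rw [← measure_inter_add_sdiff Q hΩ, Set.inter_eq_right.2 hΩQ]
  have hres : volume.restrict Ω + volume.restrict (Q \ Ω) = volume.restrict Q := by
    have h := Measure.restrict_inter_add_sdiff (μ := volume) Q hΩ
    rwa [Set.inter_eq_right.2 hΩQ] at h
  refine ennreal_le_of_forall_pos_le_add fun ε hε => ?_
  -- The finite upper bound `E` for Q \ Ω is added to both sides instead of being subtracted.
  refine (ENNReal.add_le_add_iff_right hEtop).1 ?_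
  have hfin : ∀ {S : Set (Pt d)}, S ⊆ Q → IsFiniteMeasure ((c : ℝ≥0∞) • volume.restrict S) := by
    intro S hS
    have : IsFiniteMeasure (volume.restrict S) := ⟨by
      rw [Measure.restrict_apply_univ]
      exact (measure_mono hS).trans_lt hvolQ.lt_top⟩
    exact Measure.smul_finite _ ENNReal.coe_ne_top
  have := hfin hΩQ
  have := hfin (Set.sdiff_subset (s := Q) (t := Ω))
  calc L * ((c : ℝ≥0∞) ^ (1 - p / (d : ℝ)) * volume Ω) + E
      = liminf (originScaled p ((c : ℝ≥0∞) • volume.restrict Q)) atTop := by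
        rw [hbox.liminf_eq, hE, hsplit]
        ring
    _ ≤ liminf (originScaled p ((c : ℝ≥0∞) • volume.restrict Ω)) atTop + (E + ε) := by
        refine liminf_le_liminf_add ?_
        have hlt := eventually_lt_of_limsup_lt (hdiff.trans_lt (ENNReal.lt_add_right hEtop hε.ne'))
        filter_upwards [hlt] with t ht
        have h1 := originScaled_add_le hp hp1 ((c : ℝ≥0∞) • volume.restrict Ω)
          ((c : ℝ≥0∞) • volume.restrict (Q \ Ω)) t
        rw [← smul_add, hres] at h1
        rw [withDensity_indicator_const (hQ.diff hΩ)] at ht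
        exact h1.trans (add_le_add_right ht.le _)
    _ = _ := by
        rw [withDensity_indicator_const hΩ, add_right_comm, add_assoc, add_comm E]

end BipartiteMatching

namespace BipartiteMatching

variable {d : ℕ}

/-! ### Comparison with the full matching cost -/

theorem scaledExpectation_matchingCost {p : ℝ} (hp : 0 < p) (μ : Measure (Pt d))
    [IsFiniteMeasure μ] (t : ℝ) :
    scaledExpectation p (matchingCost d p) μ t =
      matchingMean p (ENNReal.ofReal t • μ) / ENNReal.ofReal (t ^ (1 - p / (d : ℝ))) := by
  rw [scaledExpectation, poissonExpectation_matchingCost hp]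

theorem scaledExpectation_le_originScaled {p : ℝ} (hp : 0 < p) (hp1 : p ≤ 1) (μ : Measure (Pt d))
    [IsFiniteMeasure μ] (t : ℝ) :
    scaledExpectation p (matchingCost d p) μ t ≤ originScaled p μ t := by
  rw [scaledExpectation_matchingCost hp]
  exact ENNReal.div_le_div_right
    (matchingMean_le_transportMean _ (powDist_le_pointCost hp hp1 0)) _

theorem pointCost_le_ofReal_add {p α : ℝ} (hp : 0 < p) (hpα : p ≤ α) {R : ℝ} (hR : 0 < R)
    (x : Pt d) : pointCost p 0 x ≤
      ENNReal.ofReal (R ^ p) + ENNReal.ofReal (R ^ (p - α)) * ENNReal.ofReal (‖x‖ ^ α) := by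
  rw [pointCost_zero_eq hp]
  rcases le_total ‖x‖ R with h | h
  · exact le_add_right (ENNReal.ofReal_le_ofReal (Real.rpow_le_rpow (norm_nonneg _) h hp.le))
  · refine le_add_left ?_
    rw [← ENNReal.ofReal_mul (by positivity)]
    refine ENNReal.ofReal_le_ofReal ?_
    have hx : 0 < ‖x‖ := hR.trans_le h
    calc ‖x‖ ^ p = ‖x‖ ^ (p - α) * ‖x‖ ^ α := by rw [← Real.rpow_add hx, sub_add_cancel]
      _ ≤ R ^ (p - α) * ‖x‖ ^ α := by
          exact mul_le_mul_of_nonneg_right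
            (Real.rpow_le_rpow_of_nonpos hR h (by linarith)) (by positivity)

/-- Exit prices are split at radius R. The surplus points pay R^p √t, the far points R^(p-α) t times
the moment, and R = t^(1/(2α)) makes both of order t^(1/2 + p/(2α)). -/
theorem originScaled_le_scaledExpectation_add {p α : ℝ} (hp : 0 < p) (hα : 0 < α) (hpα : p ≤ α)
    (μ : Measure (Pt d)) [IsFiniteMeasure μ] {t : ℝ} (ht : 0 < t) :
    originScaled p μ t ≤ scaledExpectation p (matchingCost d p) μ t +
      (2 * μ Set.univ ^ (1 / 2 : ℝ) + 2 * ∫⁻ x, ENNReal.ofReal (‖x‖ ^ α) ∂μ) *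
        ENNReal.ofReal (t ^ (-(1 - p / (d : ℝ) - 1 / 2 - p / (2 * α)))) := by
  set R : ℝ := t ^ (1 / (2 * α)) with hR
  set γ : ℝ := 1 - p / d with hγ
  set M := ∫⁻ x, ENNReal.ofReal (‖x‖ ^ α) ∂μ with hM
  have hR0 : 0 < R := by positivity
  have hmeas : Measurable fun x : Pt d => ENNReal.ofReal (‖x‖ ^ α) := by fun_prop
  have h1 := transportMean_le_matchingMean (p := p) (ENNReal.ofReal t • μ)
    (hmeas.const_mul (ENNReal.ofReal (R ^ (p - α)))) (pointCost_le_ofReal_add hp hpα hR0)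
  have hγt : 0 < t ^ γ := by positivity
  rw [scaledExpectation_matchingCost hp, originScaled, scaledMean]
  refine (ENNReal.div_le_div_right h1 _).trans (le_of_eq ?_)
  rw [ENNReal.add_div, ENNReal.add_div, add_assoc, add_mul]
  congr 2
  · rw [ofReal_smul_univ, ENNReal.mul_rpow_of_nonneg _ _ (by norm_num),
      ENNReal.ofReal_rpow_of_pos ht]
    calc ENNReal.ofReal (R ^ p) * (2 * (ENNReal.ofReal (t ^ (1 / 2 : ℝ)) *
          μ Set.univ ^ (1 / 2 : ℝ))) / ENNReal.ofReal (t ^ γ)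
        = 2 * μ Set.univ ^ (1 / 2 : ℝ) * ((ENNReal.ofReal (R ^ p) *
          ENNReal.ofReal (t ^ (1 / 2 : ℝ))) / ENNReal.ofReal (t ^ γ)) := by
          rw [← mul_div_assoc]
          congr 1
          ring
      _ = _ := by
          rw [← ENNReal.ofReal_mul (by positivity), ← ENNReal.ofReal_div_of_pos hγt, hR,
            ← Real.rpow_mul ht.le, ← Real.rpow_add ht, ← Real.rpow_sub ht]
          congr 3
          field_simp
          ring
  · rw [lintegral_const_mul _ hmeas, lintegral_smul_measure, smul_eq_mul, ← hM]
    calc 2 * (ENNReal.ofReal (R ^ (p - α)) * (ENNReal.ofReal t * M)) / ENNReal.ofReal (t ^ γ)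
        = 2 * M * ((ENNReal.ofReal (R ^ (p - α)) * ENNReal.ofReal t) /
          ENNReal.ofReal (t ^ γ)) := by
          rw [← mul_div_assoc]
          congr 1
          ring
      _ = _ := by
          rw [← ENNReal.ofReal_mul (by positivity), ← ENNReal.ofReal_div_of_pos hγt, hR,
            ← Real.rpow_mul ht.le]
          conv_lhs => enter [2, 1, 1, 2]; rw [← Real.rpow_one t]
          rw [← Real.rpow_add ht, ← Real.rpow_sub ht]
          congr 3
          field_simp
          ring

theorem tendsto_originScaled_error {p α : ℝ}
    (hα2 : p / (2 * α) < 1 / 2 - p / (d : ℝ)) (μ : Measure (Pt d)) [IsFiniteMeasure μ]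
    (hμα : ∫⁻ x, ENNReal.ofReal (‖x‖ ^ α) ∂μ ≠ ∞) :
    Tendsto (fun t : ℝ => (2 * μ Set.univ ^ (1 / 2 : ℝ) + 2 * ∫⁻ x, ENNReal.ofReal (‖x‖ ^ α) ∂μ) *
      ENNReal.ofReal (t ^ (-(1 - p / (d : ℝ) - 1 / 2 - p / (2 * α))))) atTop (𝓝 0) := by
  refine tendsto_const_mul_rpow_neg ?_ (by linarith)
  exact ENNReal.add_ne_top.2 ⟨ENNReal.mul_ne_top (by simp) (ENNReal.rpow_ne_top_of_nonneg
    (by norm_num) (measure_ne_top _ _)), ENNReal.mul_ne_top (by simp) hμα⟩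

theorem tendsto_scaledExpectation_of_originScaled {p α : ℝ} (hp : 0 < p) (hp1 : p ≤ 1)
    (hα : 0 < α) (hpα : p ≤ α) (hα2 : p / (2 * α) < 1 / 2 - p / (d : ℝ)) (μ : Measure (Pt d))
    [IsFiniteMeasure μ] (hμα : ∫⁻ x, ENNReal.ofReal (‖x‖ ^ α) ∂μ ≠ ∞) {l : ℝ≥0∞}
    (h : Tendsto (originScaled p μ) atTop (𝓝 l)) :
    Tendsto (scaledExpectation p (matchingCost d p) μ) atTop (𝓝 l) :=
  tendsto_of_le_add_of_le_add h (tendsto_originScaled_error hα2 μ hμα)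
    (Eventually.of_forall fun t => (scaledExpectation_le_originScaled hp hp1 μ t).trans le_self_add)
    ((eventually_gt_atTop 0).mono fun _ ht =>
      originScaled_le_scaledExpectation_add hp hα hpα μ ht)

theorem liminf_originScaled_le {p α : ℝ} (hp : 0 < p)
    (hα : 0 < α) (hpα : p ≤ α) (hα2 : p / (2 * α) < 1 / 2 - p / (d : ℝ)) (μ : Measure (Pt d))
    [IsFiniteMeasure μ] (hμα : ∫⁻ x, ENNReal.ofReal (‖x‖ ^ α) ∂μ ≠ ∞) :
    liminf (originScaled p μ) atTop ≤
      liminf (scaledExpectation p (matchingCost d p) μ) atTop := by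
  refine ennreal_le_of_forall_pos_le_add fun ε hε => liminf_le_liminf_add ?_
  filter_upwards [(tendsto_originScaled_error hα2 μ hμα).eventually (ge_mem_nhds hε),
    eventually_gt_atTop 0] with t h1 ht
  exact (originScaled_le_scaledExpectation_add hp hα hpα μ ht).trans (add_le_add_right h1 _)

theorem tendsto_originScaled_of_rnDeriv_eq {p α : ℝ} (hp : 0 < p) (hp1 : p ≤ 1)
    (hpd : p < (d : ℝ) / 2) (hα : p < α * (1 - p / (d : ℝ))) {L : ℝ≥0∞} (hLtop : L ≠ ∞)
    (hL : Tendsto (scaledMean p (pointCost p 0) (unitMeasure d)) atTop (𝓝 L))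
    (μ : Measure (Pt d)) [IsFiniteMeasure μ] (hμα : ∫⁻ x, ENNReal.ofReal (‖x‖ ^ α) ∂μ ≠ ∞)
    (c : ℝ≥0) {Ω : Set (Pt d)} (hΩ : MeasurableSet Ω) (hΩb : Bornology.IsBounded Ω)
    (hμ : μ.rnDeriv volume =ᵐ[volume] Ω.indicator fun _ => (c : ℝ≥0∞)) :
    Tendsto (originScaled p μ) atTop
      (𝓝 (L * ∫⁻ x, (μ.rnDeriv volume x) ^ (1 - p / (d : ℝ)))) := by
  have h := tendsto_originScaled_indicator hp hp1 hpd hLtop hL c hΩ hΩb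
  rw [← withDensity_congr_ae hμ] at h
  rw [← lintegral_congr_ae (hμ.mono fun x hx => congrArg (· ^ (1 - p / (d : ℝ))) hx :
    (fun x => μ.rnDeriv volume x ^ (1 - p / (d : ℝ))) =ᵐ[volume]
      fun x => Ω.indicator (fun _ => (c : ℝ≥0∞)) x ^ (1 - p / (d : ℝ)))] at h
  refine tendsto_of_le_liminf_of_limsup_le (ennreal_le_of_forall_pos_le_add fun ε hε => ?_)
    (ennreal_le_of_forall_pos_le_add fun ε hε => ?_)
  · rw [← h.liminf_eq]
    exact liminf_le_liminf_add
      ((eventually_originScaled_le_add_of_singular hp hp1 hpd hα μ hμα hε).mono fun t ht => ht.1)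
  · rw [← h.limsup_eq]
    exact limsup_le_limsup_add
      ((eventually_originScaled_le_add_of_singular hp hp1 hpd hα μ hμα hε).mono fun t ht => ht.2)

theorem lintegral_norm_rpow_unitMeasure_ne_top {α : ℝ} (hα : 0 < α) :
    ∫⁻ x, ENNReal.ofReal (‖x‖ ^ α) ∂unitMeasure d ≠ ∞ := by
  have h : ∀ᵐ x ∂unitMeasure d, ENNReal.ofReal (‖x‖ ^ α) ≤ ENNReal.ofReal ((d : ℝ) ^ α) :=
    ae_unitMeasure.mono fun x hx => by
      rw [← pointCost_zero_eq hα]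
      exact pointCost_zero_le_of_mem_unitCell hα hx
  refine ne_top_of_le_ne_top ?_ (lintegral_mono_ae h)
  simp

end BipartiteMatching

/-! ### The main theorem -/

theorem mainTheorem3 (d : ℕ) (p : ℝ) (hp : 0 < p)
    (hdp : ((d = 1 ∨ d = 2) ∧ p < (d : ℝ) / 2) ∨ (3 ≤ d ∧ p ≤ 1)) :
    ∃ β β' : ℝ, 0 < β ∧ 0 < β' ∧
      Tendsto (BipartiteMatching.scaledExpectation p (BipartiteMatching.matchingCost d p)
          (volume.restrict (BipartiteMatching.unitCube d)))
        atTop (𝓝 (ENNReal.ofReal β)) ∧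
      Tendsto (BipartiteMatching.scaledExpectation p
          (BipartiteMatching.boundaryMatchingCost d p (BipartiteMatching.unitCube d))
          (volume.restrict (BipartiteMatching.unitCube d)))
        atTop (𝓝 (ENNReal.ofReal β')) ∧
      ∀ (μ : Measure (EuclideanSpace ℝ (Fin d))) [IsFiniteMeasure μ] (α : ℝ),
        2 * (d : ℝ) * p / ((d : ℝ) - 2 * p) < α →
        Integrable (fun x => ‖x‖ ^ α) μ →
        (ENNReal.ofReal β' * ∫⁻ x, (μ.rnDeriv volume x) ^ (1 - p / (d : ℝ)) ≤
          liminf (BipartiteMatching.scaledExpectation p (BipartiteMatching.matchingCost d p) μ)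
            atTop) ∧
        (∀ (c : ℝ≥0) (Ω : Set (EuclideanSpace ℝ (Fin d))),
          MeasurableSet Ω → Bornology.IsBounded Ω → 0 < volume Ω →
          μ.rnDeriv volume =ᵐ[volume] Ω.indicator (fun _ => (c : ℝ≥0∞)) →
          Tendsto
            (BipartiteMatching.scaledExpectation p (BipartiteMatching.matchingCost d p) μ)
            atTop
            (𝓝 (ENNReal.ofReal β * ∫⁻ x, (μ.rnDeriv volume x) ^ (1 - p / (d : ℝ))))) := by
  have hd : 0 < d := by omega
  have hd' : (0 : ℝ) < d := by exact_mod_cast hd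
  have hpd : p < (d : ℝ) / 2 := by
    rcases hdp with h | ⟨h3, h1⟩
    · exact h.2
    · have : (3 : ℝ) ≤ d := by exact_mod_cast h3
      linarith
  have hp1 : p ≤ 1 := by
    rcases hdp with ⟨h | h, -⟩ | ⟨-, h1⟩
    · subst h
      norm_num at hpd
      linarith
    · subst h
      norm_num at hpd
      linarith
    · exact h1
  -- The third condition, α > dp/(d - p), sums the annuli; the fourth, α > dp/(d - 2p), makes the
  -- excess over the full matching cost negligible.
  have hexp : ∀ α : ℝ, 2 * (d : ℝ) * p / ((d : ℝ) - 2 * p) < α →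
      0 < α ∧ p ≤ α ∧ p < α * (1 - p / (d : ℝ)) ∧ p / (2 * α) < 1 / 2 - p / (d : ℝ) := by
    intro α hα
    have hD : 0 < (d : ℝ) - 2 * p := by linarith
    have hdp0 : 0 < (d : ℝ) * p := by positivity
    have hα0 : 0 < α := lt_of_le_of_lt (by positivity) hα
    rw [div_lt_iff₀ hD] at hα
    have hαp : 0 < α * p := by positivity
    have h1 : p < α * (1 - p / (d : ℝ)) := by
      rw [one_sub_div hd'.ne', ← mul_div_assoc, lt_div_iff₀ hd']
      nlinarith
    have h2 : p / (2 * α) < 1 / 2 - p / (d : ℝ) := by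
      rw [div_sub_div _ _ two_ne_zero hd'.ne', div_lt_div_iff₀ (by positivity) (by positivity)]
      nlinarith
    refine ⟨hα0, h1.le.trans (mul_le_of_le_one_right hα0.le ?_), h1, h2⟩
    have : 0 < p / d := by positivity
    linarith
  obtain ⟨β, β', hβ, hβ', hlim, hlim'⟩ :=
    BipartiteMatching.exists_tendsto_scaledMean (d := d) hp hp1 hpd
  refine ⟨β, β', hβ, hβ', ?_, ?_, ?_⟩
  · rw [BipartiteMatching.restrict_unitCube]
    -- The uniform measure on the cube has all moments, so any exponent above the threshold will do.
    obtain ⟨hα0, hpα, -, hα2⟩ := hexp _ (lt_add_one _)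
    exact BipartiteMatching.tendsto_scaledExpectation_of_originScaled hp hp1 hα0 hpα hα2 _
      (BipartiteMatching.lintegral_norm_rpow_unitMeasure_ne_top hα0) hlim
  · rw [BipartiteMatching.restrict_unitCube]
    refine hlim'.congr fun t => ?_
    rw [BipartiteMatching.scaledExpectation, BipartiteMatching.scaledMean,
      BipartiteMatching.poissonExpectation_boundaryMatchingCost hp]
  · intro μ _ α hα hint
    obtain ⟨hα0, hpα, hα1, hα2⟩ := hexp α hα
    have hμα : ∫⁻ x, ENNReal.ofReal (‖x‖ ^ α) ∂μ ≠ ∞ := hint.lintegral_lt_top.ne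
    refine ⟨?_, fun c Ω hΩ hΩb _ hf => ?_⟩
    · exact (BipartiteMatching.le_liminf_originScaled hp hp1 hpd hα1 ENNReal.ofReal_ne_top hlim' μ
        hμα).trans (BipartiteMatching.liminf_originScaled_le hp hα0 hpα hα2 μ hμα)
    · exact BipartiteMatching.tendsto_scaledExpectation_of_originScaled hp hp1 hα0 hpα hα2 μ hμα
        (BipartiteMatching.tendsto_originScaled_of_rnDeriv_eq hp hp1 hpd hα1 ENNReal.ofReal_ne_top
          hlim μ hμα c hΩ hΩb hf)
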